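/- **Model.** Let $P$ be a probability measure on a measurable space $S$ and $Y:\mathbb R\times S\to\mathbb R$ jointly measurable; a simulation run at parameter $\theta$ with random input $s\sim P$ returns $Y(\theta,s)$, and different runs use independent inputs (no common random numbers). Put $\alpha(\theta)=\mathbb E[Y(\theta)]$, $\sigma^2(\theta)=\operatorname{Var}[Y(\theta)]$, $\sigma=\sigma(\theta_0)$, $B=\alpha^{(3)}(\theta_0)/6$, $D=\alpha^{(5)}(\theta_0)/120$. For $h\ne0$ let $\Delta(h)=\frac{Y(\theta_0+h)-Y(\theta_0-h)}{2h}$, computed from two independent runs, and let $Z(h)=\Delta(h)-\mathbb E\Delta(h)$. Assume that - $Y(\theta)$ is square integrable for $\theta$ near $\theta_0$, and $\alpha$ is five times continuously differentiable in a neighbourhood of $\theta_0$ with $\alpha^{(3)}(\theta_0)\ne0$ and $\alpha^{(5)}(\theta_0)\neq 0$; - $\sigma(\cdot)$ is continuous at $\theta_0$, $\sigma>0$, and $\limsup_{h\to0}\mathbb E[(hZ(h))^4]<\infty$; - $K\ge2$ and $c_1,\dots,c_K$ are nonzero and pairwise distinct, and their squares are not all equal. **Estimator.** Given $n$ and $n_b$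 with $Kn_b\le n$, let $h_k=c_kn_b^{-1/10}$ and let $\Delta_j(h_k)$, $1\le k\le K$, $1\le j\le n_b$, be independent pilot copies of $\Delta(h_k)$. For each $k$ let $\mathbb E_*\widehat\Delta^b_{n_b,h_k}$ and $\operatorname{Var}_*[\widehat\Delta^b_{n_b,h_k}]$ be the mean and variance of the average of $n_b$ draws, made uniformly and with replacement, from $\Delta_1(h_k),\dots,\Delta_{n_b}(h_k)$. Let $X_e$ be the $K\times2$ matrix with rows $(1,h_k^2)$, let $X_v$ be the vector with entries $\frac{n_b-1}{2n_b^2h_k^2}$, and let $$\widehat\beta_e=(\widehat\alpha',\widehat B)^\top=(X_e^\top X_e)^{-1}X_e^\top\big(\mathbb E_*\widehat\Delta^b_{n_b,h_k}\big)_k,\qquad \widehat\beta_v=(X_v^\top X_v)^{-1}X_v^\top\big(\operatorname{Var}_*[\widehat\Delta^b_{n_b,h_k}]\big)_k,\qquad \widehat h_n=\Big(\frac{\widehat\beta_v}{4n\widehat B^2}\Big)^{1/6}.$$ With $n_2=n-Kn_b$ additional sample pairs, generated at $\widehat h_n$ with fresh independent inputs, the Cor-CFD estimator is $$\widehat\Delta_{n,\widehat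 h_n}=\frac1n\Big(\sum_{i=1}^{n_2}\Delta_i(\widehat h_n)+\sum_{k=1}^K\sum_{j=1}^{n_b}\Big\{\frac{|h_k|}{|\widehat h_n|}\big(\Delta_j(h_k)-(1,h_k^2)\widehat\beta_e\big)+(1,\widehat h_n^2)\widehat\beta_e\Big\}\Big).$$ Let $n,n_b\to\infty$ along sequences with $Kn_b\le n$. Assume moreover that for some $\varepsilon\in(0,\min\{|B|,\sigma^2\})$ the random variables $n^{2/3}\big(\widehat\Delta_{n,\widehat h_n}-\alpha'(\theta_0)\big)^2\mathbf 1\{|\widehat B-B|\ge\varepsilon\text{ or }|\widehat\beta_v-\sigma^2|\ge\varepsilon\}$ are uniformly integrable from some point of the sequences on. Let $|c|=(|c_k|)_k$, $c^4=(c_k^4)_k$, let $\mathbf P$ be the orthogonal projection of $\mathbb R^K$ onto the orthogonal complement of the span of $(1)_k$ and $(c_k^2)_k$, and let $\Lambda=|c|^\top \mathbf P\,c^4$. Cube roots of negative numbers are real. **Claim.** For all large sample sizes $\widehat\Delta_{n,\widehat h_n}$ is square integrable, and the following hold. 1. If $n_b=o(n)$, then $$\mathbb E\widehat\Delta_{n,\widehat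 h_n}=\alpha'(\theta_0)+\Big(\frac{B\sigma^2}{4n}\Big)^{1/3}+o(n^{-1/3}),\qquad \operatorname{Var}[\widehat\Delta_{n,\widehat h_n}]=\Big(\frac{B^2\sigma^4}{2n^2}\Big)^{1/3}+o(n^{-2/3}),$$ $$\mathbb E\big[(\widehat\Delta_{n,\widehat h_n}-\alpha'(\theta_0))^2\big]=3\Big(\frac{B^2\sigma^4}{16n^2}\Big)^{1/3}+o(n^{-2/3}),$$ which are the bias, variance and MSE of the traditional central finite difference estimator with optimal perturbation. 2. If $Kn_b/n\to r$ with $0<r\le1$, then: (i) if $-1-\operatorname{sign}(B)\le\sqrt{\frac rK}\,\frac2\sigma D\Lambda\le1-\operatorname{sign}(B)$, then $$|\mathbb E\widehat\Delta_{n,\widehat h_n}-\alpha'(\theta_0)|\le\Big(\frac{|B|\sigma^2}{4n}\Big)^{1/3}+o(n^{-1/3});$$ (ii) otherwise $$|\mathbb E\widehat\Delta_{n,\widehat h_n}-\alpha'(\theta_0)|\le\Big(1+\sqrt{\frac rK}\,\frac2\sigma|D\Lambda|\Big)\Big(\frac{|B|\sigma^2}{4n}\Big)^{1/3}+o(n^{-1/3}).$$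 3. If $Kn_b/n\to r$ with $0<r\le1$ and $\max_kc_k^2\le2\min_kc_k^2$, then $\operatorname{Var}[\widehat\Delta_{n,\widehat h_n}]\le\big(\frac{B^2\sigma^4}{2n^2}\big)^{1/3}+o(n^{-2/3})$. -/

import Mathlib

open MeasureTheory ProbabilityTheory Filter Topology Asymptotics
open scoped Matrix ENNReal

namespace CorCFD

noncomputable section

/-! ### The simulation model

One run of the simulation at the parameter `θ` returns `Y θ s`, where the random input `s` has the
law `P`; runs with independent inputs are independent. -/

/-- The performance measure `α(θ) = 𝔼[Y(θ)]`. -/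
def perf {S : Type*} [MeasurableSpace S] (Y : ℝ → S → ℝ) (P : Measure S) (θ : ℝ) : ℝ :=
  ∫ s, Y θ s ∂P

/-- The standard deviation `σ(θ)` of `Y(θ)`. -/
def sd {S : Type*} [MeasurableSpace S] (Y : ℝ → S → ℝ) (P : Measure S) (θ : ℝ) : ℝ :=
  Real.sqrt (variance (Y θ) P)

/-- `B = α⁽³⁾(θ₀) / 6`. -/
def coefB {S : Type*} [MeasurableSpace S] (Y : ℝ → S → ℝ) (P : Measure S) (θ₀ : ℝ) : ℝ :=
  iteratedDeriv 3 (perf Y P) θ₀ / 6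

/-- `D = α⁽⁵⁾(θ₀) / 120`. -/
def coefD {S : Type*} [MeasurableSpace S] (Y : ℝ → S → ℝ) (P : Measure S) (θ₀ : ℝ) : ℝ :=
  iteratedDeriv 5 (perf Y P) θ₀ / 120

/-- The central finite difference `Δ(h)`, computed from the run at `θ₀ + h` with input `s` and
the run at `θ₀ - h` with input `t`. -/
def cfd {S : Type*} (Y : ℝ → S → ℝ) (θ₀ h : ℝ) (s t : S) : ℝ :=
  (Y (θ₀ + h) s - Y (θ₀ - h) t) / (2 * h)

/-- The zero-mean error `Z(h)` of `Δ(h)`. -/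
def cfdNoise {S : Type*} [MeasurableSpace S] (Y : ℝ → S → ℝ) (P : Measure S) (θ₀ h : ℝ)
    (p : S × S) : ℝ :=
  cfd Y θ₀ h p.1 p.2 - (perf Y P (θ₀ + h) - perf Y P (θ₀ - h)) / (2 * h)

/-! ### The bootstrap -/

/-- The bootstrap mean `𝔼_*` of the average of `N` draws, uniformly and with replacement, from
the sample `x`; a resample is a map `τ : Fin N → Fin N`. -/
def bootMean {N : ℕ} (x : Fin N → ℝ) : ℝ :=
  (∑ τ : Fin N → Fin N, (∑ i, x (τ i)) / N) / (N : ℝ) ^ N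

/-- The bootstrap variance `Var_*` of the average of `N` draws from the sample `x`. -/
def bootVar {N : ℕ} (x : Fin N → ℝ) : ℝ :=
  (∑ τ : Fin N → Fin N, ((∑ i, x (τ i)) / N - bootMean x) ^ 2) / (N : ℝ) ^ N

/-! ### Least squares -/

/-- The `K × 2` design matrix `X_e`, with rows `(1, h_k²)`. -/
def designE {K : ℕ} (h : Fin K → ℝ) : Matrix (Fin K) (Fin 2) ℝ :=
  Matrix.of fun k => ![1, h k ^ 2]

/-- The regression estimator `β̂_e = (α̂'(θ₀), B̂)`; `Δ k j` is the `j`-th pilot finite difference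
at `h k`. -/
def betaE {K N : ℕ} (h : Fin K → ℝ) (Δ : Fin K → Fin N → ℝ) : Fin 2 → ℝ :=
  (((designE h)ᵀ * designE h)⁻¹ * (designE h)ᵀ) *ᵥ fun k => bootMean (Δ k)

/-- The design vector `X_v`. -/
def designV {K : ℕ} (N : ℕ) (h : Fin K → ℝ) (k : Fin K) : ℝ :=
  ((N : ℝ) - 1) / (2 * (N : ℝ) ^ 2 * h k ^ 2)

/-- The regression estimator `β̂_v` of `σ²(θ₀)`. -/
def betaV {K N : ℕ} (h : Fin K → ℝ) (Δ : Fin K → Fin N → ℝ) : ℝ :=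
  (designV N h ⬝ᵥ designV N h)⁻¹ * (designV N h ⬝ᵥ fun k => bootVar (Δ k))

/-- The estimated optimal perturbation `ĥ_n = (β̂_v / (4 n B̂²))^{1/6}`. -/
def hHat {K N : ℕ} (n : ℕ) (h : Fin K → ℝ) (Δ : Fin K → Fin N → ℝ) : ℝ :=
  (betaV h Δ / (4 * n * betaE h Δ 1 ^ 2)) ^ (1 / 6 : ℝ)

/-- `(1, x²) β̂_e`. -/
def fitE {K N : ℕ} (h : Fin K → ℝ) (Δ : Fin K → Fin N → ℝ) (x : ℝ) : ℝ :=
  betaE h Δ 0 + x ^ 2 * betaE h Δ 1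

/-- The transformed pilot sample `Δ_j^{cor}(h_k)`. -/
def corSample {K N : ℕ} (n : ℕ) (h : Fin K → ℝ) (Δ : Fin K → Fin N → ℝ)
    (k : Fin K) (j : Fin N) : ℝ :=
  |h k| / |hHat n h Δ| * (Δ k j - fitE h Δ (h k)) + fitE h Δ (hHat n h Δ)

/-! ### The Cor-CFD estimator -/

/-- Labels of the simulation runs: pilot runs (`k`-th perturbation, `j`-th pair) and additional
runs (`i`-th pair); the Boolean says whether the run is at `θ₀ + h` (`true`) or at `θ₀ - h`. -/
inductive Run (K : ℕ) : Type
  | pilot (k : Fin K) (j : ℕ) (plus : Bool) : Run K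
  | fresh (i : ℕ) (plus : Bool) : Run K

/-- The pilot perturbations `h_k = c_k n_b^{-1/10}`. -/
def pilotPert {K : ℕ} (c : Fin K → ℝ) (nb : ℕ) (k : Fin K) : ℝ :=
  c k * (nb : ℝ) ^ (-(1 / 10) : ℝ)

/-- The pilot finite differences `Δ_j(h_k)`, when the run `i` has the random input `u i`. -/
def pilotDelta {S : Type*} {K : ℕ} (Y : ℝ → S → ℝ) (θ₀ : ℝ) (c : Fin K → ℝ) (nb : ℕ)
    (u : Run K → S) (k : Fin K) (j : Fin nb) : ℝ :=
  cfd Y θ₀ (pilotPert c nb k) (u (.pilot k j true)) (u (.pilot k j false))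

/-- The Cor-CFD estimator of `α'(θ₀)` with `n` sample pairs in total, of which `K * nb` are pilot
pairs and `n - K * nb` are additional pairs at the estimated perturbation `ĥ_n`. -/
def corCFD {S : Type*} {K : ℕ} (Y : ℝ → S → ℝ) (θ₀ : ℝ) (c : Fin K → ℝ) (n nb : ℕ)
    (u : Run K → S) : ℝ :=
  (1 / (n : ℝ)) *
    ((∑ i ∈ Finset.range (n - K * nb),
        cfd Y θ₀ (hHat n (pilotPert c nb) (pilotDelta Y θ₀ c nb u))
          (u (.fresh i true)) (u (.fresh i false)))
      + ∑ k : Fin K, ∑ j : Fin nb,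
          corSample n (pilotPert c nb) (pilotDelta Y θ₀ c nb u) k j)

/-! ### Constants of the asymptotic expansions -/

/-- The projection `I - X (Xᵀ X)⁻¹ Xᵀ` with `X = designE x`. It is the same for
`x = c` and for every nonzero multiple of `c`, such as `x = pilotPert c nb`. -/
def projE {K : ℕ} (x : Fin K → ℝ) : Matrix (Fin K) (Fin K) ℝ :=
  1 - designE x * ((designE x)ᵀ * designE x)⁻¹ * (designE x)ᵀ

/-- `Λ = |c|ᵀ P c⁴`, with entrywise absolute value and power. -/
def Lam {K : ℕ} (c : Fin K → ℝ) : ℝ :=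
  (fun k => |c k|) ⬝ᵥ (projE c *ᵥ fun k => c k ^ 4)

/-- The real cube root, also of negative numbers. -/
def cbrt (x : ℝ) : ℝ :=
  Real.sign x * |x| ^ (1 / 3 : ℝ)

end

end CorCFD

namespace CorCFD

/-- Peano's form of Taylor's theorem of order five. -/
theorem taylor_five_isLittleO {f : ℝ → ℝ} {x₀ : ℝ} (hf : ContDiffAt ℝ 5 f x₀) :
    (fun h => f (x₀ + h) - ∑ i ∈ Finset.range 6, iteratedDeriv i f x₀ / i.factorial * h ^ i)
      =o[𝓝 0] fun h => h ^ 5 := by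
  obtain ⟨u, hu, hfu⟩ := hf.contDiffOn (m := 5) le_rfl (by simp)
  obtain ⟨r, hr, hru⟩ := Metric.mem_nhds_iff.1 hu
  have hx : x₀ ∈ Metric.ball x₀ r := Metric.mem_ball_self hr
  have key := taylor_isLittleO (n := 5) (convex_ball x₀ r) hx (hfu.mono hru)
  rw [Metric.isOpen_ball.nhdsWithin_eq hx] at key
  have ht : Tendsto (fun h : ℝ => x₀ + h) (𝓝 0) (𝓝 x₀) := by
    have : Continuous fun h : ℝ => x₀ + h := by fun_prop
    simpa using this.tendsto 0
  have key2 := key.comp_tendsto ht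
  refine (key2.congr (fun h => ?_) fun h => ?_)
  · simp only [Function.comp_apply, taylorWithinEval_succ, taylor_within_zero_eval,
      Finset.sum_range_succ, Finset.sum_range_zero]
    have e : ∀ k, iteratedDerivWithin k f (Metric.ball x₀ r) x₀ = iteratedDeriv k f x₀ :=
      fun k => iteratedDerivWithin_of_isOpen Metric.isOpen_ball hx
    simp only [e, add_sub_cancel_left, smul_eq_mul, iteratedDeriv_zero, Nat.factorial]
    push_cast
    ring
  · simp

theorem central_difference_expansion {f : ℝ → ℝ} {x₀ : ℝ} (hf : ContDiffAt ℝ 5 f x₀) :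
    (fun h => (f (x₀ + h) - f (x₀ - h)) / (2 * h) - deriv f x₀ - iteratedDeriv 3 f x₀ / 6 * h ^ 2
        - iteratedDeriv 5 f x₀ / 120 * h ^ 4) =o[𝓝[≠] 0] fun h => h ^ 4 := by
  have h1 := taylor_five_isLittleO hf
  have hneg : Tendsto (fun h : ℝ => -h) (𝓝 0) (𝓝 0) := by
    simpa using (continuous_neg (G := ℝ)).tendsto 0
  have h2 := h1.comp_tendsto hneg
  have h3 : (fun h : ℝ => (f (x₀ + h) - ∑ i ∈ Finset.range 6,
      iteratedDeriv i f x₀ / i.factorial * h ^ i) - (f (x₀ + -h) - ∑ i ∈ Finset.range 6,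
      iteratedDeriv i f x₀ / i.factorial * (-h) ^ i)) =o[𝓝 0] fun h => h ^ 5 := by
    refine h1.sub (h2.trans_isBigO ?_)
    refine IsBigO.of_bound 1 (Eventually.of_forall fun h => ?_)
    simp
  have h4 := (h3.mono (nhdsWithin_le_nhds (s := {0}ᶜ))).mul_isBigO
    (isBigO_refl (fun h : ℝ => h⁻¹) (𝓝[≠] 0))
  refine ((h4.const_mul_left (1 / 2)).congr' ?_ ?_)
  · filter_upwards [self_mem_nhdsWithin] with h hh
    have hh : h ≠ 0 := hh
    simp only [Finset.sum_range_succ, Finset.sum_range_zero, Nat.factorial, iteratedDeriv_one,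
      ← sub_eq_add_neg]
    push_cast
    field_simp
    ring
  · filter_upwards [self_mem_nhdsWithin] with h hh
    have hh : h ≠ 0 := hh
    field_simp

theorem sum_prod_apply {N : ℕ} (f : Fin N → Fin N → ℝ) :
    ∑ τ : Fin N → Fin N, ∏ i, f i (τ i) = ∏ i, ∑ j, f i j := by
  rw [Finset.prod_univ_sum, Fintype.piFinset_univ]

theorem sum_apply_resample {N : ℕ} (y : Fin N → ℝ) (i : Fin N) :
    (∑ τ : Fin N → Fin N, y (τ i)) * N = (N : ℝ) ^ N * ∑ j, y j := by
  have h := sum_prod_apply (fun i' j => if i' = i then y j else 1)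
  have e : ∀ i', (∑ j : Fin N, if i' = i then y j else 1) = if i' = i then ∑ j, y j else (N : ℝ) := by
    intro i'; split_ifs <;> simp
  simp only [e, Finset.prod_ite_eq', Finset.mem_univ, if_true] at h
  rw [h, Finset.prod_ite, Finset.filter_eq', if_pos (Finset.mem_univ _), Finset.prod_singleton,
    Finset.filter_ne', Finset.prod_const, Finset.card_erase_of_mem (Finset.mem_univ _),
    Finset.card_univ, Fintype.card_fin, mul_assoc, ← pow_succ, Nat.sub_add_cancel i.pos, mul_comm]

theorem sum_apply_mul_apply_resample {N : ℕ} (y : Fin N → ℝ) (hy : ∑ j, y j = 0) {i i' : Fin N}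
    (hi : i ≠ i') : ∑ τ : Fin N → Fin N, y (τ i) * y (τ i') = 0 := by
  have h := sum_prod_apply (fun l j => (if l = i then y j else 1) * (if l = i' then y j else 1))
  simp only [Finset.prod_mul_distrib, Finset.prod_ite_eq', Finset.mem_univ, if_true] at h
  rw [h]
  refine Finset.prod_eq_zero (Finset.mem_univ i) ?_
  simp [hi, hy]

theorem bootMean_eq {N : ℕ} (hN : 0 < N) (x : Fin N → ℝ) : bootMean x = (∑ j, x j) / N := by
  have hN' : (N : ℝ) ≠ 0 := by positivity
  have : ∀ i, ∑ τ : Fin N → Fin N, x (τ i) = (N : ℝ) ^ N * (∑ j, x j) / N := fun i => by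
    rw [eq_div_iff hN', sum_apply_resample]
  rw [bootMean, ← Finset.sum_div, Finset.sum_comm, Finset.sum_congr rfl fun i _ => this i]
  rw [Finset.sum_const, Finset.card_univ, Fintype.card_fin, nsmul_eq_mul]
  field_simp

theorem bootVar_eq {N : ℕ} (hN : 0 < N) (x : Fin N → ℝ) :
    bootVar x = (∑ j, (x j - (∑ i, x i) / N) ^ 2) / (N : ℝ) ^ 2 := by
  have hN' : (N : ℝ) ≠ 0 := by positivity
  set y : Fin N → ℝ := fun j => x j - (∑ i, x i) / N with hydef
  have hy : ∑ j, y j = 0 := by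
    simp only [hydef, Finset.sum_sub_distrib, Finset.sum_const, Finset.card_univ, Fintype.card_fin,
      nsmul_eq_mul]
    field_simp
    simp
  have h1 : ∀ τ : Fin N → Fin N, ((∑ i, x (τ i)) / N - bootMean x) ^ 2
      = (∑ i, ∑ i', y (τ i) * y (τ i')) / (N : ℝ) ^ 2 := by
    intro τ
    have : ∑ i, y (τ i) = (∑ i, x (τ i)) - N * bootMean x := by
      simp [hydef, bootMean_eq hN]
    rw [← Finset.sum_mul_sum, this]
    field_simp
  have h2 : ∀ i : Fin N, ∑ i', ∑ τ : Fin N → Fin N, y (τ i) * y (τ i')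
      = (N : ℝ) ^ N * (∑ j, y j ^ 2) / N := by
    intro i
    rw [Finset.sum_eq_single i (fun i' _ hi => sum_apply_mul_apply_resample y hy hi.symm)
      (by simp), eq_div_iff hN', ← sum_apply_resample (fun j => y j ^ 2) i]
    simp only [sq]
  rw [bootVar, Finset.sum_congr rfl fun τ _ => h1 τ, ← Finset.sum_div, Finset.sum_comm]
  rw [Finset.sum_congr rfl fun i _ => (Finset.sum_comm.trans (h2 i))]
  rw [Finset.sum_const, Finset.card_univ, Fintype.card_fin, nsmul_eq_mul]
  generalize ∑ j, y j ^ 2 = q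
  field_simp

/-! ### Algebra of the regression -/

/-- The matrix `(Xᵀ X)⁻¹ Xᵀ` of the least squares estimator, `X = designE c`. -/
noncomputable def lsq {K : ℕ} (c : Fin K → ℝ) : Matrix (Fin 2) (Fin K) ℝ :=
  ((designE c)ᵀ * designE c)⁻¹ * (designE c)ᵀ

theorem designE_mul {K : ℕ} (c : Fin K → ℝ) (t : ℝ) :
    designE (fun k => c k * t) = designE c * Matrix.diagonal ![1, t ^ 2] := by
  ext k i
  rw [Matrix.mul_diagonal]
  fin_cases i <;> simp [designE, mul_pow]

theorem isUnit_det_designE {K : ℕ} {c : Fin K → ℝ} (hc : ∃ j k, c j ^ 2 ≠ c k ^ 2) :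
    IsUnit ((designE c)ᵀ * designE c).det := by
  obtain ⟨j, k, hjk⟩ := hc
  rw [isUnit_iff_ne_zero, Matrix.det_fin_two]
  simp only [Matrix.mul_apply, Matrix.transpose_apply, designE, Matrix.of_apply,
    Matrix.cons_val_zero, Matrix.cons_val_one]
  have h : ∑ i : Fin K, ∑ l : Fin K, (c i ^ 2 - c l ^ 2) ^ 2
      = 2 * ((∑ i : Fin K, (1:ℝ) * 1) * (∑ i, c i ^ 2 * c i ^ 2)
        - (∑ i, 1 * c i ^ 2) * (∑ i, c i ^ 2 * 1)) := by
    have : ∀ i l : Fin K, (c i ^ 2 - c l ^ 2) ^ 2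
        = (c i ^ 2 * c i ^ 2) * 1 - 2 * (c i ^ 2 * c l ^ 2) + 1 * (c l ^ 2 * c l ^ 2) := by
      intros; ring
    simp only [this, Finset.sum_add_distrib, Finset.sum_sub_distrib,
      ← Finset.mul_sum, ← Finset.sum_mul, mul_one, one_mul]
    simp only [Finset.sum_const, Finset.card_univ, Fintype.card_fin, nsmul_eq_mul, mul_one]
    have e : ∑ x, c x ^ 2 * (K * c x ^ 2) = K * ∑ x, c x ^ 2 * c x ^ 2 := by
      rw [Finset.mul_sum]
      exact Finset.sum_congr rfl fun x _ => by ring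
    rw [e]
    ring
  have h2 : 0 < ∑ i : Fin K, ∑ l : Fin K, (c i ^ 2 - c l ^ 2) ^ 2 := by
    refine Finset.sum_pos' (fun i _ => Finset.sum_nonneg fun l _ => sq_nonneg _)
      ⟨j, Finset.mem_univ _, Finset.sum_pos' (fun l _ => sq_nonneg _)
        ⟨k, Finset.mem_univ _, ?_⟩⟩
    have := sub_ne_zero.2 hjk
    positivity
  intro h0
  rw [h0] at h
  linarith

theorem isUnit_diagonal {t : ℝ} (ht : t ≠ 0) : IsUnit (Matrix.diagonal ![(1 : ℝ), t ^ 2]).det := by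
  rw [isUnit_iff_ne_zero, Matrix.det_diagonal]
  simp [ht]

theorem lsq_mul {K : ℕ} (c : Fin K → ℝ) {t : ℝ} (ht : t ≠ 0) :
    lsq (fun k => c k * t) = (Matrix.diagonal ![1, t ^ 2])⁻¹ * lsq c := by
  have hD := isUnit_diagonal ht
  rw [lsq, designE_mul, Matrix.transpose_mul, Matrix.diagonal_transpose,
    Matrix.mul_assoc (Matrix.diagonal _), ← Matrix.mul_assoc _ (designE c), Matrix.mul_inv_rev,
    Matrix.mul_inv_rev, Matrix.mul_assoc, Matrix.mul_assoc,
    Matrix.nonsing_inv_mul_cancel_left _ _ hD, lsq]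

theorem projE_eq {K : ℕ} (c : Fin K → ℝ) : projE c = 1 - designE c * lsq c := by
  rw [projE, lsq, Matrix.mul_assoc]

theorem lsq_mul_designE {K : ℕ} {c : Fin K → ℝ} (hc : ∃ j k, c j ^ 2 ≠ c k ^ 2) :
    lsq c * designE c = 1 := by
  rw [lsq, Matrix.mul_assoc, Matrix.nonsing_inv_mul _ (isUnit_det_designE hc)]

theorem projE_mul_designE {K : ℕ} {c : Fin K → ℝ} (hc : ∃ j k, c j ^ 2 ≠ c k ^ 2) :
    projE c * designE c = 0 := by
  rw [projE_eq, Matrix.sub_mul, Matrix.mul_assoc, lsq_mul_designE hc]; simp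

theorem projE_transpose {K : ℕ} (c : Fin K → ℝ) : (projE c)ᵀ = projE c := by
  rw [projE]
  simp only [Matrix.transpose_sub, Matrix.transpose_mul, Matrix.transpose_one,
    Matrix.transpose_transpose, Matrix.transpose_nonsing_inv, Matrix.mul_assoc]

theorem projE_mul_self {K : ℕ} {c : Fin K → ℝ} (hc : ∃ j k, c j ^ 2 ≠ c k ^ 2) :
    projE c * projE c = projE c := by
  nth_rewrite 2 [projE_eq]
  rw [Matrix.mul_sub, ← Matrix.mul_assoc, projE_mul_designE hc]; simp

theorem designE_mulVec {K : ℕ} (c : Fin K → ℝ) (b : Fin 2 → ℝ) (k : Fin K) :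
    (designE c *ᵥ b) k = b 0 + c k ^ 2 * b 1 := by
  simp [designE, Matrix.mulVec, dotProduct, Fin.sum_univ_two]

/-- The weights `P |c|` with which the pilot residuals enter the bias. -/
noncomputable def projAbs {K : ℕ} (c : Fin K → ℝ) : Fin K → ℝ := projE c *ᵥ fun k => |c k|

theorem dotProduct_projE {K : ℕ} (c x y : Fin K → ℝ) :
    x ⬝ᵥ (projE c *ᵥ y) = (projE c *ᵥ x) ⬝ᵥ y := by
  rw [Matrix.dotProduct_mulVec, ← Matrix.mulVec_transpose, projE_transpose]

theorem Lam_eq_sum {K : ℕ} (c : Fin K → ℝ) : Lam c = ∑ k, projAbs c k * c k ^ 4 := by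
  rw [Lam, dotProduct_projE]; rfl

/-- Regression of data which are a perturbation of `a + B h²`. -/
theorem betaE_of_resid {K N : ℕ} {c : Fin K → ℝ} (hc : ∃ j k, c j ^ 2 ≠ c k ^ 2) {t : ℝ}
    (ht : t ≠ 0) (Δ : Fin K → Fin N → ℝ) (a B : ℝ) (R : Fin K → ℝ)
    (hR : ∀ k, bootMean (Δ k) = a + B * (c k * t) ^ 2 + t ^ 4 * R k) :
    betaE (fun k => c k * t) Δ 0 = a + t ^ 4 * (lsq c *ᵥ R) 0 ∧
    betaE (fun k => c k * t) Δ 1 = B + t ^ 2 * (lsq c *ᵥ R) 1 := by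
  have h1 : (fun k => bootMean (Δ k)) = designE c *ᵥ ![a, B * t ^ 2] + t ^ 4 • R := by
    ext k
    rw [hR, Pi.add_apply, designE_mulVec]
    simp
    ring
  have h2 : betaE (fun k => c k * t) Δ
      = (Matrix.diagonal ![1, t ^ 2])⁻¹ *ᵥ (![a, B * t ^ 2] + t ^ 4 • (lsq c *ᵥ R)) := by
    have : betaE (fun k => c k * t) Δ = lsq (fun k => c k * t) *ᵥ fun k => bootMean (Δ k) := rfl
    rw [this, h1, lsq_mul c ht, ← Matrix.mulVec_mulVec, Matrix.mulVec_add, Matrix.mulVec_mulVec,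
      lsq_mul_designE hc, Matrix.one_mulVec, Matrix.mulVec_smul]
  have h3 : (Matrix.diagonal ![1, t ^ 2])⁻¹ = Matrix.diagonal ![1, (t ^ 2)⁻¹] := by
    refine Matrix.inv_eq_left_inv ?_
    rw [Matrix.diagonal_mul_diagonal, ← Matrix.diagonal_one]
    congr 1
    ext i
    fin_cases i <;> simp [ht]
  rw [h2, h3]
  simp only [Matrix.mulVec_diagonal]
  constructor
  · simp
  · simp
    field_simp

theorem sum_abs_mul_resid {K N : ℕ} {c : Fin K → ℝ} (hc : ∃ j k, c j ^ 2 ≠ c k ^ 2) {t : ℝ}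
    (ht : 0 < t) (Δ : Fin K → Fin N → ℝ) (a B : ℝ) (R : Fin K → ℝ)
    (hR : ∀ k, bootMean (Δ k) = a + B * (c k * t) ^ 2 + t ^ 4 * R k) :
    ∑ k, |c k * t| * (bootMean (Δ k) - fitE (fun k => c k * t) Δ (c k * t))
      = t ^ 5 * ∑ k, projAbs c k * R k := by
  obtain ⟨h0, h1⟩ := betaE_of_resid hc ht.ne' Δ a B R hR
  have h2 : ∀ k, bootMean (Δ k) - fitE (fun k => c k * t) Δ (c k * t)
      = t ^ 4 * (projE c *ᵥ R) k := by
    intro k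
    rw [fitE, h0, h1, hR, projE_eq, Matrix.sub_mulVec, Matrix.one_mulVec, ← Matrix.mulVec_mulVec,
      Pi.sub_apply, designE_mulVec]
    ring
  have h3 := dotProduct_projE c (fun k => |c k|) R
  simp only [dotProduct] at h3
  rw [← projAbs] at h3
  rw [← h3, Finset.mul_sum]
  refine Finset.sum_congr rfl fun k _ => ?_
  rw [h2, abs_mul, abs_of_pos ht]
  ring

theorem sum_projAbs_sq_div_le {K : ℕ} {c : Fin K → ℝ} (hc0 : ∀ k, c k ≠ 0)
    (hc : ∃ j k, c j ^ 2 ≠ c k ^ 2) (hratio : ∀ j k, c j ^ 2 ≤ 2 * c k ^ 2) :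
    ∑ k, projAbs c k ^ 2 / c k ^ 2 ≤ K := by
  obtain ⟨j₀, -, -⟩ := id hc
  obtain ⟨k₀, -, hk₀⟩ := Finset.exists_min_image Finset.univ (fun k => |c k|) ⟨j₀, Finset.mem_univ _⟩
  set m := |c k₀| with hm
  have hmpos : 0 < m := abs_pos.2 (hc0 _)
  set v : Fin K → ℝ := fun k => |c k| - m with hv
  have hPv : projAbs c = projE c *ᵥ v := by
    have h1 : (fun _ : Fin K => m) = designE c *ᵥ ![m, 0] := by
      ext k; rw [designE_mulVec]; simp
    have h2 : v = (fun k => |c k|) - fun _ => m := rfl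
    rw [h2, Matrix.mulVec_sub, h1, Matrix.mulVec_mulVec, projE_mul_designE hc, projAbs]
    simp
  have hsq : ∑ k, projAbs c k ^ 2 ≤ ∑ k, v k ^ 2 := by
    have e1 : ∑ k, projAbs c k ^ 2 = ∑ k, projAbs c k * v k := by
      have h3 := dotProduct_projE c (projE c *ᵥ v) v
      rw [Matrix.mulVec_mulVec, projE_mul_self hc, ← hPv] at h3
      simpa [dotProduct, sq] using h3
    have e2 : ∑ k, (v k ^ 2 - projAbs c k ^ 2) = ∑ k, (v k - projAbs c k) ^ 2 := by
      have : ∀ k, (v k - projAbs c k) ^ 2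
          = (v k ^ 2 - projAbs c k ^ 2) + 2 * (projAbs c k ^ 2 - projAbs c k * v k) := by
        intro k; ring
      simp only [this, Finset.sum_add_distrib, ← Finset.mul_sum, Finset.sum_sub_distrib, e1]
      ring
    have e3 : 0 ≤ ∑ k, (v k - projAbs c k) ^ 2 := Finset.sum_nonneg fun _ _ => sq_nonneg _
    rw [← e2, Finset.sum_sub_distrib] at e3
    linarith
  have hvm : ∀ k, v k ^ 2 ≤ m ^ 2 := by
    intro k
    have h1 : m ≤ |c k| := hk₀ k (Finset.mem_univ _)
    have h2 : |c k| ^ 2 ≤ 2 * m ^ 2 := by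
      rw [sq_abs, hm, sq_abs]; exact hratio k k₀
    have h3 : |c k| ≤ 2 * m := by nlinarith
    simp only [hv]
    nlinarith
  calc ∑ k, projAbs c k ^ 2 / c k ^ 2 ≤ ∑ k, projAbs c k ^ 2 / m ^ 2 := by
        refine Finset.sum_le_sum fun k _ => ?_
        have h1 : m ≤ |c k| := hk₀ k (Finset.mem_univ _)
        rw [← sq_abs (c k)]
        gcongr
    _ = (∑ k, projAbs c k ^ 2) / m ^ 2 := by rw [Finset.sum_div]
    _ ≤ (∑ k : Fin K, m ^ 2) / m ^ 2 := by
        exact div_le_div_of_nonneg_right (hsq.trans (Finset.sum_le_sum fun k _ => hvm k)) (sq_nonneg m)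
    _ = K := by
        simp [hmpos.ne']

/-! ### Null and bounded sequences in `L^p` -/

/-- A sequence of random variables which tends to zero in `L^p`. -/
def LpNull {Ω : Type*} [MeasurableSpace Ω] (μ : Measure Ω) (p : ℝ≥0∞) (f : ℕ → Ω → ℝ) : Prop :=
  (∀ m, AEStronglyMeasurable (f m) μ) ∧ Tendsto (fun m => eLpNorm (f m) p μ) atTop (𝓝 0)

/-- A sequence of random variables which is eventually bounded in `L^p`. -/
def LpBdd {Ω : Type*} [MeasurableSpace Ω] (μ : Measure Ω) (p : ℝ≥0∞) (f : ℕ → Ω → ℝ) : Prop :=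
  (∀ m, AEStronglyMeasurable (f m) μ) ∧
    ∃ C : ℝ≥0∞, C ≠ ⊤ ∧ ∀ᶠ m in atTop, eLpNorm (f m) p μ ≤ C

/-- A sequence of random variables which tends to zero in probability. -/
def ProbNull {Ω : Type*} [MeasurableSpace Ω] (μ : Measure Ω) (f : ℕ → Ω → ℝ) : Prop :=
  ∀ δ : ℝ, 0 < δ → Tendsto (fun m => μ {ω | δ ≤ |f m ω|}) atTop (𝓝 0)

variable {Ω : Type*} [MeasurableSpace Ω] {μ : Measure Ω}

theorem LpNull.memLp {p : ℝ≥0∞} {f : ℕ → Ω → ℝ} (h : LpNull μ p f) :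
    ∀ᶠ m in atTop, MemLp (f m) p μ := by
  filter_upwards [h.2.eventually_lt_const (by simp : (0 : ℝ≥0∞) < ⊤)] with m hm
  exact ⟨h.1 m, hm⟩

theorem LpNull.add {p : ℝ≥0∞} (hp : 1 ≤ p) {f g : ℕ → Ω → ℝ} (hf : LpNull μ p f)
    (hg : LpNull μ p g) : LpNull μ p (fun m ω => f m ω + g m ω) := by
  refine ⟨fun m => (hf.1 m).add (hg.1 m), ?_⟩
  refine tendsto_of_tendsto_of_tendsto_of_le_of_le tendsto_const_nhds
    (by simpa using hf.2.add hg.2) (fun _ => zero_le) fun m => ?_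
  exact eLpNorm_add_le (hf.1 m) (hg.1 m) hp

theorem LpBdd.add {p : ℝ≥0∞} (hp : 1 ≤ p) {f g : ℕ → Ω → ℝ} (hf : LpBdd μ p f)
    (hg : LpBdd μ p g) : LpBdd μ p (fun m ω => f m ω + g m ω) := by
  obtain ⟨C, hC, hm⟩ := hf.2
  obtain ⟨C', hC', hm'⟩ := hg.2
  refine ⟨fun m => (hf.1 m).add (hg.1 m), C + C', by finiteness, ?_⟩
  filter_upwards [hm, hm'] with m hm hm'
  exact (eLpNorm_add_le (hf.1 m) (hg.1 m) hp).trans (add_le_add hm hm')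

theorem LpNull.of_le {p : ℝ≥0∞} {f g : ℕ → Ω → ℝ} (hg : LpNull μ p g)
    (hf : ∀ m, AEStronglyMeasurable (f m) μ) (C : ℝ)
    (h : ∀ᶠ m in atTop, ∀ ω, |f m ω| ≤ C * |g m ω|) : LpNull μ p f := by
  refine ⟨hf, ?_⟩
  have h1 : Tendsto (fun m => ENNReal.ofReal C * eLpNorm (g m) p μ) atTop (𝓝 0) := by
    simpa using ENNReal.Tendsto.const_mul hg.2 (Or.inr ENNReal.ofReal_ne_top)
  refine tendsto_of_tendsto_of_tendsto_of_le_of_le' tendsto_const_nhds h1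
    (Eventually.of_forall fun _ => zero_le) ?_
  filter_upwards [h] with m hm
  exact eLpNorm_le_mul_eLpNorm_of_ae_le_mul (Eventually.of_forall hm) p

theorem LpBdd.of_le {p : ℝ≥0∞} {f g : ℕ → Ω → ℝ} (hg : LpBdd μ p g)
    (hf : ∀ m, AEStronglyMeasurable (f m) μ) (C : ℝ)
    (h : ∀ᶠ m in atTop, ∀ ω, |f m ω| ≤ C * |g m ω|) : LpBdd μ p f := by
  obtain ⟨C', hC', hm'⟩ := hg.2
  refine ⟨hf, ENNReal.ofReal C * C', by finiteness, ?_⟩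
  filter_upwards [h, hm'] with m hm hm'
  exact (eLpNorm_le_mul_eLpNorm_of_ae_le_mul (Eventually.of_forall hm) p).trans (by gcongr)

theorem LpNull.congr {p : ℝ≥0∞} {f g : ℕ → Ω → ℝ} (hg : LpNull μ p g)
    (hf : ∀ m, AEStronglyMeasurable (f m) μ) (h : ∀ᶠ m in atTop, ∀ ω, f m ω = g m ω) :
    LpNull μ p f :=
  hg.of_le hf 1 (h.mono fun m hm ω => by simp [hm ω])

/-- The product of a bounded and a null sequence. -/
theorem LpNull.bdd_mul {p : ℝ≥0∞} {f g : ℕ → Ω → ℝ} (hg : LpNull μ p g)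
    (hf : ∀ m, AEStronglyMeasurable (f m) μ) {C : ℝ} (h : ∀ᶠ m in atTop, ∀ ω, |f m ω| ≤ C) :
    LpNull μ p (fun m ω => f m ω * g m ω) := by
  refine hg.of_le (fun m => (hf m).mul (hg.1 m)) C (h.mono fun m hm ω => ?_)
  rw [abs_mul]
  exact mul_le_mul_of_nonneg_right (hm ω) (abs_nonneg _)

theorem LpBdd.bdd_mul {p : ℝ≥0∞} {f g : ℕ → Ω → ℝ} (hg : LpBdd μ p g)
    (hf : ∀ m, AEStronglyMeasurable (f m) μ) {C : ℝ} (h : ∀ᶠ m in atTop, ∀ ω, |f m ω| ≤ C) :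
    LpBdd μ p (fun m ω => f m ω * g m ω) := by
  refine hg.of_le (fun m => (hf m).mul (hg.1 m)) C (h.mono fun m hm ω => ?_)
  rw [abs_mul]
  exact mul_le_mul_of_nonneg_right (hm ω) (abs_nonneg _)

/-- The product of a vanishing deterministic sequence and a bounded sequence. -/
theorem LpBdd.null_mul {p : ℝ≥0∞} {g : ℕ → Ω → ℝ} (hg : LpBdd μ p g) {s : ℕ → ℝ}
    (hs : Tendsto s atTop (𝓝 0)) : LpNull μ p (fun m ω => s m * g m ω) := by
  obtain ⟨C, hC, hm⟩ := hg.2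
  refine ⟨fun m => (hg.1 m).const_mul _, ?_⟩
  have h1 : Tendsto (fun m => ENNReal.ofReal |s m| * C) atTop (𝓝 0) := by
    have : Tendsto (fun m => ENNReal.ofReal |s m|) atTop (𝓝 0) := by
      simpa using ENNReal.tendsto_ofReal hs.abs
    simpa using ENNReal.Tendsto.mul_const this (Or.inr hC)
  refine tendsto_of_tendsto_of_tendsto_of_le_of_le' tendsto_const_nhds h1
    (Eventually.of_forall fun _ => zero_le) ?_
  filter_upwards [hm] with m hm
  refine (eLpNorm_le_mul_eLpNorm_of_ae_le_mul (c := |s m|) (g := g m)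
    (Eventually.of_forall fun ω => ?_) p).trans (by gcongr)
  simp

/-- Hölder's inequality for a null and a bounded sequence. -/
theorem LpNull.mul_bdd {f g : ℕ → Ω → ℝ} (hf : LpNull μ 4 f) (hg : LpBdd μ 4 g) :
    LpNull μ 2 (fun m ω => f m ω * g m ω) := by
  obtain ⟨C, hC, hm⟩ := hg.2
  refine ⟨fun m => (hf.1 m).mul (hg.1 m), ?_⟩
  have h1 : Tendsto (fun m => eLpNorm (f m) 4 μ * C) atTop (𝓝 0) := by
    simpa using ENNReal.Tendsto.mul_const hf.2 (Or.inr hC)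
  refine tendsto_of_tendsto_of_tendsto_of_le_of_le' tendsto_const_nhds h1
    (Eventually.of_forall fun _ => zero_le) ?_
  have : ENNReal.HolderTriple 4 4 2 := ⟨by
    rw [← two_mul, show (4 : ℝ≥0∞) = 2 * 2 by norm_num, ENNReal.mul_inv (by simp) (by simp),
      ← mul_assoc, ENNReal.mul_inv_cancel (by simp) (by simp), one_mul]⟩
  filter_upwards [hm] with m hm
  exact (eLpNorm_smul_le_mul_eLpNorm (p := 4) (q := 4) (r := 2) (hg.1 m) (hf.1 m)).trans
    (by gcongr)

theorem LpNull.mono_exponent [IsProbabilityMeasure μ] {p q : ℝ≥0∞} (hpq : p ≤ q)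
    {f : ℕ → Ω → ℝ} (hf : LpNull μ q f) : LpNull μ p f :=
  ⟨hf.1, tendsto_of_tendsto_of_tendsto_of_le_of_le tendsto_const_nhds hf.2 (fun _ => zero_le)
    fun m => eLpNorm_le_eLpNorm_of_exponent_le hpq (hf.1 m)⟩

theorem LpBdd.mono_exponent [IsProbabilityMeasure μ] {p q : ℝ≥0∞} (hpq : p ≤ q)
    {f : ℕ → Ω → ℝ} (hf : LpBdd μ q f) : LpBdd μ p f := by
  obtain ⟨C, hC, hm⟩ := hf.2
  refine ⟨hf.1, C, hC, hm.mono fun m hm => ?_⟩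
  exact (eLpNorm_le_eLpNorm_of_exponent_le hpq (hf.1 m)).trans hm

theorem eLpNorm_le_ofReal [IsProbabilityMeasure μ] {p : ℝ≥0∞} {f : Ω → ℝ} {C : ℝ}
    (h : ∀ ω, |f ω| ≤ C) : eLpNorm f p μ ≤ ENNReal.ofReal C := by
  simpa using eLpNorm_le_of_ae_bound (p := p) (μ := μ) (Eventually.of_forall h)

theorem LpBdd.of_bounded [IsProbabilityMeasure μ] {p : ℝ≥0∞} {f : ℕ → Ω → ℝ}
    (hf : ∀ m, AEStronglyMeasurable (f m) μ) {C : ℝ} (h : ∀ᶠ m in atTop, ∀ ω, |f m ω| ≤ C) :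
    LpBdd μ p f :=
  ⟨hf, ENNReal.ofReal C, by simp, h.mono fun _ hm => eLpNorm_le_ofReal hm⟩

theorem LpBdd.const_of_tendsto [IsProbabilityMeasure μ] {p : ℝ≥0∞} {s : ℕ → ℝ} {l : ℝ}
    (hs : Tendsto s atTop (𝓝 l)) : LpBdd μ p (fun m _ => s m) :=
  LpBdd.of_bounded (C := |l| + 1) (fun m => aestronglyMeasurable_const) <| by
    filter_upwards [hs.abs.eventually_le_const (show |l| < |l| + 1 by linarith)] with m hm _
    exact hm

theorem LpNull.of_uniform [IsProbabilityMeasure μ] {p : ℝ≥0∞} {f : ℕ → Ω → ℝ}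
    (hf : ∀ m, AEStronglyMeasurable (f m) μ)
    (h : ∀ δ : ℝ, 0 < δ → ∀ᶠ m in atTop, ∀ ω, |f m ω| ≤ δ) : LpNull μ p f := by
  refine ⟨hf, ENNReal.tendsto_nhds_zero.2 fun ε hε => ?_⟩
  obtain ⟨δ, hδ, hδε⟩ := ENNReal.lt_iff_exists_nnreal_btwn.1 hε
  filter_upwards [h δ (by simpa using hδ)] with m hm
  exact (eLpNorm_le_ofReal hm).trans (by simpa using hδε.le)

theorem LpNull.of_tendsto [IsProbabilityMeasure μ] {p : ℝ≥0∞} {s : ℕ → ℝ}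
    (hs : Tendsto s atTop (𝓝 0)) : LpNull μ p (fun m (_ : Ω) => s m) :=
  LpNull.of_uniform (fun m => aestronglyMeasurable_const) fun δ hδ => by
    filter_upwards [(tendsto_zero_iff_abs_tendsto_zero _).1 hs |>.eventually_le_const hδ]
      with m hm _
    exact hm

/-- Bounded convergence in probability. -/
theorem LpNull.of_bounded_of_probNull [IsProbabilityMeasure μ] {p : ℝ≥0∞} (hp : 1 ≤ p)
    (hp' : p ≠ ⊤) {f : ℕ → Ω → ℝ} (hf : ∀ m, Measurable (f m)) {C : ℝ}
    (h : ∀ᶠ m in atTop, ∀ ω, |f m ω| ≤ C) (h0 : ProbNull μ f) : LpNull μ p f := by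
  refine ⟨fun m => (hf m).aestronglyMeasurable, ENNReal.tendsto_nhds_zero.2 fun ε hε => ?_⟩
  have hε2 : 0 < ε / 2 := ENNReal.half_pos hε.ne'
  obtain ⟨δ, hδ, hδε⟩ := ENNReal.lt_iff_exists_nnreal_btwn.1 hε2
  have hδ' : (0 : ℝ) < δ := by simpa using hδ
  have hpp : 0 < p.toReal := ENNReal.toReal_pos (by positivity) hp'
  have h1 : Tendsto (fun m => ENNReal.ofReal C * μ {ω | (δ : ℝ) ≤ |f m ω|} ^ (1 / p.toReal)) atTop
      (𝓝 0) := by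
    have h2 := (h0 δ hδ').ennrpow_const (1 / p.toReal)
    rw [ENNReal.zero_rpow_of_pos (by positivity)] at h2
    simpa using ENNReal.Tendsto.const_mul h2 (Or.inr ENNReal.ofReal_ne_top)
  filter_upwards [h, h1.eventually_le_const hε2] with m hm hm1
  have hC : 0 ≤ C := by
    have : Nonempty Ω := by
      by_contra hne
      rw [not_nonempty_iff] at hne
      exact IsProbabilityMeasure.ne_zero μ (Measure.eq_zero_of_isEmpty μ)
    exact (abs_nonneg _).trans (hm this.some)
  have hms : MeasurableSet {ω | (δ : ℝ) ≤ |f m ω|} := measurableSet_le measurable_const (hf m).abs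
  have e1 : eLpNorm (f m) p μ ≤ eLpNorm ((fun _ => (δ : ℝ)) +
      {ω | (δ : ℝ) ≤ |f m ω|}.indicator fun _ => C) p μ := by
    refine eLpNorm_mono_real fun ω => ?_
    by_cases hω : (δ : ℝ) ≤ |f m ω|
    · simp only [Pi.add_apply, Set.indicator_of_mem (s := {ω | (δ : ℝ) ≤ |f m ω|}) hω]
      have := hm ω
      rw [Real.norm_eq_abs]; linarith
    · simp only [Pi.add_apply, Set.indicator_of_notMem (s := {ω | (δ : ℝ) ≤ |f m ω|}) hω]
      rw [Real.norm_eq_abs]; linarith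
  refine e1.trans ((eLpNorm_add_le aestronglyMeasurable_const
    (aestronglyMeasurable_const.indicator hms) hp).trans ?_)
  rw [← ENNReal.add_halves ε]
  refine add_le_add ?_ ?_
  · refine (eLpNorm_le_ofReal (C := (δ : ℝ)) fun ω => by simp).trans ?_
    simpa using hδε.le
  · refine (eLpNorm_indicator_const_le _ _).trans ?_
    rwa [← ofReal_norm, Real.norm_eq_abs, abs_of_nonneg hC]

/-! ### Second moments -/

theorem integral_sq_eq_eLpNorm {f : Ω → ℝ} (hf : MemLp f 2 μ) :
    ∫ ω, f ω ^ 2 ∂μ = (eLpNorm f 2 μ).toReal ^ 2 := by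
  have h := hf.eLpNorm_eq_integral_rpow_norm (by simp) (by simp)
  have h0 : 0 ≤ ∫ ω, f ω ^ 2 ∂μ := integral_nonneg fun _ => sq_nonneg _
  simp only [ENNReal.toReal_ofNat, Real.norm_eq_abs, Real.rpow_ofNat, sq_abs] at h
  rw [h, ENNReal.toReal_ofReal (by positivity), ← Real.rpow_natCast, ← Real.rpow_mul h0]
  norm_num

theorem LpNull.tendsto_integral_sq {f : ℕ → Ω → ℝ} (hf : LpNull μ 2 f) :
    Tendsto (fun m => ∫ ω, f m ω ^ 2 ∂μ) atTop (𝓝 0) := by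
  have h := (ENNReal.tendsto_toReal ENNReal.zero_ne_top).comp hf.2
  have h2 : Tendsto (fun m => (eLpNorm (f m) 2 μ).toReal ^ 2) atTop (𝓝 0) := by
    simpa using h.pow 2
  refine h2.congr' ?_
  filter_upwards [hf.memLp] with m hm
  rw [integral_sq_eq_eLpNorm hm]

theorem LpNull.of_integral_sq {f : ℕ → Ω → ℝ} (hf : ∀ m, AEStronglyMeasurable (f m) μ)
    (hL : ∀ᶠ m in atTop, MemLp (f m) 2 μ)
    (h : Tendsto (fun m => ∫ ω, f m ω ^ 2 ∂μ) atTop (𝓝 0)) : LpNull μ 2 f := by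
  refine ⟨hf, ?_⟩
  have h1 : Tendsto (fun m => ENNReal.ofReal (Real.sqrt (∫ ω, f m ω ^ 2 ∂μ))) atTop (𝓝 0) := by
    have := ENNReal.tendsto_ofReal ((Real.continuous_sqrt.tendsto 0).comp h)
    simpa using this
  refine h1.congr' ?_
  filter_upwards [hL] with m hm
  rw [integral_sq_eq_eLpNorm hm, Real.sqrt_sq ENNReal.toReal_nonneg,
    ENNReal.ofReal_toReal hm.2.ne]

theorem integral_mul_sq_le {f g : Ω → ℝ} (hf : MemLp f 2 μ) (hg : MemLp g 2 μ) :
    (∫ ω, f ω * g ω ∂μ) ^ 2 ≤ (∫ ω, f ω ^ 2 ∂μ) * ∫ ω, g ω ^ 2 ∂μ := by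
  have hfg : Integrable (fun ω => f ω * g ω) μ := hf.integrable_mul hg
  have key : ∀ x : ℝ, 0 ≤ (∫ ω, g ω ^ 2 ∂μ) * (x * x) + 2 * (∫ ω, f ω * g ω ∂μ) * x
      + ∫ ω, f ω ^ 2 ∂μ := by
    intro x
    have h0 : 0 ≤ ∫ ω, (f ω + x * g ω) ^ 2 ∂μ := integral_nonneg fun _ => sq_nonneg _
    have e : ∫ ω, (f ω + x * g ω) ^ 2 ∂μ = ∫ ω, (x * x) * g ω ^ 2 + (2 * x) * (f ω * g ω)
        + f ω ^ 2 ∂μ := by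
      congr 1; ext ω; ring
    rw [e, integral_add (by exact (hg.integrable_sq.const_mul _).add (hfg.const_mul _))
      hf.integrable_sq, integral_add (hg.integrable_sq.const_mul _) (hfg.const_mul _),
      integral_const_mul, integral_const_mul] at h0
    linarith
  have := discrim_le_zero key
  rw [discrim] at this
  nlinarith

theorem LpNull.tendsto_integral [IsProbabilityMeasure μ] {f : ℕ → Ω → ℝ} (hf : LpNull μ 2 f) :
    Tendsto (fun m => ∫ ω, f m ω ∂μ) atTop (𝓝 0) := by
  have h := (Real.continuous_sqrt.tendsto 0).comp hf.tendsto_integral_sq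
  rw [Real.sqrt_zero] at h
  refine squeeze_zero_norm' ?_ h
  filter_upwards [hf.memLp] with m hm
  have := integral_mul_sq_le hm (memLp_const (1 : ℝ))
  simp only [mul_one, one_pow, integral_const, probReal_univ, smul_eq_mul] at this
  exact Real.abs_le_sqrt this

/-- Mean and variance of `b + W + e`, where `W` is centred and `e` vanishes in `L²`. -/
theorem tendsto_moments [IsProbabilityMeasure μ] {X W e : ℕ → Ω → ℝ} {b v : ℕ → ℝ} {β v₀ : ℝ}
    (hb : Tendsto b atTop (𝓝 β)) (hW : ∀ᶠ m in atTop, MemLp (W m) 2 μ)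
    (hW0 : ∀ᶠ m in atTop, ∫ ω, W m ω ∂μ = 0)
    (hWv : ∀ᶠ m in atTop, ∫ ω, W m ω ^ 2 ∂μ = v m) (hv : Tendsto v atTop (𝓝 v₀))
    (he : LpNull μ 2 e) (hX : ∀ᶠ m in atTop, ∀ ω, X m ω = b m + W m ω + e m ω) :
    Tendsto (fun m => ∫ ω, X m ω ∂μ) atTop (𝓝 β) ∧
    Tendsto (fun m => variance (X m) μ) atTop (𝓝 v₀) := by
  have he1 := he.tendsto_integral
  have he2 := he.tendsto_integral_sq
  constructor
  · have h1 : Tendsto (fun m => b m + ∫ ω, e m ω ∂μ) atTop (𝓝 β) := by simpa using hb.add he1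
    refine h1.congr' ?_
    filter_upwards [hW, hW0, hX, he.memLp] with m hW hW0 hX hem
    have hWi := hW.integrable one_le_two
    have hei := hem.integrable one_le_two
    simp only [hX]
    rw [integral_add (by exact (integrable_const _).add hWi) hei,
      integral_add (integrable_const _) hWi, hW0]
    simp
  · have hcross : Tendsto (fun m => ∫ ω, W m ω * e m ω ∂μ) atTop (𝓝 0) := by
      have h := (Real.continuous_sqrt.tendsto _).comp (hv.mul he2)
      rw [mul_zero, Real.sqrt_zero] at h
      refine squeeze_zero_norm' ?_ h
      filter_upwards [hW, hWv, he.memLp] with m hW hWv hem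
      simp only [Function.comp_apply, ← hWv]
      exact Real.abs_le_sqrt (integral_mul_sq_le hW hem)
    have h1 : Tendsto (fun m => v m + 2 * (∫ ω, W m ω * e m ω ∂μ) + (∫ ω, e m ω ^ 2 ∂μ)
        - (∫ ω, e m ω ∂μ) ^ 2) atTop (𝓝 v₀) := by
      simpa using ((hv.add (hcross.const_mul 2)).add he2).sub (he1.pow 2)
    refine h1.congr' ?_
    filter_upwards [hW, hW0, hWv, hX, he.memLp] with m hW hW0 hWv hX hem
    have hWi := hW.integrable one_le_two
    have hei := hem.integrable one_le_two
    have hXe : X m = fun ω => (W m ω + e m ω) + b m := by ext ω; rw [hX]; ring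
    have hWe : MemLp (fun ω => W m ω + e m ω) 2 μ := hW.add hem
    have hWem : Integrable (fun ω => W m ω * e m ω) μ := hW.integrable_mul hem
    rw [hXe, variance_add_const hWe.1, variance_eq_sub hWe, integral_add hWi hei, hW0, zero_add]
    congr 1
    have e2 : ∫ ω, ((fun ω => W m ω + e m ω) ^ 2) ω ∂μ
        = ∫ ω, W m ω ^ 2 + 2 * (W m ω * e m ω) + e m ω ^ 2 ∂μ := by
      congr 1; ext ω; simp only [Pi.pow_apply]; ring
    rw [e2, integral_add (by exact hW.integrable_sq.add (hWem.const_mul 2)) hem.integrable_sq,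
      integral_add hW.integrable_sq (hWem.const_mul 2), integral_const_mul, hWv]

/-- The second moment of a sum of orthogonal variables. -/
theorem integral_sum_sq_of_orthogonal {ι : Type*} (s : Finset ι) {f : ι → Ω → ℝ}
    (hf : ∀ i ∈ s, MemLp (f i) 2 μ)
    (h : ∀ i ∈ s, ∀ j ∈ s, i ≠ j → ∫ ω, f i ω * f j ω ∂μ = 0) :
    ∫ ω, (∑ i ∈ s, f i ω) ^ 2 ∂μ = ∑ i ∈ s, ∫ ω, f i ω ^ 2 ∂μ := by
  have e : ∀ ω, (∑ i ∈ s, f i ω) ^ 2 = ∑ i ∈ s, ∑ j ∈ s, f i ω * f j ω := by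
    intro ω; rw [sq, Finset.sum_mul_sum]
  simp only [e]
  have hi2 : ∀ i ∈ s, ∀ j ∈ s, Integrable (fun ω => f i ω * f j ω) μ := fun i hi j hj =>
    (hf i hi).integrable_mul (hf j hj)
  rw [integral_finsetSum _ fun i hi => integrable_finsetSum _ fun j hj => hi2 i hi j hj]
  refine Finset.sum_congr rfl fun i hi => ?_
  rw [integral_finsetSum _ fun j hj => hi2 i hi j hj,
    Finset.sum_eq_single i (fun j hj hji => h i hi j hj hji.symm) (fun h => absurd hi h)]
  simp only [sq]

/-! ### The noise of one finite difference -/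

section Noise

variable {S : Type*} [MeasurableSpace S] {P : Measure S} {Y : ℝ → S → ℝ} {θ₀ : ℝ}

theorem cfdNoise_eq (h : ℝ) (p : S × S) : cfdNoise Y P θ₀ h p
    = (2 * h)⁻¹ * (Y (θ₀ + h) p.1 - perf Y P (θ₀ + h))
      + -(2 * h)⁻¹ * (Y (θ₀ - h) p.2 - perf Y P (θ₀ - h)) := by
  rw [cfdNoise, cfd]
  ring

theorem eventually_memLp_both (hYL2 : ∀ᶠ θ in 𝓝 θ₀, MemLp (Y θ) 2 P) :
    ∀ᶠ h in 𝓝 (0 : ℝ), MemLp (Y (θ₀ + h)) 2 P ∧ MemLp (Y (θ₀ - h)) 2 P := by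
  have t1 : Tendsto (fun h : ℝ => θ₀ + h) (𝓝 0) (𝓝 θ₀) := by
    have : Continuous fun h : ℝ => θ₀ + h := by fun_prop
    simpa using this.tendsto 0
  have t2 : Tendsto (fun h : ℝ => θ₀ - h) (𝓝 0) (𝓝 θ₀) := by
    have : Continuous fun h : ℝ => θ₀ - h := by fun_prop
    simpa using this.tendsto 0
  exact (t1.eventually hYL2).and (t2.eventually hYL2)

variable [IsProbabilityMeasure P]

theorem measurable_perf (hY : Measurable (Function.uncurry Y)) : Measurable (perf Y P) :=
  (StronglyMeasurable.integral_prod_right hY.stronglyMeasurable).measurable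

theorem measurable_cfd (hY : Measurable (Function.uncurry Y)) (θ₀ : ℝ) :
    Measurable fun x : ℝ × (S × S) => cfd Y θ₀ x.1 x.2.1 x.2.2 := by
  unfold cfd
  have h1 : Measurable fun x : ℝ × (S × S) => Function.uncurry Y (θ₀ + x.1, x.2.1) :=
    hY.comp (by fun_prop)
  have h2 : Measurable fun x : ℝ × (S × S) => Function.uncurry Y (θ₀ - x.1, x.2.2) :=
    hY.comp (by fun_prop)
  exact (h1.sub h2).div (by fun_prop)

theorem measurable_cfdNoise (hY : Measurable (Function.uncurry Y)) (θ₀ : ℝ) :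
    Measurable fun x : ℝ × (S × S) => cfdNoise Y P θ₀ x.1 x.2 := by
  have hp := measurable_perf (P := P) hY
  unfold cfdNoise
  refine (measurable_cfd hY θ₀).sub (Measurable.div (Measurable.sub ?_ ?_) (by fun_prop))
  · exact hp.comp (by fun_prop)
  · exact hp.comp (by fun_prop)

theorem memLp_cfdNoise {h : ℝ} (h1 : MemLp (Y (θ₀ + h)) 2 P) (h2 : MemLp (Y (θ₀ - h)) 2 P) :
    MemLp (cfdNoise Y P θ₀ h) 2 (P.prod P) := by
  have e1 := ((h1.sub (memLp_const (perf Y P (θ₀ + h)))).const_mul ((2 * h)⁻¹)).comp_fst P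
  have e2 := ((h2.sub (memLp_const (perf Y P (θ₀ - h)))).const_mul (-(2 * h)⁻¹)).comp_snd P
  refine (e1.add e2).congr_norm ?_ (Eventually.of_forall fun p => ?_)
  · have := (e1.add e2).1
    convert! this using 1
    ext p
    rw [cfdNoise_eq]; rfl
  · rw [cfdNoise_eq]; rfl

theorem integral_cfdNoise {h : ℝ} (h1 : MemLp (Y (θ₀ + h)) 2 P) (h2 : MemLp (Y (θ₀ - h)) 2 P) :
    ∫ p, cfdNoise Y P θ₀ h p ∂(P.prod P) = 0 := by
  have e1 := ((h1.sub (memLp_const (perf Y P (θ₀ + h)))).const_mul ((2 * h)⁻¹)).comp_fst P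
  have e2 := ((h2.sub (memLp_const (perf Y P (θ₀ - h)))).const_mul (-(2 * h)⁻¹)).comp_snd P
  have e3 := integral_add (e1.integrable one_le_two) (e2.integrable one_le_two)
  simp only [Pi.sub_apply] at e3
  simp only [cfdNoise_eq]
  rw [e3,
    integral_fun_fst (fun s => (2 * h)⁻¹ * (Y (θ₀ + h) s - perf Y P (θ₀ + h))),
    integral_fun_snd (fun s => -(2 * h)⁻¹ * (Y (θ₀ - h) s - perf Y P (θ₀ - h))),
    integral_const_mul, integral_const_mul, integral_sub (h1.integrable one_le_two)
    (integrable_const _), integral_sub (h2.integrable one_le_two) (integrable_const _)]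
  simp [perf]

/-- The second moment of the noise, normalized by `h²`. -/
noncomputable def noiseVar (Y : ℝ → S → ℝ) (P : Measure S) (θ₀ h : ℝ) : ℝ :=
  h ^ 2 * ∫ p, cfdNoise Y P θ₀ h p ^ 2 ∂(P.prod P)

theorem noiseVar_eq {h : ℝ} (hh : h ≠ 0) (h1 : MemLp (Y (θ₀ + h)) 2 P)
    (h2 : MemLp (Y (θ₀ - h)) 2 P) :
    noiseVar Y P θ₀ h = (sd Y P (θ₀ + h) ^ 2 + sd Y P (θ₀ - h) ^ 2) / 4 := by
  have e0 := variance_eq_sub (memLp_cfdNoise h1 h2)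
  rw [integral_cfdNoise h1 h2] at e0
  have e1 := (h1.sub (memLp_const (perf Y P (θ₀ + h)))).const_mul ((2 * h)⁻¹)
  have e2 := (h2.sub (memLp_const (perf Y P (θ₀ - h)))).const_mul (-(2 * h)⁻¹)
  have e3 := variance_add_prod e1 e2
  have e4 : cfdNoise Y P θ₀ h = fun p : S × S =>
      (2 * h)⁻¹ * (Y (θ₀ + h) p.1 - perf Y P (θ₀ + h))
      + -(2 * h)⁻¹ * (Y (θ₀ - h) p.2 - perf Y P (θ₀ - h)) := by
    ext p; exact cfdNoise_eq h p
  have e5 : variance (cfdNoise Y P θ₀ h) (P.prod P)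
      = ((2 * h)⁻¹) ^ 2 * variance (Y (θ₀ + h)) P + ((2 * h)⁻¹) ^ 2 * variance (Y (θ₀ - h)) P := by
    rw [e4]
    refine e3.trans ?_
    have a1 := variance_sub_const h1.1 (perf Y P (θ₀ + h))
    have a2 := variance_sub_const h2.1 (perf Y P (θ₀ - h))
    rw [variance_const_mul, variance_const_mul]
    rw [neg_sq]
    congr 2
  have e6 : ∫ p, cfdNoise Y P θ₀ h p ^ 2 ∂(P.prod P)
      = variance (cfdNoise Y P θ₀ h) (P.prod P) := by
    rw [e0]
    simp
  rw [noiseVar, e6, e5, sd, sd, Real.sq_sqrt (variance_nonneg _ _),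
    Real.sq_sqrt (variance_nonneg _ _)]
  field_simp
  ring

theorem tendsto_noiseVar (hYL2 : ∀ᶠ θ in 𝓝 θ₀, MemLp (Y θ) 2 P)
    (hσ : ContinuousAt (sd Y P) θ₀) :
    Tendsto (noiseVar Y P θ₀) (𝓝[≠] 0) (𝓝 (sd Y P θ₀ ^ 2 / 2)) := by
  have t1 : Tendsto (fun h : ℝ => θ₀ + h) (𝓝 0) (𝓝 θ₀) := by
    have : Continuous fun h : ℝ => θ₀ + h := by fun_prop
    simpa using this.tendsto 0
  have t2 : Tendsto (fun h : ℝ => θ₀ - h) (𝓝 0) (𝓝 θ₀) := by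
    have : Continuous fun h : ℝ => θ₀ - h := by fun_prop
    simpa using this.tendsto 0
  have h1 := (((hσ.tendsto.comp t1).pow 2).add ((hσ.tendsto.comp t2).pow 2)).div_const 4
  rw [show (sd Y P θ₀ ^ 2 + sd Y P θ₀ ^ 2) / 4 = sd Y P θ₀ ^ 2 / 2 by ring] at h1
  refine (h1.mono_left nhdsWithin_le_nhds).congr' ?_
  filter_upwards [self_mem_nhdsWithin, nhdsWithin_le_nhds (eventually_memLp_both hYL2)]
    with h hh hm
  exact (noiseVar_eq hh hm.1 hm.2).symm

theorem exists_noise_fourth_bound (hY : Measurable (Function.uncurry Y))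
    (hν₄ : limsup (fun h : ℝ =>
      ∫⁻ p, ENNReal.ofReal ((h * cfdNoise Y P θ₀ h p) ^ 4) ∂(P.prod P)) (𝓝[≠] 0) < ⊤) :
    ∃ C : ℝ, 0 ≤ C ∧ ∀ᶠ h in 𝓝[≠] (0 : ℝ), MemLp (fun p => h * cfdNoise Y P θ₀ h p) 4 (P.prod P) ∧
      ∫ p, (h * cfdNoise Y P θ₀ h p) ^ 4 ∂(P.prod P) ≤ C := by
  obtain ⟨C, hC, hC'⟩ := exists_between hν₄
  refine ⟨C.toReal, ENNReal.toReal_nonneg, ?_⟩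
  filter_upwards [eventually_lt_of_limsup_lt hC] with h hh
  have hm : Measurable fun p => h * cfdNoise Y P θ₀ h p :=
    ((measurable_cfdNoise (P := P) hY θ₀).comp measurable_prodMk_left).const_mul h
  have hpos : ∀ p, 0 ≤ (h * cfdNoise Y P θ₀ h p) ^ 4 := fun p => by positivity
  constructor
  · refine ⟨hm.aestronglyMeasurable, ?_⟩
    rw [eLpNorm_lt_top_iff_lintegral_rpow_enorm_lt_top (by simp) (by simp)]
    refine lt_of_le_of_lt (le_of_eq ?_) (hh.trans hC')
    refine lintegral_congr fun p => ?_
    rw [← ofReal_norm, ENNReal.ofReal_rpow_of_nonneg (norm_nonneg _) (by simp)]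
    congr 1
    simp only [ENNReal.toReal_ofNat, Real.rpow_ofNat, Real.norm_eq_abs]
    rw [← abs_pow, abs_of_nonneg (hpos p)]
  · rw [integral_eq_lintegral_of_nonneg_ae (Eventually.of_forall hpos)
      (hm.pow_const 4).aestronglyMeasurable]
    exact ENNReal.toReal_mono hC'.ne hh.le

end Noise

/-! ### Independence -/

section Indep

variable {Ω : Type*} [MeasurableSpace Ω] {μ : Measure Ω}

theorem indepFun_of_disjoint {ι α β γ : Type*} [mα : MeasurableSpace α] [MeasurableSpace β]
    [MeasurableSpace γ] {ξ : ι → Ω → α} (hξ : ∀ i, Measurable (ξ i)) (hind : iIndepFun ξ μ)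
    {s t : Set ι} (hst : Disjoint s t) {f : Ω → β} {g : Ω → γ}
    (hf : ∀ m : MeasurableSpace Ω, (∀ i ∈ s, Measurable[m] (ξ i)) → Measurable[m] f)
    (hg : ∀ m : MeasurableSpace Ω, (∀ i ∈ t, Measurable[m] (ξ i)) → Measurable[m] g) :
    IndepFun f g μ := by
  have h := indep_iSup_of_disjoint (fun i => (hξ i).comap_le) hind hst
  have hle : ∀ u : Set ι, ∀ i ∈ u,
      Measurable[⨆ j ∈ u, MeasurableSpace.comap (ξ j) mα] (ξ i) := fun u i hi =>
    Measurable.of_comap_le (le_biSup (fun j => MeasurableSpace.comap (ξ j) mα) hi)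
  exact indep_of_indep_of_le_left (indep_of_indep_of_le_right h (hg _ (hle t)).comap_le)
    (hf _ (hle s)).comap_le

variable [IsProbabilityMeasure μ]

theorem map_pair_eq {ι α : Type*} [MeasurableSpace α] {P : Measure α} [IsProbabilityMeasure P]
    {ξ : ι → Ω → α} (hξ : ∀ i, Measurable (ξ i)) (hlaw : ∀ i, μ.map (ξ i) = P)
    (hind : iIndepFun ξ μ) {i j : ι} (hij : i ≠ j) :
    μ.map (fun ω => (ξ i ω, ξ j ω)) = P.prod P := by
  have h := (indepFun_iff_map_prod_eq_prod_map_map (hξ i).aemeasurable (hξ j).aemeasurable).1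
    (hind.indepFun hij)
  rw [h, hlaw, hlaw]

theorem IndepFun_map_prod {α β : Type*} [MeasurableSpace α] [MeasurableSpace β] {X : Ω → α}
    {p : Ω → β} (hX : Measurable X) (hp : Measurable p) (h : IndepFun X p μ) :
    μ.map (fun ω => (X ω, p ω)) = (μ.map X).prod (μ.map p) :=
  (indepFun_iff_map_prod_eq_prod_map_map hX.aemeasurable hp.aemeasurable).1 h

/-- A function of independent `X` and `p` which is centred for every fixed value of `X`
is centred. -/
theorem integral_eq_zero_of_centred {α β : Type*} [MeasurableSpace α] [MeasurableSpace β]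
    {X : Ω → α} {p : Ω → β} (hX : Measurable X) (hp : Measurable p) (h : IndepFun X p μ)
    {F : α × β → ℝ} (hF : Measurable F) (h0 : ∀ x, ∫ y, F (x, y) ∂(μ.map p) = 0) :
    ∫ ω, F (X ω, p ω) ∂μ = 0 := by
  have : IsProbabilityMeasure (μ.map X) := Measure.isProbabilityMeasure_map hX.aemeasurable
  have : IsProbabilityMeasure (μ.map p) := Measure.isProbabilityMeasure_map hp.aemeasurable
  have e := integral_map (hX.prodMk hp).aemeasurable (μ := μ) (f := F) hF.aestronglyMeasurable
  rw [← e, IndepFun_map_prod hX hp h]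
  by_cases hi : Integrable F ((μ.map X).prod (μ.map p))
  · rw [integral_prod _ hi]; simp [h0]
  · exact integral_undef hi

theorem memLp_two_of_fibre_bound {α β : Type*} [MeasurableSpace α] [MeasurableSpace β]
    {X : Ω → α} {p : Ω → β} (hX : Measurable X) (hp : Measurable p) (h : IndepFun X p μ)
    {F : α × β → ℝ} (hF : Measurable F) {C : ℝ}
    (hint : ∀ x, Integrable (fun y => F (x, y) ^ 2) (μ.map p))
    (hC : ∀ x, ∫ y, F (x, y) ^ 2 ∂(μ.map p) ≤ C) :
    MemLp (fun ω => F (X ω, p ω)) 2 μ ∧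
    ∫ ω, F (X ω, p ω) ^ 2 ∂μ = ∫ ω, (∫ y, F (X ω, y) ^ 2 ∂(μ.map p)) ∂μ := by
  have : IsProbabilityMeasure (μ.map X) := Measure.isProbabilityMeasure_map hX.aemeasurable
  have : IsProbabilityMeasure (μ.map p) := Measure.isProbabilityMeasure_map hp.aemeasurable
  have hF2 : Measurable fun z => F z ^ 2 := hF.pow_const 2
  have hi : Integrable (fun z => F z ^ 2) ((μ.map X).prod (μ.map p)) := by
    rw [integrable_prod_iff hF2.aestronglyMeasurable]
    refine ⟨Eventually.of_forall hint, ?_⟩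
    refine Integrable.of_bound (C := C)
      (hF2.norm.stronglyMeasurable.integral_prod_right').aestronglyMeasurable
      (Eventually.of_forall fun x => ?_)
    have e : ∀ y, ‖F (x, y) ^ 2‖ = F (x, y) ^ 2 := fun y => by
      rw [Real.norm_eq_abs, abs_of_nonneg (sq_nonneg _)]
    simp only [e]
    rw [Real.norm_eq_abs, abs_of_nonneg (integral_nonneg fun _ => sq_nonneg _)]
    exact hC x
  have hmap := IndepFun_map_prod hX hp h
  have hXp : Measurable fun ω => (X ω, p ω) := hX.prodMk hp
  constructor
  · have hFm : AEStronglyMeasurable (fun ω => F (X ω, p ω)) μ := (hF.comp hXp).aestronglyMeasurable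
    rw [memLp_two_iff_integrable_sq hFm]
    rw [← hmap] at hi
    exact hi.comp_measurable hXp
  · have e := integral_map hXp.aemeasurable (μ := μ) (f := fun z => F z ^ 2)
      hF2.aestronglyMeasurable
    rw [← e, hmap, integral_prod _ hi, integral_map hX.aemeasurable]
    exact hF2.stronglyMeasurable.integral_prod_right'.aestronglyMeasurable

/-- The fourth moment of a sum of independent centred variables. -/
theorem fourth_moment_sum_le {ι : Type*} [DecidableEq ι] {X : ι → Ω → ℝ} {M : ℝ} (hM : 0 ≤ M)
    (hX : ∀ i, MemLp (X i) 4 μ) (h0 : ∀ i, ∫ ω, X i ω ∂μ = 0)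
    (h2 : ∀ i, ∫ ω, X i ω ^ 2 ∂μ ≤ M) (h4 : ∀ i, ∫ ω, X i ω ^ 4 ∂μ ≤ M ^ 2)
    (hind : ∀ (s : Finset ι) (i : ι), i ∉ s → IndepFun (fun ω => ∑ j ∈ s, X j ω) (X i) μ)
    (s : Finset ι) : MemLp (fun ω => ∑ i ∈ s, X i ω) 4 μ ∧
      ∫ ω, (∑ i ∈ s, X i ω) ^ 4 ∂μ ≤ 4 * (s.card : ℝ) ^ 2 * M ^ 2 := by
  suffices H : MemLp (fun ω => ∑ i ∈ s, X i ω) 4 μ ∧ ∫ ω, (∑ i ∈ s, X i ω) ∂μ = 0 ∧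
      ∫ ω, (∑ i ∈ s, X i ω) ^ 2 ∂μ ≤ s.card * M ∧
      ∫ ω, (∑ i ∈ s, X i ω) ^ 4 ∂μ ≤ s.card * M ^ 2 + 3 * (s.card : ℝ) ^ 2 * M ^ 2 by
    refine ⟨H.1, H.2.2.2.trans ?_⟩
    have : (s.card : ℝ) ≤ (s.card : ℝ) ^ 2 := by
      exact_mod_cast Nat.le_self_pow two_ne_zero _
    nlinarith [sq_nonneg M]
  induction s using Finset.induction_on with
  | empty => simp
  | insert i s hi ih =>
    obtain ⟨hS, hS0, hS2, hS4⟩ := ih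
    set T : Ω → ℝ := fun ω => ∑ j ∈ s, X j ω with hT
    have hTX := hind s i hi
    have int : ∀ {f : Ω → ℝ}, MemLp f 4 μ → ∀ k : ℕ, k ≤ 4 → Integrable (fun ω => f ω ^ k) μ := by
      intro f hf k hk
      have h1 : MemLp f k μ := hf.mono_exponent (by exact_mod_cast hk)
      refine (h1.integrable_norm_pow').mono' (hf.1.pow k) (Eventually.of_forall fun ω => ?_)
      simp
    have hTXk : ∀ k l : ℕ, IndepFun (fun ω => T ω ^ k) (fun ω => X i ω ^ l) μ := fun k l =>
      hTX.comp (φ := fun x => x ^ k) (ψ := fun x => x ^ l) (by fun_prop) (by fun_prop)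
    have imul : ∀ k l : ℕ, k ≤ 4 → l ≤ 4 → Integrable (fun ω => T ω ^ k * X i ω ^ l) μ :=
      fun k l hk hl => (hTXk k l).integrable_mul (int hS k hk) (int (hX i) l hl)
    have vmul : ∀ k l : ℕ, ∫ ω, T ω ^ k * X i ω ^ l ∂μ
        = (∫ ω, T ω ^ k ∂μ) * ∫ ω, X i ω ^ l ∂μ := fun k l =>
      (hTXk k l).integral_fun_mul_eq_mul_integral (hS.1.pow k) ((hX i).1.pow l)
    have hsum : ∀ ω, ∑ j ∈ insert i s, X j ω = T ω + X i ω := fun ω => by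
      rw [Finset.sum_insert hi, add_comm]
    have iX := int (hX i)
    have iT := int hS
    have z1 : ∫ ω, X i ω ^ 1 ∂μ = 0 := by simpa using h0 i
    have zT : ∫ ω, T ω ^ 1 ∂μ = 0 := by simpa using hS0
    simp only [hsum, Finset.card_insert_of_notMem hi]
    refine ⟨hS.add (hX i), ?_, ?_, ?_⟩
    · rw [integral_add (by simpa using iT 1 (by norm_num)) (by simpa using iX 1 (by norm_num)),
        hS0, h0, add_zero]
    · have e : ∫ ω, (T ω + X i ω) ^ 2 ∂μ
          = ∫ ω, T ω ^ 2 + 2 * (T ω ^ 1 * X i ω ^ 1) + X i ω ^ 2 ∂μ := by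
        congr 1; ext ω; ring
      have j1 : Integrable (fun ω => T ω ^ 2 + 2 * (T ω ^ 1 * X i ω ^ 1)) μ :=
        (iT 2 (by norm_num)).add ((imul 1 1 (by norm_num) (by norm_num)).const_mul 2)
      rw [e, integral_add j1 (iX 2 (by norm_num)), integral_add (iT 2 (by norm_num)) ((imul 1 1 (by norm_num) (by norm_num)).const_mul 2),
        integral_const_mul, vmul, z1]
      push_cast
      linarith [h2 i]
    · have i22 := (imul 2 2 (by norm_num) (by norm_num)).const_mul 6
      have i31 := (imul 3 1 (by norm_num) (by norm_num)).const_mul 4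
      have i13 := (imul 1 3 (by norm_num) (by norm_num)).const_mul 4
      have e : ∫ ω, (T ω + X i ω) ^ 4 ∂μ
          = ∫ ω, T ω ^ 4 + 4 * (T ω ^ 3 * X i ω ^ 1) + 6 * (T ω ^ 2 * X i ω ^ 2)
            + 4 * (T ω ^ 1 * X i ω ^ 3) + X i ω ^ 4 ∂μ := by
        congr 1; ext ω; ring
      have j1 : Integrable (fun ω => T ω ^ 4 + 4 * (T ω ^ 3 * X i ω ^ 1)) μ :=
        (iT 4 (by norm_num)).add i31
      have j2 : Integrable (fun ω => T ω ^ 4 + 4 * (T ω ^ 3 * X i ω ^ 1)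
          + 6 * (T ω ^ 2 * X i ω ^ 2)) μ := j1.add i22
      have j3 : Integrable (fun ω => T ω ^ 4 + 4 * (T ω ^ 3 * X i ω ^ 1)
          + 6 * (T ω ^ 2 * X i ω ^ 2) + 4 * (T ω ^ 1 * X i ω ^ 3)) μ := j2.add i13
      rw [e, integral_add j3 (iX 4 (by norm_num)), integral_add j2 i13, integral_add j1 i22,
        integral_add (iT 4 (by norm_num)) i31,
        integral_const_mul, integral_const_mul, integral_const_mul, vmul, vmul, vmul, z1, zT]
      have hS2' : 0 ≤ ∫ ω, T ω ^ 2 ∂μ := integral_nonneg fun _ => sq_nonneg _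
      have hX2' : 0 ≤ ∫ ω, X i ω ^ 2 ∂μ := integral_nonneg fun _ => sq_nonneg _
      have : (∫ ω, T ω ^ 2 ∂μ) * ∫ ω, X i ω ^ 2 ∂μ ≤ (s.card * M) * M :=
        mul_le_mul hS2 (h2 i) hX2' (by positivity)
      have h4i := h4 i
      push_cast
      nlinarith

end Indep

/-! ### The pilot stage -/

/-- The assumptions on the simulation model and on the random inputs. -/
structure Sim {S : Type*} [MeasurableSpace S] (P : Measure S) (Y : ℝ → S → ℝ) (θ₀ : ℝ) {K : ℕ}
    (c : Fin K → ℝ) {Ω : Type*} [MeasurableSpace Ω] (μ : Measure Ω) (ξ : Run K → Ω → S) :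
    Prop where
  meas : Measurable (Function.uncurry Y)
  sqInt : ∀ᶠ θ in 𝓝 θ₀, MemLp (Y θ) 2 P
  smooth : ContDiffAt ℝ 5 (perf Y P) θ₀
  sd_cont : ContinuousAt (sd Y P) θ₀
  fourth : limsup (fun h : ℝ =>
      ∫⁻ p, ENNReal.ofReal ((h * cfdNoise Y P θ₀ h p) ^ 4) ∂(P.prod P)) (𝓝[≠] 0) < ⊤
  c_ne : ∀ k, c k ≠ 0
  c_sq : ∃ j k, c j ^ 2 ≠ c k ^ 2
  input : ∀ i, Measurable (ξ i)
  law : ∀ i, μ.map (ξ i) = P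
  indep : iIndepFun ξ μ

/-- Perturbations at which the noise has the moments of the limit, up to a constant. -/
structure GoodPert {S : Type*} [MeasurableSpace S] (P : Measure S) (Y : ℝ → S → ℝ) (θ₀ M h : ℝ) :
    Prop where
  ne : h ≠ 0
  memLp_add : MemLp (Y (θ₀ + h)) 2 P
  memLp_sub : MemLp (Y (θ₀ - h)) 2 P
  memLp_noise : MemLp (fun p => h * cfdNoise Y P θ₀ h p) 4 (P.prod P)
  fourth_le : ∫ p, (h * cfdNoise Y P θ₀ h p) ^ 4 ∂(P.prod P) ≤ M ^ 2
  second_le : noiseVar Y P θ₀ h ≤ M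

/-- The factor `n_b^{-1/10}` of the pilot perturbations. -/
noncomputable def pilotScale (N : ℕ) : ℝ := (N : ℝ) ^ (-(1 / 10) : ℝ)

theorem pilotPert_eq {K : ℕ} (c : Fin K → ℝ) (N : ℕ) :
    pilotPert c N = fun k => c k * pilotScale N := rfl

theorem pilotScale_pos {N : ℕ} (hN : 0 < N) : 0 < pilotScale N :=
  Real.rpow_pos_of_pos (by exact_mod_cast hN) _

theorem pilotScale_pow {N : ℕ} (hN : 0 < N) : (N : ℝ) * pilotScale N ^ 10 = 1 := by
  have h : (0 : ℝ) < N := by exact_mod_cast hN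
  rw [pilotScale, ← Real.rpow_natCast, ← Real.rpow_mul h.le]
  norm_num
  rw [Real.rpow_neg_one, mul_inv_cancel₀ h.ne']

theorem tendsto_pilotScale : Tendsto pilotScale atTop (𝓝 0) :=
  (tendsto_rpow_neg_atTop (by norm_num : (0 : ℝ) < 1 / 10)).comp tendsto_natCast_atTop_atTop

/-- The normalized noise of the mean of the pilot sample. -/
noncomputable def pilotErr {S : Type*} [MeasurableSpace S] (P : Measure S) (Y : ℝ → S → ℝ) (θ₀ : ℝ)
    {K : ℕ} (c : Fin K → ℝ) {Ω : Type*} (ξ : Run K → Ω → S) (N : ℕ) (k : Fin K) (ω : Ω) : ℝ :=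
  (N * pilotScale N ^ 4)⁻¹ * ∑ j : Fin N, cfdNoise Y P θ₀ (pilotPert c N k)
    (ξ (.pilot k j true) ω, ξ (.pilot k j false) ω)

/-- The normalized deviation of the mean of a pilot finite difference from the regression line. -/
noncomputable def pilotBias {S : Type*} [MeasurableSpace S] (P : Measure S) (Y : ℝ → S → ℝ)
    (θ₀ : ℝ) {K : ℕ} (c : Fin K → ℝ) (N : ℕ) (k : Fin K) : ℝ :=
  (pilotScale N ^ 4)⁻¹ * ((perf Y P (θ₀ + pilotPert c N k) - perf Y P (θ₀ - pilotPert c N k))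
    / (2 * pilotPert c N k) - deriv (perf Y P) θ₀ - coefB Y P θ₀ * pilotPert c N k ^ 2)

section

set_option linter.unusedSectionVars false

variable {S : Type*} [MeasurableSpace S] {P : Measure S} [IsProbabilityMeasure P]
  {Y : ℝ → S → ℝ} {θ₀ : ℝ} {K : ℕ} {c : Fin K → ℝ} {Ω : Type*} [MeasurableSpace Ω]
  {μ : Measure Ω} [IsProbabilityMeasure μ] {ξ : Run K → Ω → S}

theorem Sim.exists_goodPert (H : Sim P Y θ₀ c μ ξ) :
    ∃ M : ℝ, 0 ≤ M ∧ ∀ᶠ h in 𝓝[≠] (0 : ℝ), GoodPert P Y θ₀ M h := by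
  obtain ⟨C, hC, h4⟩ := exists_noise_fourth_bound H.meas H.fourth
  have h2 := (tendsto_noiseVar H.sqInt H.sd_cont).eventually_le_const
    (show sd Y P θ₀ ^ 2 / 2 < sd Y P θ₀ ^ 2 / 2 + 1 by linarith)
  refine ⟨max (C + 1) (sd Y P θ₀ ^ 2 / 2 + 1), by positivity, ?_⟩
  filter_upwards [h4, h2, self_mem_nhdsWithin,
    nhdsWithin_le_nhds (eventually_memLp_both H.sqInt)] with h h4 h2 hh hm
  refine ⟨hh, hm.1, hm.2, h4.1, h4.2.trans ?_, h2.trans (le_max_right _ _)⟩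
  have : C + 1 ≤ max (C + 1) (sd Y P θ₀ ^ 2 / 2 + 1) := le_max_left _ _
  nlinarith

theorem tendsto_pilotPert (hc : ∀ k, c k ≠ 0) (k : Fin K) :
    Tendsto (fun N => pilotPert c N k) atTop (𝓝[≠] 0) := by
  refine tendsto_nhdsWithin_iff.2 ⟨by simpa [pilotPert_eq] using tendsto_pilotScale.const_mul (c k), ?_⟩
  filter_upwards [eventually_gt_atTop 0] with N hN
  exact mul_ne_zero (hc k) (pilotScale_pos hN).ne'

theorem Sim.tendsto_noiseVar_pilot (H : Sim P Y θ₀ c μ ξ) (k : Fin K) :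
    Tendsto (fun N => noiseVar Y P θ₀ (pilotPert c N k)) atTop (𝓝 (sd Y P θ₀ ^ 2 / 2)) :=
  (tendsto_noiseVar H.sqInt H.sd_cont).comp (tendsto_pilotPert H.c_ne k)

theorem Sim.tendsto_pilotBias (H : Sim P Y θ₀ c μ ξ) (k : Fin K) :
    Tendsto (fun N => pilotBias P Y θ₀ c N k) atTop (𝓝 (coefD Y P θ₀ * c k ^ 4)) := by
  have h1 := (central_difference_expansion H.smooth).comp_tendsto (tendsto_pilotPert H.c_ne k)
  have h2 := ((isLittleO_iff_tendsto' (by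
    filter_upwards [(tendsto_pilotPert H.c_ne k).eventually self_mem_nhdsWithin] with N hN h0
    exact absurd h0 (pow_ne_zero 4 hN))).1 h1).mul_const (c k ^ 4)
  have h3 := h2.add_const (coefD Y P θ₀ * c k ^ 4)
  rw [zero_mul, zero_add] at h3
  refine h3.congr' ?_
  filter_upwards [eventually_gt_atTop 0] with N hN
  have ht := (pilotScale_pos hN).ne'
  have hc := H.c_ne k
  have e : pilotPert c N k = c k * pilotScale N := rfl
  simp only [Function.comp_apply, pilotBias, coefD, coefB]
  set q := (perf Y P (θ₀ + pilotPert c N k) - perf Y P (θ₀ - pilotPert c N k))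
    / (2 * pilotPert c N k)
  rw [e]
  field_simp
  ring

/-- The inputs of a pilot pair or of an additional pair. -/
theorem Sim.map_pair (H : Sim P Y θ₀ c μ ξ) {i j : Run K} (hij : i ≠ j) :
    μ.map (fun ω => (ξ i ω, ξ j ω)) = P.prod P :=
  map_pair_eq H.input H.law H.indep hij

theorem Sim.integral_pair (H : Sim P Y θ₀ c μ ξ) {i j : Run K} (hij : i ≠ j) {f : S × S → ℝ}
    (hf : Measurable f) : ∫ ω, f (ξ i ω, ξ j ω) ∂μ = ∫ p, f p ∂(P.prod P) := by
  rw [← H.map_pair hij, integral_map ((H.input i).prodMk (H.input j)).aemeasurable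
    hf.aestronglyMeasurable]

theorem Sim.memLp_pair (H : Sim P Y θ₀ c μ ξ) {i j : Run K} (hij : i ≠ j) {f : S × S → ℝ}
    {p : ℝ≥0∞} (hf : MemLp f p (P.prod P)) : MemLp (fun ω => f (ξ i ω, ξ j ω)) p μ := by
  rw [← H.map_pair hij] at hf
  exact hf.comp_of_map ((H.input i).prodMk (H.input j)).aemeasurable

theorem Sim.measurable_noise (H : Sim P Y θ₀ c μ ξ) (h : ℝ) : Measurable (cfdNoise Y P θ₀ h) :=
  (measurable_cfdNoise (P := P) H.meas θ₀).comp measurable_prodMk_left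

/-- The normalized noise of one pilot pair. -/
noncomputable def pilotNoise (P : Measure S) (Y : ℝ → S → ℝ) (θ₀ : ℝ) (c : Fin K → ℝ)
    (ξ : Run K → Ω → S) (N : ℕ) (k : Fin K) (j : Fin N) (ω : Ω) : ℝ :=
  pilotPert c N k * cfdNoise Y P θ₀ (pilotPert c N k)
    (ξ (.pilot k j true) ω, ξ (.pilot k j false) ω)

theorem measurable_pilotNoise {Ω' : Type*} [m : MeasurableSpace Ω'] {ξ : Run K → Ω' → S}
    (hY : Measurable (Function.uncurry Y)) {N : ℕ} {k : Fin K} {j : Fin N}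
    (hm : ∀ b, Measurable (ξ (.pilot k j b))) : Measurable (pilotNoise P Y θ₀ c ξ N k j) :=
  (((measurable_cfdNoise (P := P) hY θ₀).comp measurable_prodMk_left).comp
    ((hm true).prodMk (hm false))).const_mul _

theorem pilotErr_eq {N : ℕ} (hN : 0 < N) {k : Fin K} (hc : c k ≠ 0) (ω : Ω) :
    pilotErr P Y θ₀ c ξ N k ω
      = pilotScale N ^ 5 / c k * ∑ j : Fin N, pilotNoise P Y θ₀ c ξ N k j ω := by
  have h1 := pilotScale_pow hN
  have ht := (pilotScale_pos hN).ne'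
  have hN' : (N : ℝ) ≠ 0 := by positivity
  simp only [pilotErr, pilotNoise, ← Finset.mul_sum]
  have e : pilotPert c N k = c k * pilotScale N := rfl
  generalize (∑ j : Fin N, cfdNoise Y P θ₀ (pilotPert c N k)
    (ξ (.pilot k j true) ω, ξ (.pilot k j false) ω)) = s
  rw [e]
  field_simp
  linear_combination (-s) * h1

theorem measurable_pilotErr {Ω' : Type*} [m : MeasurableSpace Ω'] {ξ : Run K → Ω' → S}
    (hY : Measurable (Function.uncurry Y)) {N : ℕ} {k : Fin K}
    (hm : ∀ (j : Fin N) b, Measurable (ξ (.pilot k j b))) :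
    Measurable (pilotErr P Y θ₀ c ξ N k) :=
  (Finset.measurable_sum _ fun j _ =>
    ((measurable_cfdNoise (P := P) hY θ₀).comp measurable_prodMk_left).comp
      ((hm j true).prodMk (hm j false))).const_mul _

variable {M : ℝ} {N : ℕ} {k : Fin K}

theorem Sim.pilotNoise_memLp (H : Sim P Y θ₀ c μ ξ) (hg : GoodPert P Y θ₀ M (pilotPert c N k))
    (j : Fin N) : MemLp (pilotNoise P Y θ₀ c ξ N k j) 4 μ :=
  H.memLp_pair (by simp) hg.memLp_noise

theorem Sim.integral_pilotNoise (H : Sim P Y θ₀ c μ ξ)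
    (hg : GoodPert P Y θ₀ M (pilotPert c N k)) (j : Fin N) :
    ∫ ω, pilotNoise P Y θ₀ c ξ N k j ω ∂μ = 0 := by
  have := H.integral_pair (i := .pilot k j true) (j := .pilot k j false) (by simp)
    ((H.measurable_noise (pilotPert c N k)).const_mul (pilotPert c N k))
  refine this.trans ?_
  rw [integral_const_mul, integral_cfdNoise hg.memLp_add hg.memLp_sub, mul_zero]

theorem Sim.integral_pilotNoise_sq (H : Sim P Y θ₀ c μ ξ) (j : Fin N) :
    ∫ ω, pilotNoise P Y θ₀ c ξ N k j ω ^ 2 ∂μ = noiseVar Y P θ₀ (pilotPert c N k) := by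
  have := H.integral_pair (i := .pilot k j true) (j := .pilot k j false) (by simp)
    (((H.measurable_noise (pilotPert c N k)).const_mul (pilotPert c N k)).pow_const 2)
  simp only [pilotNoise]
  rw [this, noiseVar, ← integral_const_mul]
  simp only [mul_pow]

theorem Sim.integral_pilotNoise_fourth (H : Sim P Y θ₀ c μ ξ)
    (hg : GoodPert P Y θ₀ M (pilotPert c N k)) (j : Fin N) :
    ∫ ω, pilotNoise P Y θ₀ c ξ N k j ω ^ 4 ∂μ ≤ M ^ 2 := by
  have := H.integral_pair (i := .pilot k j true) (j := .pilot k j false) (by simp)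
    (((H.measurable_noise (pilotPert c N k)).const_mul (pilotPert c N k)).pow_const 4)
  simp only [pilotNoise]
  rw [this]
  exact hg.fourth_le

theorem Sim.indepFun_sum_pilotNoise (H : Sim P Y θ₀ c μ ξ) (s : Finset (Fin N)) (i : Fin N)
    (hi : i ∉ s) : IndepFun (fun ω => ∑ j ∈ s, pilotNoise P Y θ₀ c ξ N k j ω)
      (pilotNoise P Y θ₀ c ξ N k i) μ := by
  have hY := H.meas
  refine indepFun_of_disjoint H.input H.indep
    (s := {r | ∃ j ∈ s, ∃ b, r = .pilot k (j : ℕ) b}) (t := {r | ∃ b, r = .pilot k (i : ℕ) b}) ?_ ?_ ?_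
  · rw [Set.disjoint_left]
    rintro r ⟨j, hj, b, rfl⟩ ⟨b', h⟩
    simp only [Run.pilot.injEq, true_and, Fin.val_inj] at h
    exact hi (h.1 ▸ hj)
  · intro m hm
    exact Finset.measurable_sum (m := m) _ fun j hj => measurable_pilotNoise (m := m) hY fun b =>
      hm _ ⟨j, hj, b, rfl⟩
  · intro m hm
    exact measurable_pilotNoise (m := m) hY fun b => hm _ ⟨b, rfl⟩

theorem Sim.pilotErr_moments (H : Sim P Y θ₀ c μ ξ) (hM : 0 ≤ M) (hN : 0 < N)
    (hg : GoodPert P Y θ₀ M (pilotPert c N k)) :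
    MemLp (pilotErr P Y θ₀ c ξ N k) 4 μ ∧ ∫ ω, pilotErr P Y θ₀ c ξ N k ω ∂μ = 0 ∧
    ∫ ω, pilotErr P Y θ₀ c ξ N k ω ^ 2 ∂μ = noiseVar Y P θ₀ (pilotPert c N k) / c k ^ 2 ∧
    ∫ ω, pilotErr P Y θ₀ c ξ N k ω ^ 4 ∂μ ≤ 4 * M ^ 2 / c k ^ 4 := by
  have hck := H.c_ne k
  have hs := pilotScale_pow hN
  have ht := pilotScale_pos hN
  have hX := fun j => H.pilotNoise_memLp hg j
  have hX2 := fun j => (hX j).mono_exponent (show (2 : ℝ≥0∞) ≤ 4 by norm_num)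
  have h0 := fun j => H.integral_pilotNoise hg j
  obtain ⟨m4, f4⟩ := fourth_moment_sum_le hM hX h0
    (fun j => (H.integral_pilotNoise_sq j).trans_le hg.second_le)
    (H.integral_pilotNoise_fourth hg) H.indepFun_sum_pilotNoise Finset.univ
  have e : pilotErr P Y θ₀ c ξ N k = fun ω =>
      pilotScale N ^ 5 / c k * ∑ j : Fin N, pilotNoise P Y θ₀ c ξ N k j ω := by
    ext ω; exact pilotErr_eq hN hck ω
  refine ⟨?_, ?_, ?_, ?_⟩
  · rw [e]; exact m4.const_mul _
  · rw [e, integral_const_mul, integral_finsetSum _ fun j _ => (hX2 j).integrable one_le_two]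
    simp [h0]
  · have orth := integral_sum_sq_of_orthogonal Finset.univ (fun j _ => hX2 j) fun i _ j _ hij => by
      have hind : IndepFun (pilotNoise P Y θ₀ c ξ N k i) (pilotNoise P Y θ₀ c ξ N k j) μ := by
        simpa using H.indepFun_sum_pilotNoise (k := k) {i} j (by simpa using hij.symm)
      rw [hind.integral_fun_mul_eq_mul_integral (hX i).1 (hX j).1, h0 i, zero_mul]
    simp only [H.integral_pilotNoise_sq, Finset.sum_const, Finset.card_univ, Fintype.card_fin,
      nsmul_eq_mul] at orth
    simp only [e, mul_pow]
    rw [integral_const_mul, orth]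
    field_simp
    linear_combination (noiseVar Y P θ₀ (pilotPert c N k)) * hs
  · simp only [e, mul_pow]
    rw [integral_const_mul]
    simp only [Finset.card_univ, Fintype.card_fin] at f4
    have hpos : 0 ≤ (pilotScale N ^ 5 / c k) ^ 4 := by positivity
    refine (mul_le_mul_of_nonneg_left f4 hpos).trans (le_of_eq ?_)
    have hs2 : (N : ℝ) ^ 2 * pilotScale N ^ 20 = 1 := by
      have : ((N : ℝ) * pilotScale N ^ 10) ^ 2 = 1 := by rw [hs]; norm_num
      linear_combination this
    rw [div_pow]
    linear_combination (4 * M ^ 2 / c k ^ 4) * hs2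

theorem Sim.eventually_goodPert (H : Sim P Y θ₀ c μ ξ) :
    ∃ M : ℝ, 0 ≤ M ∧ ∀ᶠ N in atTop, ∀ k, GoodPert P Y θ₀ M (pilotPert c N k) := by
  obtain ⟨M, hM, h⟩ := H.exists_goodPert
  exact ⟨M, hM, eventually_all.2 fun k => (tendsto_pilotPert H.c_ne k).eventually h⟩

theorem LpBdd.of_fourth_moment {f : ℕ → Ω → ℝ} (hf : ∀ m, AEStronglyMeasurable (f m) μ) {C : ℝ}
    (h : ∀ᶠ m in atTop, MemLp (f m) 4 μ ∧ ∫ ω, f m ω ^ 4 ∂μ ≤ C) : LpBdd μ 4 f := by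
  refine ⟨hf, ENNReal.ofReal (C ^ (1 / 4 : ℝ)), by simp, ?_⟩
  filter_upwards [h] with m hm
  rw [hm.1.eLpNorm_eq_integral_rpow_norm (by simp) (by simp)]
  refine ENNReal.ofReal_le_ofReal ?_
  have e : ∀ ω, ‖f m ω‖ ^ (ENNReal.toReal 4) = f m ω ^ 4 := fun ω => by
    simp only [ENNReal.toReal_ofNat, Real.rpow_ofNat, Real.norm_eq_abs, ← abs_pow]
    exact abs_of_nonneg (Even.pow_nonneg (by decide) _)
  simp only [e]
  rw [ENNReal.toReal_ofNat, ← one_div]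
  exact Real.rpow_le_rpow (integral_nonneg fun _ => by positivity) hm.2 (by norm_num)

theorem Sim.pilotErr_bdd (H : Sim P Y θ₀ c μ ξ) (k : Fin K) :
    LpBdd μ 4 (fun N => pilotErr P Y θ₀ c ξ N k) := by
  obtain ⟨M, hM, h⟩ := H.eventually_goodPert
  refine LpBdd.of_fourth_moment (C := 4 * M ^ 2 / c k ^ 4)
    (fun N => (measurable_pilotErr H.meas fun _ _ => H.input _).aestronglyMeasurable) ?_
  filter_upwards [h, eventually_gt_atTop 0] with N h hN
  have := H.pilotErr_moments hM hN (h k)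
  exact ⟨this.1, this.2.2.2⟩

theorem Sim.indepFun_pilotErr (H : Sim P Y θ₀ c μ ξ) {k l : Fin K} (hkl : k ≠ l) :
    IndepFun (pilotErr P Y θ₀ c ξ N k) (pilotErr P Y θ₀ c ξ N l) μ := by
  have hY := H.meas
  refine indepFun_of_disjoint H.input H.indep
    (s := {r | ∃ j b, r = .pilot k j b}) (t := {r | ∃ j b, r = .pilot l j b}) ?_ ?_ ?_
  · rw [Set.disjoint_left]
    rintro r ⟨j, b, rfl⟩ ⟨j', b', h⟩
    simp only [Run.pilot.injEq] at h
    exact hkl h.1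
  · exact fun m hm => measurable_pilotErr (m := m) hY fun j b => hm _ ⟨j, b, rfl⟩
  · exact fun m hm => measurable_pilotErr (m := m) hY fun j b => hm _ ⟨j, b, rfl⟩

/-- Mean and variance of linear combinations of the pilot noise. -/
theorem Sim.pilotErr_sum_moments (H : Sim P Y θ₀ c μ ξ) (w : Fin K → ℝ) :
    ∀ᶠ N in atTop, MemLp (fun ω => ∑ k, w k * pilotErr P Y θ₀ c ξ N k ω) 2 μ ∧
      ∫ ω, ∑ k, w k * pilotErr P Y θ₀ c ξ N k ω ∂μ = 0 ∧
      ∫ ω, (∑ k, w k * pilotErr P Y θ₀ c ξ N k ω) ^ 2 ∂μ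
        = ∑ k, w k ^ 2 / c k ^ 2 * noiseVar Y P θ₀ (pilotPert c N k) := by
  obtain ⟨M, hM, h⟩ := H.eventually_goodPert
  filter_upwards [h, eventually_gt_atTop 0] with N h hN
  have hm := fun k => H.pilotErr_moments hM hN (h k)
  have h2 : ∀ k, MemLp (fun ω => w k * pilotErr P Y θ₀ c ξ N k ω) 2 μ := fun k =>
    ((hm k).1.mono_exponent (show (2 : ℝ≥0∞) ≤ 4 by norm_num)).const_mul _
  refine ⟨memLp_finsetSum _ fun k _ => h2 k, ?_, ?_⟩
  · rw [integral_finsetSum _ fun k _ => (h2 k).integrable one_le_two]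
    simp only [integral_const_mul, (hm _).2.1, mul_zero, Finset.sum_const_zero]
  · rw [integral_sum_sq_of_orthogonal Finset.univ (fun k _ => h2 k)]
    · refine Finset.sum_congr rfl fun k _ => ?_
      simp only [mul_pow]
      rw [integral_const_mul, (hm k).2.2.1]
      ring
    · intro k _ l _ hkl
      have e : ∀ ω, w k * pilotErr P Y θ₀ c ξ N k ω * (w l * pilotErr P Y θ₀ c ξ N l ω)
          = (w k * w l) * (pilotErr P Y θ₀ c ξ N k ω * pilotErr P Y θ₀ c ξ N l ω) := fun ω => by
        ring
      simp only [e]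
      rw [integral_const_mul, (H.indepFun_pilotErr hkl).integral_fun_mul_eq_mul_integral
        (hm k).1.1 (hm l).1.1, (hm k).2.1]
      simp

theorem pilotDelta_eq (N : ℕ) (k : Fin K) (j : Fin N) (ω : Ω) :
    pilotDelta Y θ₀ c N (fun i => ξ i ω) k j
      = (perf Y P (θ₀ + pilotPert c N k) - perf Y P (θ₀ - pilotPert c N k))
          / (2 * pilotPert c N k)
        + cfdNoise Y P θ₀ (pilotPert c N k) (ξ (.pilot k j true) ω, ξ (.pilot k j false) ω) := by
  rw [cfdNoise, pilotDelta]; ring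

theorem bootMean_pilotDelta (hN : 0 < N) (k : Fin K) (ω : Ω) :
    bootMean (pilotDelta Y θ₀ c N (fun i => ξ i ω) k)
      = deriv (perf Y P) θ₀ + coefB Y P θ₀ * (c k * pilotScale N) ^ 2
        + pilotScale N ^ 4 * (pilotBias P Y θ₀ c N k + pilotErr P Y θ₀ c ξ N k ω) := by
  have ht := (pilotScale_pos hN).ne'
  have hN' : (N : ℝ) ≠ 0 := by positivity
  rw [bootMean_eq hN]
  simp only [pilotDelta_eq (P := P), pilotBias, pilotErr, Finset.sum_add_distrib, Finset.sum_const,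
    Finset.card_univ, Fintype.card_fin, nsmul_eq_mul]
  have e : pilotPert c N k = c k * pilotScale N := rfl
  generalize (∑ j : Fin N, cfdNoise Y P θ₀ (pilotPert c N k)
    (ξ (.pilot k j true) ω, ξ (.pilot k j false) ω)) = s
  generalize (perf Y P (θ₀ + pilotPert c N k) - perf Y P (θ₀ - pilotPert c N k))
          / (2 * pilotPert c N k) = q
  rw [e]
  field_simp
  ring

end

/-! ### Measurability of the statistics of the pilot sample -/

section Measurability

variable {K N : ℕ}

theorem measurable_bootMean (k : Fin K) :
    Measurable fun Δ : Fin K → Fin N → ℝ => bootMean (Δ k) := by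
  unfold bootMean; fun_prop

theorem measurable_bootVar (k : Fin K) :
    Measurable fun Δ : Fin K → Fin N → ℝ => bootVar (Δ k) := by
  have := measurable_bootMean (N := N) k
  unfold bootVar; fun_prop

theorem measurable_betaE (h : Fin K → ℝ) (i : Fin 2) :
    Measurable fun Δ : Fin K → Fin N → ℝ => betaE h Δ i := by
  have := fun k => measurable_bootMean (K := K) (N := N) k
  unfold betaE
  simp only [Matrix.mulVec, dotProduct]
  fun_prop

theorem measurable_betaV (h : Fin K → ℝ) :
    Measurable fun Δ : Fin K → Fin N → ℝ => betaV h Δ := by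
  have := fun k => measurable_bootVar (K := K) (N := N) k
  unfold betaV
  simp only [dotProduct]
  fun_prop

theorem measurable_hHat (n : ℕ) (h : Fin K → ℝ) :
    Measurable fun Δ : Fin K → Fin N → ℝ => hHat n h Δ := by
  have h1 := measurable_betaE (N := N) h 1
  have h2 := measurable_betaV (N := N) h
  unfold hHat
  fun_prop

theorem measurable_fitE (h : Fin K → ℝ) {f : (Fin K → Fin N → ℝ) → ℝ} (hf : Measurable f) :
    Measurable fun Δ : Fin K → Fin N → ℝ => fitE h Δ (f Δ) := by
  have h1 := measurable_betaE (N := N) h 1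
  have h0 := measurable_betaE (N := N) h 0
  exact h0.add ((hf.pow_const 2).mul h1)

theorem measurable_corSample (n : ℕ) (h : Fin K → ℝ) (k : Fin K) (j : Fin N) :
    Measurable fun Δ : Fin K → Fin N → ℝ => corSample n h Δ k j := by
  have h0 := measurable_hHat (N := N) n h
  have h1 := measurable_fitE (N := N) h h0
  have h2 := measurable_fitE (N := N) h (f := fun _ => h k) measurable_const
  have h3 : Measurable fun Δ : Fin K → Fin N → ℝ => |hHat n h Δ| := h0.abs
  have h4 : Measurable fun Δ : Fin K → Fin N → ℝ => Δ k j := by fun_prop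
  exact ((measurable_const.div h3).mul (h4.sub h2)).add h1

theorem measurable_pilotDelta {S : Type*} [MeasurableSpace S] {Y : ℝ → S → ℝ}
    (hY : Measurable (Function.uncurry Y)) (θ₀ : ℝ) (c : Fin K → ℝ) (N : ℕ) {Ω : Type*}
    [m : MeasurableSpace Ω] {ξ : Run K → Ω → S}
    (hξ : ∀ (k : Fin K) (j : ℕ) (b : Bool), Measurable (ξ (.pilot k j b))) :
    Measurable fun ω => pilotDelta Y θ₀ c N (fun i => ξ i ω) := by
  refine measurable_pi_lambda _ fun k => measurable_pi_lambda _ fun j => ?_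
  exact (measurable_cfd hY θ₀).comp
    (measurable_const.prodMk ((hξ k j true).prodMk (hξ k j false)))

end Measurability

theorem LpNull.probNull {Ω : Type*} [MeasurableSpace Ω] {μ : Measure Ω} {p : ℝ≥0∞} (hp : p ≠ 0)
    {f : ℕ → Ω → ℝ} (hf : LpNull μ p f) : ProbNull μ f := by
  have h := tendstoInMeasure_of_tendsto_eLpNorm (g := 0) hp hf.1 aestronglyMeasurable_zero
    (by simpa using hf.2)
  rw [tendstoInMeasure_iff_norm] at h
  intro δ hδ
  simpa using h δ hδ

theorem LpNull.sum {Ω : Type*} [MeasurableSpace Ω] {μ : Measure Ω} {p : ℝ≥0∞} (hp : 1 ≤ p)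
    {ι : Type*} (s : Finset ι) {f : ι → ℕ → Ω → ℝ} (hf : ∀ i ∈ s, LpNull μ p (f i)) :
    LpNull μ p (fun m ω => ∑ i ∈ s, f i m ω) := by
  classical
  induction s using Finset.induction_on with
  | empty =>
    simp only [Finset.sum_empty]
    exact ⟨fun m => aestronglyMeasurable_const, by simp⟩
  | insert i s hi ih =>
    simp only [Finset.sum_insert hi]
    exact (hf i (Finset.mem_insert_self i s)).add hp
      (ih fun j hj => hf j (Finset.mem_insert_of_mem hj))

theorem LpBdd.sum {Ω : Type*} [MeasurableSpace Ω] {μ : Measure Ω} {p : ℝ≥0∞} (hp : 1 ≤ p)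
    {ι : Type*} (s : Finset ι) {f : ι → ℕ → Ω → ℝ} (hf : ∀ i ∈ s, LpBdd μ p (f i)) :
    LpBdd μ p (fun m ω => ∑ i ∈ s, f i m ω) := by
  classical
  induction s using Finset.induction_on with
  | empty =>
    simp only [Finset.sum_empty]
    exact ⟨fun m => aestronglyMeasurable_const, 0, by simp, by simp⟩
  | insert i s hi ih =>
    simp only [Finset.sum_insert hi]
    exact (hf i (Finset.mem_insert_self i s)).add hp
      (ih fun j hj => hf j (Finset.mem_insert_of_mem hj))

theorem LpBdd.const_mul {Ω : Type*} [MeasurableSpace Ω] {μ : Measure Ω} {p : ℝ≥0∞}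
    {f : ℕ → Ω → ℝ} (hf : LpBdd μ p f) (a : ℝ) : LpBdd μ p (fun m ω => a * f m ω) :=
  hf.bdd_mul (f := fun _ _ => a) (fun _ => aestronglyMeasurable_const) (C := |a|) (by simp)

/-! ### Consistency of the variance estimator -/

section

variable {S : Type*} [MeasurableSpace S] {P : Measure S} [IsProbabilityMeasure P]
  {Y : ℝ → S → ℝ} {θ₀ : ℝ} {K : ℕ} {c : Fin K → ℝ} {Ω : Type*} [MeasurableSpace Ω]
  {μ : Measure Ω} [IsProbabilityMeasure μ] {ξ : Run K → Ω → S}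

theorem Sim.indepFun_pilotNoise (H : Sim P Y θ₀ c μ ξ) {N : ℕ} {k : Fin K} {i j : Fin N}
    (hij : i ≠ j) : IndepFun (pilotNoise P Y θ₀ c ξ N k i) (pilotNoise P Y θ₀ c ξ N k j) μ := by
  simpa using H.indepFun_sum_pilotNoise (k := k) {i} j (by simpa using hij.symm)

/-- The law of large numbers for the squared pilot noise. -/
theorem Sim.mean_sq_pilotNoise_null (H : Sim P Y θ₀ c μ ξ) (k : Fin K) :
    LpNull μ 2 (fun N ω => (∑ j : Fin N, pilotNoise P Y θ₀ c ξ N k j ω ^ 2) / N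
      - noiseVar Y P θ₀ (pilotPert c N k)) := by
  obtain ⟨M, hM, hgood⟩ := H.eventually_goodPert
  have hmeas : ∀ N, Measurable (fun ω => (∑ j : Fin N, pilotNoise P Y θ₀ c ξ N k j ω ^ 2) / N
      - noiseVar Y P θ₀ (pilotPert c N k)) := fun N =>
    ((Finset.measurable_sum _ fun j _ => (measurable_pilotNoise H.meas fun b =>
      H.input _).pow_const 2).div_const _).sub_const _
  have key : ∀ᶠ N : ℕ in atTop, MemLp (fun ω => (∑ j : Fin N, pilotNoise P Y θ₀ c ξ N k j ω ^ 2) / N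
      - noiseVar Y P θ₀ (pilotPert c N k)) 2 μ ∧
      ∫ ω, ((∑ j : Fin N, pilotNoise P Y θ₀ c ξ N k j ω ^ 2) / N
      - noiseVar Y P θ₀ (pilotPert c N k)) ^ 2 ∂μ ≤ M ^ 2 * (N : ℝ)⁻¹ := by
    filter_upwards [hgood, eventually_gt_atTop 0] with N hg hN
    have hN' : (N : ℝ) ≠ 0 := by positivity
    set ν := noiseVar Y P θ₀ (pilotPert c N k) with hν
    set V : Fin N → Ω → ℝ := fun j ω => pilotNoise P Y θ₀ c ξ N k j ω ^ 2 - ν with hV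
    have hX := fun j => H.pilotNoise_memLp (hg k) j
    have hX2 : ∀ j, MemLp (fun ω => pilotNoise P Y θ₀ c ξ N k j ω ^ 2) 2 μ := by
      intro j
      have hm : AEStronglyMeasurable (fun ω => pilotNoise P Y θ₀ c ξ N k j ω ^ 2) μ :=
        (hX j).1.pow 2
      rw [memLp_two_iff_integrable_sq hm]
      refine ((hX j).integrable_norm_pow (by norm_num)).congr (Eventually.of_forall fun ω => ?_)
      simp only [Real.norm_eq_abs]
      rw [← pow_mul, ← abs_pow, abs_of_nonneg (Even.pow_nonneg (by decide) _)]
    have hVm : ∀ j, MemLp (V j) 2 μ := fun j => (hX2 j).sub (memLp_const ν)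
    have hV0 : ∀ j, ∫ ω, V j ω ∂μ = 0 := fun j => by
      simp only [hV]
      rw [integral_sub ((hX2 j).integrable one_le_two) (integrable_const _),
        H.integral_pilotNoise_sq j]
      simp [hν]
    have hV2 : ∀ j, ∫ ω, V j ω ^ 2 ∂μ ≤ M ^ 2 := fun j => by
      have e : ∀ ω, V j ω ^ 2 = pilotNoise P Y θ₀ c ξ N k j ω ^ 4
          - 2 * ν * pilotNoise P Y θ₀ c ξ N k j ω ^ 2 + ν ^ 2 := fun ω => by
        simp only [hV]; ring
      have i4 : Integrable (fun ω => pilotNoise P Y θ₀ c ξ N k j ω ^ 4) μ := by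
        refine ((hX2 j).integrable_sq).congr (Eventually.of_forall fun ω => ?_)
        ring
      have i2 : Integrable (fun ω => 2 * ν * pilotNoise P Y θ₀ c ξ N k j ω ^ 2) μ :=
        ((hX2 j).integrable one_le_two).const_mul _
      have i42 : Integrable (fun ω => pilotNoise P Y θ₀ c ξ N k j ω ^ 4
          - 2 * ν * pilotNoise P Y θ₀ c ξ N k j ω ^ 2) μ := i4.sub i2
      simp only [e]
      rw [integral_add i42 (integrable_const _), integral_sub i4 i2, integral_const_mul,
        H.integral_pilotNoise_sq j]
      have := H.integral_pilotNoise_fourth (hg k) j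
      simp only [integral_const, probReal_univ, smul_eq_mul, one_mul]
      nlinarith [sq_nonneg ν]
    have orth : ∫ ω, (∑ j, V j ω) ^ 2 ∂μ = ∑ j, ∫ ω, V j ω ^ 2 ∂μ := by
      refine integral_sum_sq_of_orthogonal Finset.univ (fun j _ => hVm j) fun i _ j _ hij => ?_
      have hind : IndepFun (V i) (V j) μ := (H.indepFun_pilotNoise hij).comp
        (φ := fun x => x ^ 2 - ν) (ψ := fun x => x ^ 2 - ν) (by fun_prop) (by fun_prop)
      rw [hind.integral_fun_mul_eq_mul_integral (hVm i).1 (hVm j).1, hV0 i, zero_mul]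
    have e : ∀ ω, (∑ j : Fin N, pilotNoise P Y θ₀ c ξ N k j ω ^ 2) / N - ν
        = (N : ℝ)⁻¹ * ∑ j, V j ω := fun ω => by
      simp only [hV, Finset.sum_sub_distrib, Finset.sum_const, Finset.card_univ, Fintype.card_fin,
        nsmul_eq_mul]
      field_simp
    simp only [e]
    refine ⟨(memLp_finsetSum _ fun j _ => hVm j).const_mul _, ?_⟩
    simp only [mul_pow]
    rw [integral_const_mul, orth]
    calc ((N : ℝ)⁻¹) ^ 2 * ∑ j, ∫ ω, V j ω ^ 2 ∂μ ≤ ((N : ℝ)⁻¹) ^ 2 * ∑ _j : Fin N, M ^ 2 := by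
          gcongr with j; exact hV2 j
      _ = M ^ 2 * (N : ℝ)⁻¹ := by
          simp only [Finset.sum_const, Finset.card_univ, Fintype.card_fin, nsmul_eq_mul]
          field_simp
  refine LpNull.of_integral_sq (fun N => (hmeas N).aestronglyMeasurable)
    (key.mono fun _ h => h.1) ?_
  refine tendsto_of_tendsto_of_tendsto_of_le_of_le' tendsto_const_nhds
    (?_ : Tendsto (fun N : ℕ => M ^ 2 * (N : ℝ)⁻¹) atTop (𝓝 0))
    (Eventually.of_forall fun _ => integral_nonneg fun _ => sq_nonneg _) (key.mono fun _ h => h.2)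
  simpa using (tendsto_inv_atTop_nhds_zero_nat (𝕜 := ℝ)).const_mul (M ^ 2)

/-- The bootstrap variance in terms of the noise. -/
theorem bootVar_pilotDelta {N : ℕ} (hN : 1 < N) {k : Fin K} (hc : c k ≠ 0) (ω : Ω) :
    bootVar (pilotDelta Y θ₀ c N (fun i => ξ i ω) k)
      = designV N (pilotPert c N) k * (2 / ((N : ℝ) - 1) *
        (∑ j : Fin N, pilotNoise P Y θ₀ c ξ N k j ω ^ 2
          - c k ^ 2 * pilotErr P Y θ₀ c ξ N k ω ^ 2)) := by
  have hN0 : 0 < N := by omega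
  have hN' : (N : ℝ) ≠ 0 := by positivity
  have hN1 : (N : ℝ) - 1 ≠ 0 := by
    have : (1 : ℝ) < N := by exact_mod_cast hN
    linarith
  have ht := (pilotScale_pos hN0).ne'
  have hs := pilotScale_pow hN0
  have hh : pilotPert c N k ≠ 0 := mul_ne_zero hc ht
  have hsq : c k ^ 2 * pilotErr P Y θ₀ c ξ N k ω ^ 2
      = (∑ j : Fin N, pilotNoise P Y θ₀ c ξ N k j ω) ^ 2 / N := by
    rw [pilotErr_eq hN0 hc, mul_pow, div_pow]
    field_simp
    linear_combination (∑ j : Fin N, pilotNoise P Y θ₀ c ξ N k j ω) ^ 2 * hs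
  have hdev : ∀ j : Fin N, pilotDelta Y θ₀ c N (fun i => ξ i ω) k j
      - (∑ i, pilotDelta Y θ₀ c N (fun i => ξ i ω) k i) / N
      = (pilotPert c N k)⁻¹ * (pilotNoise P Y θ₀ c ξ N k j ω
        - (∑ i : Fin N, pilotNoise P Y θ₀ c ξ N k i ω) / N) := by
    intro j
    simp only [pilotDelta_eq (P := P), pilotNoise, Finset.sum_add_distrib, Finset.sum_const,
      Finset.card_univ, Fintype.card_fin, nsmul_eq_mul, ← Finset.mul_sum]
    generalize (∑ j : Fin N, cfdNoise Y P θ₀ (pilotPert c N k)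
      (ξ (.pilot k j true) ω, ξ (.pilot k j false) ω)) = s
    generalize (perf Y P (θ₀ + pilotPert c N k) - perf Y P (θ₀ - pilotPert c N k))
          / (2 * pilotPert c N k) = q
    field_simp
    ring
  have hvar : ∑ j : Fin N, (pilotNoise P Y θ₀ c ξ N k j ω
        - (∑ i : Fin N, pilotNoise P Y θ₀ c ξ N k i ω) / N) ^ 2
      = ∑ j : Fin N, pilotNoise P Y θ₀ c ξ N k j ω ^ 2
        - (∑ j : Fin N, pilotNoise P Y θ₀ c ξ N k j ω) ^ 2 / N := by
    set s := ∑ j : Fin N, pilotNoise P Y θ₀ c ξ N k j ω with hsdef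
    have e : ∀ j : Fin N, (pilotNoise P Y θ₀ c ξ N k j ω - s / N) ^ 2
        = pilotNoise P Y θ₀ c ξ N k j ω ^ 2 - 2 * (s / N) * pilotNoise P Y θ₀ c ξ N k j ω
          + (s / N) ^ 2 := fun j => by ring
    simp only [e, Finset.sum_add_distrib, Finset.sum_sub_distrib, ← Finset.mul_sum, ← hsdef,
      Finset.sum_const, Finset.card_univ, Fintype.card_fin, nsmul_eq_mul]
    field_simp
    ring
  rw [bootVar_eq hN0]
  simp only [hdev, mul_pow, ← Finset.mul_sum]
  rw [hvar, hsq, designV]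
  field_simp

theorem betaV_pilotDelta {N : ℕ} (hN : 1 < N) (hc : ∀ k, c k ≠ 0) (hK : 0 < K) (s : ℝ) (ω : Ω) :
    betaV (pilotPert c N) (pilotDelta Y θ₀ c N (fun i => ξ i ω)) - s
      = ∑ k, (c k ^ 4)⁻¹ / (∑ l, (c l ^ 4)⁻¹) * (2 / ((N : ℝ) - 1) *
        (∑ j : Fin N, pilotNoise P Y θ₀ c ξ N k j ω ^ 2
          - c k ^ 2 * pilotErr P Y θ₀ c ξ N k ω ^ 2) - s) := by
  have hN0 : 0 < N := by omega
  have hN' : (N : ℝ) ≠ 0 := by positivity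
  have hN1 : (N : ℝ) - 1 ≠ 0 := by
    have : (1 : ℝ) < N := by exact_mod_cast hN
    linarith
  have ht := (pilotScale_pos hN0).ne'
  have hw : 0 < ∑ l, (c l ^ 4)⁻¹ := by
    have : Nonempty (Fin K) := ⟨⟨0, hK⟩⟩
    exact Finset.sum_pos (fun l _ => inv_pos.2 (by have := hc l; positivity)) Finset.univ_nonempty
  have hd : ∀ k, designV N (pilotPert c N) k * designV N (pilotPert c N) k
      = (((N : ℝ) - 1) / (2 * (N : ℝ) ^ 2 * pilotScale N ^ 2)) ^ 2 * (c k ^ 4)⁻¹ := by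
    intro k
    have e : pilotPert c N k = c k * pilotScale N := rfl
    have := hc k
    rw [designV, e]
    field_simp
  have hκ : (((N : ℝ) - 1) / (2 * (N : ℝ) ^ 2 * pilotScale N ^ 2)) ^ 2 ≠ 0 := by positivity
  rw [betaV]
  simp only [dotProduct, bootVar_pilotDelta (P := P) hN (hc _), ← mul_assoc (designV _ _ _), hd,
    mul_sub _ _ s, Finset.sum_sub_distrib]
  rw [← Finset.mul_sum, ← Finset.sum_mul, ← Finset.sum_div, div_self hw.ne', one_mul]
  congr 1
  simp only [mul_assoc]
  rw [← Finset.mul_sum]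
  simp only [div_mul_eq_mul_div, ← Finset.sum_div]
  field_simp

/-- `β̂_v` converges to `σ²` in `L²`. -/
theorem Sim.betaV_null (H : Sim P Y θ₀ c μ ξ) :
    LpNull μ 2 (fun N ω => betaV (pilotPert c N) (pilotDelta Y θ₀ c N (fun i => ξ i ω))
      - sd Y P θ₀ ^ 2) := by
  have hK : 0 < K := by
    obtain ⟨j, -⟩ := H.c_sq
    exact j.pos
  set s := sd Y P θ₀ ^ 2 with hsdef
  have hN1 : ∀ᶠ N : ℕ in atTop, 1 < N := eventually_gt_atTop 1
  have hinv : Tendsto (fun N : ℕ => 2 / ((N : ℝ) - 1)) atTop (𝓝 0) :=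
    tendsto_const_nhds.div_atTop
      (tendsto_atTop_add_const_right _ (-1) tendsto_natCast_atTop_atTop)
  have hratio : Tendsto (fun N : ℕ => 2 / ((N : ℝ) - 1) * N) atTop (𝓝 2) := by
    have h := hinv.add_const 2
    rw [zero_add] at h
    refine h.congr' ?_
    filter_upwards [hN1] with N hN
    have : (N : ℝ) - 1 ≠ 0 := by
      have : (1 : ℝ) < N := by exact_mod_cast hN
      linarith
    field_simp
    ring
  have hmeas : ∀ N, Measurable (fun ω =>
      betaV (pilotPert c N) (pilotDelta Y θ₀ c N (fun i => ξ i ω)) - s) := fun N =>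
    ((measurable_betaV _).comp (measurable_pilotDelta H.meas θ₀ c N fun _ _ _ =>
      H.input _)).sub_const _
  have hterm : ∀ k, LpNull μ 2 (fun N ω => (c k ^ 4)⁻¹ / (∑ l, (c l ^ 4)⁻¹) *
      ((2 / ((N : ℝ) - 1) * N) * ((∑ j : Fin N, pilotNoise P Y θ₀ c ξ N k j ω ^ 2) / N
        - noiseVar Y P θ₀ (pilotPert c N k))
      + ((2 / ((N : ℝ) - 1) * N) * noiseVar Y P θ₀ (pilotPert c N k) - s)
      + (-(c k ^ 2 * (2 / ((N : ℝ) - 1))) * pilotErr P Y θ₀ c ξ N k ω)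
        * pilotErr P Y θ₀ c ξ N k ω)) := by
    intro k
    refine LpNull.bdd_mul (f := fun _ _ => (c k ^ 4)⁻¹ / (∑ l, (c l ^ 4)⁻¹))
      (C := |(c k ^ 4)⁻¹ / (∑ l, (c l ^ 4)⁻¹)|) ?_ (fun _ => aestronglyMeasurable_const)
      (Eventually.of_forall fun _ _ => le_rfl)
    refine LpNull.add one_le_two (LpNull.add one_le_two ?_ ?_) ?_
    · refine LpNull.bdd_mul (f := fun N _ => 2 / ((N : ℝ) - 1) * N) (C := 3)
        (H.mean_sq_pilotNoise_null k) (fun _ => aestronglyMeasurable_const) ?_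
      have habs := hratio.abs
      filter_upwards [habs.eventually_le_const (show |(2 : ℝ)| < 3 by norm_num)] with N h _
      exact h
    · refine LpNull.of_tendsto ?_
      have h := (hratio.mul (H.tendsto_noiseVar_pilot k)).sub_const s
      rw [hsdef] at h ⊢
      rwa [show 2 * (sd Y P θ₀ ^ 2 / 2) - sd Y P θ₀ ^ 2 = 0 by ring] at h
    · refine LpNull.mul_bdd (LpBdd.null_mul (H.pilotErr_bdd k) ?_) (H.pilotErr_bdd k)
      simpa using (hinv.const_mul (c k ^ 2)).neg
  refine (LpNull.sum one_le_two Finset.univ fun k _ => hterm k).congr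
    (fun N => (hmeas N).aestronglyMeasurable) ?_
  filter_upwards [hN1] with N hN ω
  rw [betaV_pilotDelta (P := P) hN H.c_ne hK]
  refine Finset.sum_congr rfl fun k _ => ?_
  have hN' : (N : ℝ) ≠ 0 := by positivity
  congr 1
  field_simp
  ring

end

/-! ### The additional runs -/

section

set_option linter.unusedSectionVars false

variable {S : Type*} [MeasurableSpace S] {P : Measure S} [IsProbabilityMeasure P]
  {Y : ℝ → S → ℝ} {θ₀ : ℝ} {K : ℕ} {c : Fin K → ℝ} {Ω : Type*} [MeasurableSpace Ω]
  {μ : Measure Ω} [IsProbabilityMeasure μ] {ξ : Run K → Ω → S}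

/-- The inputs of the `i`-th additional pair. -/
def freshPair (ξ : Run K → Ω → S) (i : ℕ) (ω : Ω) : S × S :=
  (ξ (.fresh i true) ω, ξ (.fresh i false) ω)

theorem Sim.measurable_freshPair (H : Sim P Y θ₀ c μ ξ) (i : ℕ) : Measurable (freshPair ξ i) :=
  (H.input _).prodMk (H.input _)

theorem Sim.map_freshPair (H : Sim P Y θ₀ c μ ξ) (i : ℕ) : μ.map (freshPair ξ i) = P.prod P :=
  H.map_pair (by simp)

theorem Sim.indepFun_freshPair (H : Sim P Y θ₀ c μ ξ) {β : Type*} [MeasurableSpace β] {X : Ω → β}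
    (i : ℕ) (hX : ∀ m : MeasurableSpace Ω, (∀ r, (∀ b, r ≠ .fresh i b) → Measurable[m] (ξ r)) →
      Measurable[m] X) : IndepFun X (freshPair ξ i) μ := by
  refine indepFun_of_disjoint H.input H.indep (s := {r | ∀ b, r ≠ .fresh i b})
    (t := {r | ∃ b, r = .fresh i b}) ?_ hX ?_
  · rw [Set.disjoint_left]
    rintro r h ⟨b, rfl⟩
    exact h b rfl
  · exact fun m hm => (hm _ ⟨true, rfl⟩).prodMk (hm _ ⟨false, rfl⟩)

/-- The noise at a perturbation which is independent of the inputs is centred. -/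
theorem Sim.integral_mul_noise_eq_zero (H : Sim P Y θ₀ c μ ξ) {β : Type*} [MeasurableSpace β]
    {X : Ω → β} (hX : Measurable X) {i : ℕ} (hind : IndepFun X (freshPair ξ i) μ) {a h : β → ℝ}
    (ha : Measurable a) (hh : Measurable h)
    (hL : ∀ x, a x ≠ 0 → MemLp (Y (θ₀ + h x)) 2 P ∧ MemLp (Y (θ₀ - h x)) 2 P) :
    ∫ ω, a (X ω) * cfdNoise Y P θ₀ (h (X ω)) (freshPair ξ i ω) ∂μ = 0 := by
  refine integral_eq_zero_of_centred hX (H.measurable_freshPair i) hind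
    (F := fun z => a z.1 * cfdNoise Y P θ₀ (h z.1) z.2) ?_ fun x => ?_
  · exact (ha.comp measurable_fst).mul ((measurable_cfdNoise H.meas θ₀).comp
      ((hh.comp measurable_fst).prodMk measurable_snd))
  · dsimp only
    rw [integral_const_mul, H.map_freshPair]
    by_cases hx : a x = 0
    · simp [hx]
    · rw [integral_cfdNoise (hL x hx).1 (hL x hx).2, mul_zero]

variable {N : ℕ}

/-- The noise of the `i`-th additional pair at the perturbation `h`, which is a function of the
pilot sample, on the event that the pilot sample belongs to `G`. -/
noncomputable def freshNoise (P : Measure S) (Y : ℝ → S → ℝ) (θ₀ : ℝ) (c : Fin K → ℝ)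
    (ξ : Run K → Ω → S) (G : Set (Fin K → Fin N → ℝ)) (h : (Fin K → Fin N → ℝ) → ℝ) (i : ℕ)
    (ω : Ω) : ℝ :=
  G.indicator 1 (pilotDelta Y θ₀ c N fun r => ξ r ω) *
    cfdNoise Y P θ₀ (h (pilotDelta Y θ₀ c N fun r => ξ r ω)) (freshPair ξ i ω)

variable {G : Set (Fin K → Fin N → ℝ)} {h : (Fin K → Fin N → ℝ) → ℝ}

theorem Sim.measurable_freshNoise (H : Sim P Y θ₀ c μ ξ) (hG : MeasurableSet G)
    (hh : Measurable h) (i : ℕ) : Measurable (freshNoise P Y θ₀ c ξ G h i) := by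
  have hT := measurable_pilotDelta H.meas θ₀ c N (ξ := ξ) fun _ _ _ => H.input _
  exact ((measurable_one.indicator hG).comp hT).mul ((measurable_cfdNoise H.meas θ₀).comp
    ((hh.comp hT).prodMk (H.measurable_freshPair i)))

theorem Sim.freshNoise_sq (H : Sim P Y θ₀ c μ ξ) (hG : MeasurableSet G) (hh : Measurable h)
    (hL : ∀ x ∈ G, MemLp (Y (θ₀ + h x)) 2 P ∧ MemLp (Y (θ₀ - h x)) 2 P) {C : ℝ} (hC0 : 0 ≤ C)
    (hC : ∀ x ∈ G, h x ≠ 0 ∧ noiseVar Y P θ₀ (h x) / h x ^ 2 ≤ C) (i : ℕ) :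
    MemLp (freshNoise P Y θ₀ c ξ G h i) 2 μ ∧
    ∫ ω, freshNoise P Y θ₀ c ξ G h i ω ^ 2 ∂μ
      = ∫ ω, G.indicator (fun x => noiseVar Y P θ₀ (h x) / h x ^ 2)
          (pilotDelta Y θ₀ c N fun r => ξ r ω) ∂μ := by
  have hT := measurable_pilotDelta H.meas θ₀ c N (ξ := ξ) fun _ _ _ => H.input _
  have hind : IndepFun (fun ω => pilotDelta Y θ₀ c N fun r => ξ r ω) (freshPair ξ i) μ := by
    have hY := H.meas
    exact H.indepFun_freshPair i fun m hm => measurable_pilotDelta (m := m) hY θ₀ c N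
      fun k j b => hm _ (by simp)
  have hF : Measurable fun z : (Fin K → Fin N → ℝ) × (S × S) =>
      G.indicator (1 : (Fin K → Fin N → ℝ) → ℝ) z.1 * cfdNoise Y P θ₀ (h z.1) z.2 :=
    ((measurable_one.indicator hG).comp measurable_fst).mul ((measurable_cfdNoise H.meas θ₀).comp
      ((hh.comp measurable_fst).prodMk measurable_snd))
  have hfib : ∀ x, ∫ p, (G.indicator (1 : (Fin K → Fin N → ℝ) → ℝ) x * cfdNoise Y P θ₀ (h x) p) ^ 2
      ∂(P.prod P) = G.indicator (fun x => noiseVar Y P θ₀ (h x) / h x ^ 2) x := by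
    intro x
    by_cases hx : x ∈ G
    · have := (hC x hx).1
      simp only [Set.indicator_of_mem hx, Pi.one_apply, one_mul, noiseVar]
      field_simp
    · simp [Set.indicator_of_notMem hx]
  have key := memLp_two_of_fibre_bound (C := C) hT (H.measurable_freshPair i) hind hF ?_ ?_
  · refine ⟨key.1, key.2.trans ?_⟩
    rw [H.map_freshPair]
    simp only [hfib]
  · intro x
    rw [H.map_freshPair]
    by_cases hx : x ∈ G
    · simp only [Set.indicator_of_mem hx, Pi.one_apply, one_mul]
      exact (memLp_cfdNoise (hL x hx).1 (hL x hx).2).integrable_sq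
    · simp [Set.indicator_of_notMem hx]
  · intro x
    rw [H.map_freshPair]
    simp only [hfib]
    exact Set.indicator_apply_le' (fun hx => (hC x hx).2) fun _ => hC0

theorem Sim.integral_freshNoise_mul (H : Sim P Y θ₀ c μ ξ) (hG : MeasurableSet G)
    (hh : Measurable h)
    (hL : ∀ x ∈ G, MemLp (Y (θ₀ + h x)) 2 P ∧ MemLp (Y (θ₀ - h x)) 2 P) (i : ℕ)
    {A : Ω → ℝ} (hAm : Measurable A)
    (hA : ∀ m : MeasurableSpace Ω, (∀ r, (∀ b, r ≠ .fresh i b) → Measurable[m] (ξ r)) →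
      Measurable[m] A) :
    ∫ ω, freshNoise P Y θ₀ c ξ G h i ω * A ω ∂μ = 0 := by
  have hY := H.meas
  have hT := measurable_pilotDelta hY θ₀ c N (ξ := ξ) fun _ _ _ => H.input _
  have hind : IndepFun (fun ω => (pilotDelta Y θ₀ c N (fun r => ξ r ω), A ω))
      (freshPair ξ i) μ :=
    H.indepFun_freshPair i fun m hm => Measurable.prodMk
      (measurable_pilotDelta (m := m) hY θ₀ c N fun k j b => hm _ (by simp)) (hA m hm)
  have := H.integral_mul_noise_eq_zero (hT.prodMk hAm) hind
    (a := fun z => G.indicator 1 z.1 * z.2) (h := fun z => h z.1)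
    (((measurable_one.indicator hG).comp measurable_fst).mul measurable_snd)
    (hh.comp measurable_fst) fun z hz => hL z.1 ?_
  · rw [← this]
    congr 1
    ext ω
    simp only [freshNoise]
    ring
  · by_contra hx
    simp [Set.indicator_of_notMem hx] at hz

/-- The moments of the noise of the additional runs. -/
theorem Sim.sum_freshNoise (H : Sim P Y θ₀ c μ ξ) (hG : MeasurableSet G) (hh : Measurable h)
    (hL : ∀ x ∈ G, MemLp (Y (θ₀ + h x)) 2 P ∧ MemLp (Y (θ₀ - h x)) 2 P) {C : ℝ} (hC0 : 0 ≤ C)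
    (hC : ∀ x ∈ G, h x ≠ 0 ∧ noiseVar Y P θ₀ (h x) / h x ^ 2 ≤ C) (n : ℕ) (w : Fin K → ℝ) :
    MemLp (fun ω => ∑ i ∈ Finset.range n, freshNoise P Y θ₀ c ξ G h i ω) 2 μ ∧
    ∫ ω, ∑ i ∈ Finset.range n, freshNoise P Y θ₀ c ξ G h i ω ∂μ = 0 ∧
    ∫ ω, (∑ i ∈ Finset.range n, freshNoise P Y θ₀ c ξ G h i ω) ^ 2 ∂μ
      = n * ∫ ω, G.indicator (fun x => noiseVar Y P θ₀ (h x) / h x ^ 2)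
          (pilotDelta Y θ₀ c N fun r => ξ r ω) ∂μ ∧
    (MemLp (fun ω => ∑ k, w k * pilotErr P Y θ₀ c ξ N k ω) 2 μ →
    ∫ ω, (∑ i ∈ Finset.range n, freshNoise P Y θ₀ c ξ G h i ω) *
      (∑ k, w k * pilotErr P Y θ₀ c ξ N k ω) ∂μ = 0) := by
  have hY := H.meas
  have hf := H.freshNoise_sq hG hh hL hC0 hC
  refine ⟨memLp_finsetSum _ fun i _ => (hf i).1, ?_, ?_, fun hA => ?_⟩
  · rw [integral_finsetSum _ fun i _ => (hf i).1.integrable one_le_two]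
    refine Finset.sum_eq_zero fun i _ => ?_
    simpa using H.integral_freshNoise_mul hG hh hL i (A := fun _ => 1) measurable_const
      fun m _ => measurable_const
  · rw [integral_sum_sq_of_orthogonal _ (fun i _ => (hf i).1)]
    · simp only [(hf _).2, Finset.sum_const, Finset.card_range, nsmul_eq_mul]
    · intro i _ j _ hij
      refine H.integral_freshNoise_mul hG hh hL i (H.measurable_freshNoise hG hh j) fun m hm => ?_
      have hT := measurable_pilotDelta (m := m) hY θ₀ c N (ξ := ξ) fun k j b => hm _ (by simp)
      have hp : Measurable[m] (freshPair ξ j) :=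
        (hm (.fresh j true) (by simp [hij.symm])).prodMk (hm (.fresh j false) (by simp [hij.symm]))
      exact Measurable.mul ((measurable_one.indicator hG).comp hT)
        ((measurable_cfdNoise hY θ₀).comp ((hh.comp hT).prodMk hp))
  · simp only [Finset.sum_mul]
    have hi : ∀ i ∈ Finset.range n, Integrable (fun ω => freshNoise P Y θ₀ c ξ G h i ω *
      ∑ k, w k * pilotErr P Y θ₀ c ξ N k ω) μ := fun i _ => (hf i).1.integrable_mul hA
    rw [integral_finsetSum _ hi]
    refine Finset.sum_eq_zero fun i _ => ?_
    refine H.integral_freshNoise_mul hG hh hL i ?_ fun m hm => ?_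
    · exact Finset.measurable_sum _ fun k _ => (measurable_pilotErr hY fun _ _ =>
        H.input _).const_mul _
    · exact Finset.measurable_sum _ fun k _ => (measurable_pilotErr (m := m) hY fun _ _ =>
        hm _ (by simp)).const_mul _

end

/-! ### The estimated perturbation -/

/-- The normalized optimal perturbation as a function of `B` and `σ²`. -/
noncomputable def rho (z : ℝ × ℝ) : ℝ := (z.2 / (4 * z.1 ^ 2)) ^ (1 / 6 : ℝ)

/-- Pairs of estimates of `B` and `σ²` with an error less than `ε`. -/
def goodBox (B s ε : ℝ) : Set (ℝ × ℝ) := {z | |z.1 - B| < ε ∧ |z.2 - s| < ε}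

/-- The pilot estimates of `B` and `σ²`. -/
noncomputable def pilotEst {K N : ℕ} (c : Fin K → ℝ) (x : Fin K → Fin N → ℝ) : ℝ × ℝ :=
  (betaE (pilotPert c N) x 1, betaV (pilotPert c N) x)

/-- Pilot samples for which the estimates of `B` and `σ²` have an error less than `ε`. -/
def goodSet {K : ℕ} (c : Fin K → ℝ) (N : ℕ) (B s ε : ℝ) : Set (Fin K → Fin N → ℝ) :=
  {x | pilotEst c x ∈ goodBox B s ε}

theorem measurableSet_goodBox (B s ε : ℝ) : MeasurableSet (goodBox B s ε) := by
  have h1 : MeasurableSet {z : ℝ × ℝ | |z.1 - B| < ε} :=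
    measurableSet_lt (measurable_fst.sub_const B).abs measurable_const
  have h2 : MeasurableSet {z : ℝ × ℝ | |z.2 - s| < ε} :=
    measurableSet_lt (measurable_snd.sub_const s).abs measurable_const
  exact h1.inter h2

theorem measurable_pilotEst {K N : ℕ} (c : Fin K → ℝ) :
    Measurable fun x : Fin K → Fin N → ℝ => pilotEst c x :=
  (measurable_betaE _ 1).prodMk (measurable_betaV _)

theorem measurableSet_goodSet {K : ℕ} (c : Fin K → ℝ) (N : ℕ) (B s ε : ℝ) :
    MeasurableSet (goodSet c N B s ε) :=
  measurable_pilotEst c (measurableSet_goodBox B s ε)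

theorem measurable_rho : Measurable rho := by
  unfold rho; fun_prop

theorem goodBox_snd_pos {B s ε : ℝ} (hs : ε < s) {z : ℝ × ℝ} (hz : z ∈ goodBox B s ε) :
    0 < z.2 := by
  have := abs_lt.1 hz.2
  linarith

theorem rho_bounds {B s ε : ℝ} (hε : 0 < ε) (hB : ε < |B|) (hs : ε < s) :
    ∃ ρ₁ ρ₂ : ℝ, 0 < ρ₁ ∧ ∀ z ∈ goodBox B s ε, ρ₁ ≤ rho z ∧ rho z ≤ ρ₂ := by
  have hB1 : 0 < |B| - ε := by linarith
  have hs1 : 0 < s - ε := by linarith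
  refine ⟨((s - ε) / (4 * (|B| + ε) ^ 2)) ^ (1 / 6 : ℝ),
    ((s + ε) / (4 * (|B| - ε) ^ 2)) ^ (1 / 6 : ℝ), by positivity, fun z hz => ?_⟩
  have h1 := abs_lt.1 hz.2
  have h2 : |z.1| ≤ |B| + ε := by
    have := abs_sub_abs_le_abs_sub z.1 B
    linarith [hz.1]
  have h3 : |B| - ε ≤ |z.1| := by
    have := abs_sub_abs_le_abs_sub B z.1
    rw [abs_sub_comm] at this
    linarith [hz.1]
  have hz0 : 0 < |z.1| := by linarith
  have hz2 : 0 < z.2 := goodBox_snd_pos hs hz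
  unfold rho
  rw [← sq_abs z.1]
  constructor
  · refine Real.rpow_le_rpow (by positivity) ?_ (by norm_num)
    gcongr; linarith
  · refine Real.rpow_le_rpow (by positivity) ?_ (by norm_num)
    gcongr <;> linarith

theorem rho_pos {B s : ℝ} (hB : B ≠ 0) (hs : 0 < s) : 0 < rho (B, s) := by
  unfold rho; positivity

theorem continuousAt_rho {B s : ℝ} (hB : B ≠ 0) : ContinuousAt rho (B, s) := by
  unfold rho
  refine ContinuousAt.rpow_const ?_ (Or.inr (by norm_num))
  exact ContinuousAt.div (by fun_prop) (by fun_prop) (by simpa using hB)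

/-- The normalization `n^{-1/6}` of the optimal perturbation. -/
noncomputable def sampleScale (n : ℕ) : ℝ := (n : ℝ) ^ (-(1 / 6) : ℝ)

theorem sampleScale_pos {n : ℕ} (hn : 0 < n) : 0 < sampleScale n :=
  Real.rpow_pos_of_pos (by exact_mod_cast hn) _

theorem sampleScale_pow {n : ℕ} (hn : 0 < n) : (n : ℝ) * sampleScale n ^ 6 = 1 := by
  have h : (0 : ℝ) < n := by exact_mod_cast hn
  rw [sampleScale, ← Real.rpow_natCast, ← Real.rpow_mul h.le]
  norm_num
  rw [Real.rpow_neg_one, mul_inv_cancel₀ h.ne']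

theorem tendsto_sampleScale : Tendsto sampleScale atTop (𝓝 0) :=
  (tendsto_rpow_neg_atTop (by norm_num : (0 : ℝ) < 1 / 6)).comp tendsto_natCast_atTop_atTop

theorem hHat_eq {K N n : ℕ} {c : Fin K → ℝ} {B s ε : ℝ} (hs : ε < s) {x : Fin K → Fin N → ℝ}
    (hx : x ∈ goodSet c N B s ε) :
    hHat n (pilotPert c N) x = sampleScale n * rho (pilotEst c x) := by
  have hv : 0 < (pilotEst c x).2 := goodBox_snd_pos hs hx
  have e : betaV (pilotPert c N) x / (4 * n * betaE (pilotPert c N) x 1 ^ 2)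
      = (n : ℝ)⁻¹ * ((pilotEst c x).2 / (4 * (pilotEst c x).1 ^ 2)) := by
    simp only [pilotEst]
    rw [mul_comm (4 : ℝ), mul_assoc, div_mul_eq_div_div, div_div, div_eq_mul_inv, mul_inv]
    ring
  rw [hHat, e, Real.mul_rpow (by positivity) (by positivity), sampleScale, rho,
    Real.rpow_neg (by positivity), Real.inv_rpow (by positivity)]

theorem eventually_goodSet {K : ℕ} {c : Fin K → ℝ} {B s ε : ℝ} (hε : 0 < ε) (hB : ε < |B|)
    (hs : ε < s) {n nb : ℕ → ℕ} (hn : Tendsto n atTop atTop) {Q : ℝ → Prop}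
    (hQ : ∀ᶠ h in 𝓝[≠] (0 : ℝ), Q h) :
    ∀ᶠ m in atTop, ∀ x ∈ goodSet c (nb m) B s ε, Q (hHat (n m) (pilotPert c (nb m)) x) := by
  obtain ⟨ρ₁, ρ₂, hρ₁, hρ⟩ := rho_bounds hε hB hs
  obtain ⟨δ, hδ, hball⟩ := Metric.mem_nhdsWithin_iff.1 hQ
  have h0 : Tendsto (fun m => sampleScale (n m) * ρ₂) atTop (𝓝 0) := by
    simpa using (tendsto_sampleScale.comp hn).mul_const ρ₂
  filter_upwards [h0.eventually_lt_const hδ, hn.eventually_gt_atTop 0] with m hm hnm x hx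
  have hu := sampleScale_pos hnm
  obtain ⟨h1, h2⟩ := hρ _ hx
  rw [hHat_eq hs hx]
  have hpos : 0 < sampleScale (n m) * rho (pilotEst c x) := mul_pos hu (hρ₁.trans_le h1)
  refine hball ⟨?_, hpos.ne'⟩
  rw [Metric.mem_ball, Real.dist_eq, sub_zero, abs_of_pos hpos]
  exact (mul_le_mul_of_nonneg_left h2 hu.le).trans_lt hm

theorem LpNull.comp_tendsto {Ω : Type*} [MeasurableSpace Ω] {μ : Measure Ω} {p : ℝ≥0∞}
    {f : ℕ → Ω → ℝ} (hf : LpNull μ p f) {u : ℕ → ℕ} (hu : Tendsto u atTop atTop) :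
    LpNull μ p (fun m => f (u m)) :=
  ⟨fun m => hf.1 (u m), hf.2.comp hu⟩

theorem LpBdd.comp_tendsto {Ω : Type*} [MeasurableSpace Ω] {μ : Measure Ω} {p : ℝ≥0∞}
    {f : ℕ → Ω → ℝ} (hf : LpBdd μ p f) {u : ℕ → ℕ} (hu : Tendsto u atTop atTop) :
    LpBdd μ p (fun m => f (u m)) := by
  obtain ⟨C, hC, h⟩ := hf.2
  exact ⟨fun m => hf.1 (u m), C, hC, hu.eventually h⟩

section

set_option linter.unusedSectionVars false

variable {S : Type*} [MeasurableSpace S] {P : Measure S} [IsProbabilityMeasure P]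
  {Y : ℝ → S → ℝ} {θ₀ : ℝ} {K : ℕ} {c : Fin K → ℝ} {Ω : Type*} [MeasurableSpace Ω]
  {μ : Measure Ω} [IsProbabilityMeasure μ] {ξ : Run K → Ω → S}

/-- The normalized error of the regression estimator. -/
noncomputable def regErr (P : Measure S) (Y : ℝ → S → ℝ) (θ₀ : ℝ) (c : Fin K → ℝ)
    (ξ : Run K → Ω → S) (N : ℕ) (i : Fin 2) (ω : Ω) : ℝ :=
  (lsq c *ᵥ fun k => pilotBias P Y θ₀ c N k + pilotErr P Y θ₀ c ξ N k ω) i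

theorem Sim.regErr_bdd (H : Sim P Y θ₀ c μ ξ) (i : Fin 2) :
    LpBdd μ 4 (fun N => regErr P Y θ₀ c ξ N i) := by
  refine LpBdd.sum (by norm_num) Finset.univ (f := fun k N ω => lsq c i k *
    (pilotBias P Y θ₀ c N k + pilotErr P Y θ₀ c ξ N k ω)) fun k _ => ?_
  exact ((LpBdd.const_of_tendsto (H.tendsto_pilotBias k)).add (by norm_num)
    (H.pilotErr_bdd k)).const_mul _

theorem Sim.betaE_pilotDelta (H : Sim P Y θ₀ c μ ξ) {N : ℕ} (hN : 0 < N) (ω : Ω) :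
    betaE (pilotPert c N) (pilotDelta Y θ₀ c N fun r => ξ r ω) 0
      = deriv (perf Y P) θ₀ + pilotScale N ^ 4 * regErr P Y θ₀ c ξ N 0 ω ∧
    betaE (pilotPert c N) (pilotDelta Y θ₀ c N fun r => ξ r ω) 1
      = coefB Y P θ₀ + pilotScale N ^ 2 * regErr P Y θ₀ c ξ N 1 ω :=
  betaE_of_resid H.c_sq (pilotScale_pos hN).ne' _ _ _ _ fun k => bootMean_pilotDelta hN k ω

theorem Sim.betaE_null (H : Sim P Y θ₀ c μ ξ) :
    LpNull μ 2 (fun N ω => betaE (pilotPert c N) (pilotDelta Y θ₀ c N fun r => ξ r ω) 1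
      - coefB Y P θ₀) := by
  have h0 : Tendsto (fun N => pilotScale N ^ 2) atTop (𝓝 0) := by
    simpa using tendsto_pilotScale.pow 2
  refine (LpBdd.null_mul ((H.regErr_bdd 1).mono_exponent (p := 2) (by norm_num)) h0).congr
    (fun N => ?_) ?_
  · exact (((measurable_betaE _ 1).comp (measurable_pilotDelta H.meas θ₀ c N fun _ _ _ =>
      H.input _)).sub_const _).aestronglyMeasurable
  · filter_upwards [eventually_gt_atTop 0] with N hN ω
    rw [(H.betaE_pilotDelta hN ω).2]
    ring

/-- Functions of the pilot estimates, on the event that the estimates are good, converge. -/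
theorem Sim.good_fun_null (H : Sim P Y θ₀ c μ ξ) {B s ε : ℝ} (hB : B = coefB Y P θ₀)
    (hs : s = sd Y P θ₀ ^ 2) (hε : 0 < ε) {p : ℝ≥0∞} (hp : 1 ≤ p) (hp' : p ≠ ⊤)
    {F : ℝ × ℝ → ℝ} (hF : Measurable F) (hFc : ContinuousAt F (B, s)) {C : ℝ}
    (hC : ∀ z ∈ goodBox B s ε, |F z| ≤ C) :
    LpNull μ p (fun N ω => (goodSet c N B s ε).indicator (fun x => F (pilotEst c x))
      (pilotDelta Y θ₀ c N fun r => ξ r ω) - F (B, s)) := by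
  have hmeas : ∀ N, Measurable fun ω => (goodSet c N B s ε).indicator (fun x => F (pilotEst c x))
      (pilotDelta Y θ₀ c N fun r => ξ r ω) - F (B, s) := fun N =>
    (((hF.comp (measurable_pilotEst c)).indicator (measurableSet_goodSet c N B s ε)).comp
      (measurable_pilotDelta H.meas θ₀ c N fun _ _ _ => H.input _)).sub_const _
  have hC0 : 0 ≤ C := (abs_nonneg _).trans (hC (B, s) (by simp [goodBox, hε]))
  refine LpNull.of_bounded_of_probNull hp hp' hmeas (C := C + |F (B, s)|)
    (Eventually.of_forall fun N ω => ?_) fun δ hδ => ?_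
  · refine (abs_sub _ _).trans (add_le_add ?_ le_rfl)
    by_cases hx : (pilotDelta Y θ₀ c N fun r => ξ r ω) ∈ goodSet c N B s ε
    · rw [Set.indicator_of_mem hx]; exact hC _ hx
    · rw [Set.indicator_of_notMem hx, abs_zero]; exact hC0
  · obtain ⟨η, hη, hFη⟩ := Metric.continuousAt_iff.1 hFc δ hδ
    set κ := min η ε with hκ
    have hκ0 : 0 < κ := lt_min hη hε
    have h1 := H.betaE_null.probNull two_ne_zero κ hκ0
    have h2 := H.betaV_null.probNull two_ne_zero κ hκ0
    have h12 := h1.add h2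
    rw [add_zero] at h12
    refine tendsto_of_tendsto_of_tendsto_of_le_of_le tendsto_const_nhds h12
      (fun _ => zero_le) fun N => ?_
    refine (measure_mono ?_).trans (measure_union_le _ _)
    intro ω hω
    by_contra hcon
    simp only [Set.mem_union, Set.mem_ofPred_eq, not_or, not_le, ← hB, ← hs] at hcon
    have hx : (pilotDelta Y θ₀ c N fun r => ξ r ω) ∈ goodSet c N B s ε :=
      ⟨hcon.1.trans_le (min_le_right _ _), hcon.2.trans_le (min_le_right _ _)⟩
    simp only [Set.mem_ofPred_eq, Set.indicator_of_mem hx] at hω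
    have : dist (pilotEst c (pilotDelta Y θ₀ c N fun r => ξ r ω)) (B, s) < η := by
      rw [Prod.dist_eq, Real.dist_eq, Real.dist_eq]
      exact max_lt (hcon.1.trans_le (min_le_left _ _)) (hcon.2.trans_le (min_le_left _ _))
    have := hFη this
    rw [Real.dist_eq] at this
    linarith

/-- The probability that the pilot estimates are bad vanishes. -/
theorem Sim.tendsto_bad (H : Sim P Y θ₀ c μ ξ) {B s ε : ℝ} (hB : B = coefB Y P θ₀)
    (hs : s = sd Y P θ₀ ^ 2) (hε : 0 < ε) :
    Tendsto (fun N => μ {ω | (pilotDelta Y θ₀ c N fun r => ξ r ω) ∉ goodSet c N B s ε}) atTop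
      (𝓝 0) := by
  have h1 := H.betaE_null.probNull two_ne_zero ε hε
  have h2 := H.betaV_null.probNull two_ne_zero ε hε
  have h12 := h1.add h2
  rw [add_zero] at h12
  refine tendsto_of_tendsto_of_tendsto_of_le_of_le tendsto_const_nhds h12
    (fun _ => zero_le) fun N => ?_
  refine (measure_mono ?_).trans (measure_union_le _ _)
  intro ω hω
  by_contra hcon
  simp only [Set.mem_union, Set.mem_ofPred_eq, not_or, not_le, ← hB, ← hs] at hcon
  exact hω ⟨hcon.1, hcon.2⟩

end

/-! ### Decomposition of the error of the estimator -/

/-- The square root of `n_b / n`. -/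
noncomputable def ratioScale (n N : ℕ) : ℝ := sampleScale n ^ 3 / pilotScale N ^ 5

theorem ratioScale_pos {n N : ℕ} (hn : 0 < n) (hN : 0 < N) : 0 < ratioScale n N :=
  div_pos (pow_pos (sampleScale_pos hn) 3) (pow_pos (pilotScale_pos hN) 5)

theorem ratioScale_sq {n N : ℕ} (hn : 0 < n) (hN : 0 < N) : ratioScale n N ^ 2 = (N : ℝ) / n := by
  have h1 := sampleScale_pow hn
  have h2 := pilotScale_pow hN
  have hn' : (n : ℝ) ≠ 0 := by positivity
  have := (pilotScale_pos hN).ne'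
  rw [ratioScale, div_pow, eq_div_iff hn']
  rw [div_mul_eq_mul_div, div_eq_iff (by positivity)]
  linear_combination h1 - h2

theorem ratioScale_le_one {K n N : ℕ} (hn : 0 < n) (hN : 0 < N) (hK : 0 < K) (h : K * N ≤ n) :
    ratioScale n N ≤ 1 := by
  have h1 : (N : ℝ) / n ≤ 1 := by
    rw [div_le_one (by exact_mod_cast hn)]
    exact_mod_cast (Nat.le_mul_of_pos_left N hK).trans h
  rw [← ratioScale_sq hn hN] at h1
  nlinarith [ratioScale_pos hn hN]

/-- The relative error of the quadratic approximation to the bias of a finite difference. -/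
noncomputable def biasErr {S : Type*} [MeasurableSpace S] (P : Measure S) (Y : ℝ → S → ℝ)
    (θ₀ h : ℝ) : ℝ :=
  ((perf Y P (θ₀ + h) - perf Y P (θ₀ - h)) / (2 * h) - deriv (perf Y P) θ₀) / h ^ 2 - coefB Y P θ₀

section

set_option linter.unusedSectionVars false

variable {S : Type*} [MeasurableSpace S] {P : Measure S} [IsProbabilityMeasure P]
  {Y : ℝ → S → ℝ} {θ₀ : ℝ} {K : ℕ} {c : Fin K → ℝ} {Ω : Type*} [MeasurableSpace Ω]
  {μ : Measure Ω} [IsProbabilityMeasure μ] {ξ : Run K → Ω → S}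

theorem Sim.tendsto_biasErr (H : Sim P Y θ₀ c μ ξ) :
    Tendsto (biasErr P Y θ₀) (𝓝[≠] 0) (𝓝 0) := by
  have h1 := (isLittleO_iff_tendsto' (by
    filter_upwards [self_mem_nhdsWithin] with h hh h0
    exact absurd h0 (pow_ne_zero 4 hh))).1 (central_difference_expansion H.smooth)
  have h2 : Tendsto (fun h : ℝ => h ^ 2) (𝓝[≠] 0) (𝓝 0) := by
    have : Continuous fun h : ℝ => h ^ 2 := by fun_prop
    simpa using (this.tendsto 0).mono_left nhdsWithin_le_nhds
  have h3 := (h1.add_const (coefD Y P θ₀)).mul h2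
  rw [mul_zero] at h3
  refine h3.congr' ?_
  filter_upwards [self_mem_nhdsWithin] with h hh
  have hh : h ≠ 0 := hh
  simp only [biasErr, coefB, coefD]
  generalize (perf Y P (θ₀ + h) - perf Y P (θ₀ - h)) / (2 * h) = g
  field_simp
  ring

theorem measurable_biasErr (hY : Measurable (Function.uncurry Y)) :
    Measurable (biasErr P Y θ₀) := by
  have hp := measurable_perf (P := P) hY
  have h1 : Measurable fun h => perf Y P (θ₀ + h) := hp.comp (by fun_prop)
  have h2 : Measurable fun h => perf Y P (θ₀ - h) := hp.comp (by fun_prop)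
  unfold biasErr
  fun_prop

theorem measurable_noiseVar (hY : Measurable (Function.uncurry Y)) :
    Measurable (noiseVar Y P θ₀) := by
  have h1 := ((measurable_cfdNoise (P := P) hY θ₀).pow_const 2).stronglyMeasurable
  have h2 : Measurable fun h => ∫ p, cfdNoise Y P θ₀ h p ^ 2 ∂(P.prod P) :=
    h1.integral_prod_right'.measurable
  exact (measurable_id.pow_const 2).mul h2

/-- The average of the fresh and the transformed pilot finite differences. -/
theorem Sim.corCFD_decomposition (H : Sim P Y θ₀ c μ ξ) {n N : ℕ} (hn : 0 < n) (hN : 0 < N)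
    (hKN : K * N ≤ n) (ω : Ω) {ρ : ℝ} (hρ : 0 < ρ)
    (hH : hHat n (pilotPert c N) (pilotDelta Y θ₀ c N fun r => ξ r ω) = sampleScale n * ρ) :
    (sampleScale n ^ 2)⁻¹ * (corCFD Y θ₀ c n N (fun r => ξ r ω) - deriv (perf Y P) θ₀)
      = sampleScale n ^ 4 * (∑ i ∈ Finset.range (n - K * N),
          cfdNoise Y P θ₀ (sampleScale n * ρ) (freshPair ξ i ω))
        + coefB Y P θ₀ * ρ ^ 2
        + sampleScale n ^ 6 * ((n - K * N : ℕ) : ℝ) * (ρ ^ 2 * biasErr P Y θ₀ (sampleScale n * ρ))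
        + ratioScale n N * ρ⁻¹ * (∑ k, projAbs c k *
            (pilotBias P Y θ₀ c N k + pilotErr P Y θ₀ c ξ N k ω))
        + K * (sampleScale n ^ 4 / pilotScale N ^ 6) * regErr P Y θ₀ c ξ N 0 ω
        + K * ratioScale n N ^ 2 * ρ ^ 2 * (pilotScale N ^ 2 * regErr P Y θ₀ c ξ N 1 ω) := by
  obtain ⟨h0, h1⟩ := H.betaE_pilotDelta hN ω
  have hL := sum_abs_mul_resid H.c_sq (pilotScale_pos hN)
    (pilotDelta Y θ₀ c N fun r => ξ r ω) _ _ _ fun k => bootMean_pilotDelta (P := P) hN k ω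
  rw [← pilotPert_eq] at hL
  have hu := sampleScale_pos hn
  have ht := pilotScale_pos hN
  have hun := sampleScale_pow hn
  have htN := pilotScale_pow hN
  have hn' : (n : ℝ) ≠ 0 := by positivity
  have hN' : (N : ℝ) ≠ 0 := by positivity
  have hHpos : 0 < sampleScale n * ρ := mul_pos hu hρ
  -- the pilot part
  have hpilot : ∑ k : Fin K, ∑ j : Fin N, corSample n (pilotPert c N)
      (pilotDelta Y θ₀ c N fun r => ξ r ω) k j
      = N * (sampleScale n * ρ)⁻¹ * (pilotScale N ^ 5 * ∑ k, projAbs c k *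
            (pilotBias P Y θ₀ c N k + pilotErr P Y θ₀ c ξ N k ω))
        + K * N * fitE (pilotPert c N) (pilotDelta Y θ₀ c N fun r => ξ r ω) (sampleScale n * ρ) := by
    have e : ∀ k, ∑ j : Fin N, corSample n (pilotPert c N)
        (pilotDelta Y θ₀ c N fun r => ξ r ω) k j
        = N * (sampleScale n * ρ)⁻¹ * (|c k * pilotScale N| *
          (bootMean (pilotDelta Y θ₀ c N (fun r => ξ r ω) k) - fitE (pilotPert c N)
            (pilotDelta Y θ₀ c N fun r => ξ r ω) (c k * pilotScale N)))
          + N * fitE (pilotPert c N) (pilotDelta Y θ₀ c N fun r => ξ r ω) (sampleScale n * ρ) := by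
      intro k
      simp only [corSample, hH, bootMean_eq hN, Finset.sum_add_distrib, ← Finset.mul_sum,
        Finset.sum_sub_distrib, Finset.sum_const, Finset.card_univ, Fintype.card_fin,
        nsmul_eq_mul, abs_of_pos hHpos]
      have e1 : pilotPert c N k = c k * pilotScale N := rfl
      rw [e1]
      field_simp
    simp only [e, Finset.sum_add_distrib, ← Finset.mul_sum, hL, Finset.sum_const,
      Finset.card_univ, Fintype.card_fin, nsmul_eq_mul]
    ring
  -- the additional part
  have hfresh : ∑ i ∈ Finset.range (n - K * N), cfd Y θ₀ (sampleScale n * ρ)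
        (ξ (.fresh i true) ω) (ξ (.fresh i false) ω)
      = (∑ i ∈ Finset.range (n - K * N), cfdNoise Y P θ₀ (sampleScale n * ρ) (freshPair ξ i ω))
        + ((n - K * N : ℕ) : ℝ) * (deriv (perf Y P) θ₀ + (sampleScale n * ρ) ^ 2
          * (coefB Y P θ₀ + biasErr P Y θ₀ (sampleScale n * ρ))) := by
    have e : deriv (perf Y P) θ₀ + (sampleScale n * ρ) ^ 2
          * (coefB Y P θ₀ + biasErr P Y θ₀ (sampleScale n * ρ))
        = (perf Y P (θ₀ + sampleScale n * ρ) - perf Y P (θ₀ - sampleScale n * ρ))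
          / (2 * (sampleScale n * ρ)) := by
      rw [biasErr]
      generalize (perf Y P (θ₀ + sampleScale n * ρ) - perf Y P (θ₀ - sampleScale n * ρ))
          / (2 * (sampleScale n * ρ)) = g
      field_simp
      ring
    rw [e]
    simp only [cfdNoise, freshPair, Finset.sum_sub_distrib, Finset.sum_const, Finset.card_range,
      nsmul_eq_mul]
    ring
  have hcast : ((n - K * N : ℕ) : ℝ) = n - K * N := by push_cast [Nat.cast_sub hKN]; ring
  rw [corCFD, hH, hpilot, hfresh, fitE, h0, h1, hcast, ratioScale]
  generalize (∑ i ∈ Finset.range (n - K * N),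
    cfdNoise Y P θ₀ (sampleScale n * ρ) (freshPair ξ i ω)) = Z
  generalize (∑ k, projAbs c k *
            (pilotBias P Y θ₀ c N k + pilotErr P Y θ₀ c ξ N k ω)) = L
  generalize biasErr P Y θ₀ (sampleScale n * ρ) = r
  generalize regErr P Y θ₀ c ξ N 0 ω = e0
  generalize regErr P Y θ₀ c ξ N 1 ω = e1
  generalize deriv (perf Y P) θ₀ = a
  generalize coefB Y P θ₀ = B
  generalize sampleScale n = u at *
  generalize pilotScale N = t at *
  have hnu : (n : ℝ) = (u ^ 6)⁻¹ := by field_simp; linear_combination hun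
  have hNt : (N : ℝ) = (t ^ 10)⁻¹ := by field_simp; linear_combination htN
  rw [hnu, hNt]
  field_simp
  ring

end

/-! ### Expansion of the error of the estimator in `L²` -/

section

set_option linter.unusedSectionVars false

variable {S : Type*} [MeasurableSpace S] {P : Measure S} [IsProbabilityMeasure P]
  {Y : ℝ → S → ℝ} {θ₀ : ℝ} {K : ℕ} {c : Fin K → ℝ} {Ω : Type*} [MeasurableSpace Ω]
  {μ : Measure Ω} [IsProbabilityMeasure μ] {ξ : Run K → Ω → S}

theorem Sim.K_pos (H : Sim P Y θ₀ c μ ξ) : 0 < K := by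
  obtain ⟨j, -⟩ := H.c_sq
  exact j.pos

theorem Sim.measurable_sample (H : Sim P Y θ₀ c μ ξ) (N : ℕ) :
    Measurable fun ω => pilotDelta Y θ₀ c N fun r => ξ r ω :=
  measurable_pilotDelta H.meas θ₀ c N fun _ _ _ => H.input _

theorem Sim.measurable_corCFD (H : Sim P Y θ₀ c μ ξ) (n N : ℕ) :
    Measurable fun ω => corCFD Y θ₀ c n N fun r => ξ r ω := by
  have hT := H.measurable_sample N
  unfold corCFD
  refine Measurable.const_mul (Measurable.add ?_ ?_) _
  · exact Finset.measurable_sum _ fun i _ => (measurable_cfd H.meas θ₀).comp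
      (((measurable_hHat n _).comp hT).prodMk ((H.input _).prodMk (H.input _)))
  · exact Finset.measurable_sum _ fun k _ => Finset.measurable_sum _ fun j _ =>
      (measurable_corSample n _ k j).comp hT

/-- Normalization of the additional noise. -/
noncomputable def freshVar (P : Measure S) (Y : ℝ → S → ℝ) (θ₀ : ℝ) (c : Fin K → ℝ)
    (ξ : Run K → Ω → S) (μ : Measure Ω) (n N : ℕ) (B s ε : ℝ) : ℝ :=
  sampleScale n ^ 2 * ∫ ω, (goodSet c N B s ε).indicator
    (fun x => noiseVar Y P θ₀ (hHat n (pilotPert c N) x) / hHat n (pilotPert c N) x ^ 2)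
    (pilotDelta Y θ₀ c N fun r => ξ r ω) ∂μ

/-- The leading noise of the estimator: the noise of the additional runs and that of the pilot
runs. -/
noncomputable def leadNoise (P : Measure S) (Y : ℝ → S → ℝ) (θ₀ : ℝ) (c : Fin K → ℝ)
    (ξ : Run K → Ω → S) (n N : ℕ) (B s ε : ℝ) (ω : Ω) : ℝ :=
  sampleScale n ^ 4 * (∑ i ∈ Finset.range (n - K * N),
      freshNoise P Y θ₀ c ξ (goodSet c N B s ε) (hHat n (pilotPert c N)) i ω)
    + ratioScale n N * (rho (B, s))⁻¹ * ∑ k, projAbs c k * pilotErr P Y θ₀ c ξ N k ω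

variable {B s ε : ℝ} {n nb : ℕ → ℕ}

theorem Sim.tendsto_freshVar (H : Sim P Y θ₀ c μ ξ) (hB : B = coefB Y P θ₀)
    (hs : s = sd Y P θ₀ ^ 2) (hε : 0 < ε) (hεB : ε < |B|) (hεs : ε < s)
    (hn : Tendsto n atTop atTop) (hnb : Tendsto nb atTop atTop) :
    Tendsto (fun m => freshVar P Y θ₀ c ξ μ (n m) (nb m) B s ε) atTop
      (𝓝 ((rho (B, s) ^ 2)⁻¹ * (s / 2))) := by
  have hB0 : B ≠ 0 := by rintro rfl; simp at hεB; linarith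
  obtain ⟨ρ₁, ρ₂, hρ₁, hρ⟩ := rho_bounds hε hεB hεs
  have hρ0 : 0 < rho (B, s) := rho_pos hB0 (hε.trans hεs)
  have hbound : ∀ z ∈ goodBox B s ε, |(rho z ^ 2)⁻¹| ≤ (ρ₁ ^ 2)⁻¹ := fun z hz => by
    have h1 := (hρ z hz).1
    have : 0 < rho z := hρ₁.trans_le h1
    rw [abs_of_pos (by positivity)]
    gcongr
  let T : (m : ℕ) → Ω → Fin K → Fin (nb m) → ℝ := fun m ω => pilotDelta Y θ₀ c (nb m) fun r => ξ r ω
  have hmain : LpNull μ 2 (fun m ω => sampleScale (n m) ^ 2 * (goodSet c (nb m) B s ε).indicator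
    (fun x => noiseVar Y P θ₀ (hHat (n m) (pilotPert c (nb m)) x)
      / hHat (n m) (pilotPert c (nb m)) x ^ 2) (T m ω) - (rho (B, s) ^ 2)⁻¹ * (s / 2)) := by
    have h1 : LpNull μ 2 (fun m ω => (goodSet c (nb m) B s ε).indicator
        (fun x => (rho (pilotEst c x) ^ 2)⁻¹ *
          (noiseVar Y P θ₀ (hHat (n m) (pilotPert c (nb m)) x) - s / 2)) (T m ω)) := by
      refine LpNull.of_uniform (fun m => ?_) fun δ hδ => ?_
      · refine Measurable.aestronglyMeasurable ?_
        refine (Measurable.indicator ?_ (measurableSet_goodSet _ _ _ _ _)).comp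
          (H.measurable_sample _)
        exact ((measurable_rho.comp (measurable_pilotEst c)).pow_const 2).inv.mul
          (((measurable_noiseVar H.meas).comp (measurable_hHat _ _)).sub_const _)
      · have hlim := (tendsto_noiseVar H.sqInt H.sd_cont).sub_const (s / 2)
        rw [hs, sub_self, ← hs] at hlim
        have hev := (tendsto_zero_iff_abs_tendsto_zero _).1 hlim |>.eventually_le_const
          (show 0 < δ * ρ₁ ^ 2 by positivity)
        filter_upwards [eventually_goodSet hε hεB hεs hn hev (c := c) (nb := nb)] with m hm ω
        by_cases hx : T m ω ∈ goodSet c (nb m) B s ε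
        · rw [Set.indicator_of_mem hx, abs_mul]
          calc _ ≤ (ρ₁ ^ 2)⁻¹ * (δ * ρ₁ ^ 2) :=
                mul_le_mul (hbound _ hx) (hm _ hx) (abs_nonneg _) (by positivity)
            _ = δ := by field_simp
        · rw [Set.indicator_of_notMem hx, abs_zero]; exact hδ.le
    have h2 := (H.good_fun_null hB hs hε (p := 2) one_le_two (by simp)
      (F := fun z => (rho z ^ 2)⁻¹) (measurable_rho.pow_const 2).inv
      (((continuousAt_rho hB0).pow 2).inv₀ (pow_ne_zero 2 hρ0.ne')) hbound).comp_tendsto hnb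
    have h3 := h1.add one_le_two (LpNull.bdd_mul (f := fun _ _ => s / 2) h2
      (fun _ => aestronglyMeasurable_const) (C := |s / 2|) (Eventually.of_forall fun _ _ => le_rfl))
    refine h3.congr (fun m => ?_) ?_
    · refine Measurable.aestronglyMeasurable ?_
      refine Measurable.sub_const (Measurable.const_mul ((Measurable.indicator ?_
        (measurableSet_goodSet _ _ _ _ _)).comp (H.measurable_sample _)) _) _
      exact ((measurable_noiseVar H.meas).comp (measurable_hHat _ _)).div
        ((measurable_hHat _ _).pow_const 2)
    · filter_upwards [hn.eventually_gt_atTop 0] with m hm ω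
      have hu := sampleScale_pos hm
      by_cases hx : T m ω ∈ goodSet c (nb m) B s ε
      · have hr : 0 < rho (pilotEst c (T m ω)) := hρ₁.trans_le (hρ _ hx).1
        simp only [T] at hx hr ⊢
        simp only [Set.indicator_of_mem hx]
        rw [hHat_eq hεs hx]
        field_simp
        ring
      · simp only [T] at hx ⊢
        simp only [Set.indicator_of_notMem hx]
        ring
  have h4 := hmain.tendsto_integral
  have h5 := h4.add_const ((rho (B, s) ^ 2)⁻¹ * (s / 2))
  rw [zero_add] at h5
  refine h5.congr' ?_
  filter_upwards [hmain.memLp] with m hm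
  have hi := hm.integrable one_le_two
  have hi2 := hi.add (integrable_const ((rho (B, s) ^ 2)⁻¹ * (s / 2)))
  have e := integral_add hi (integrable_const (μ := μ) ((rho (B, s) ^ 2)⁻¹ * (s / 2)))
  simp only [integral_const, probReal_univ, smul_eq_mul, one_mul, sub_add_cancel] at e
  rw [← e, freshVar, ← integral_const_mul]

/-- Mean and variance of the leading noise. -/
theorem Sim.leadNoise_moments (H : Sim P Y θ₀ c μ ξ) (hε : 0 < ε) (hεB : ε < |B|) (hεs : ε < s)
    (hn : Tendsto n atTop atTop) (hnb : Tendsto nb atTop atTop) (hnbn : ∀ m, K * nb m ≤ n m) :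
    ∀ᶠ m in atTop, MemLp (leadNoise P Y θ₀ c ξ (n m) (nb m) B s ε) 2 μ ∧
      ∫ ω, leadNoise P Y θ₀ c ξ (n m) (nb m) B s ε ω ∂μ = 0 ∧
      ∫ ω, leadNoise P Y θ₀ c ξ (n m) (nb m) B s ε ω ^ 2 ∂μ
        = (1 - K * ((nb m : ℝ) / n m)) * freshVar P Y θ₀ c ξ μ (n m) (nb m) B s ε
          + (nb m : ℝ) / n m * (rho (B, s) ^ 2)⁻¹ *
            ∑ k, projAbs c k ^ 2 / c k ^ 2 * noiseVar Y P θ₀ (pilotPert c (nb m) k) := by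
  obtain ⟨ρ₁, ρ₂, hρ₁, hρ⟩ := rho_bounds hε hεB hεs
  obtain ⟨M, hM, hgood⟩ := H.exists_goodPert
  filter_upwards [eventually_goodSet hε hεB hεs hn hgood (c := c) (nb := nb),
    hnb.eventually (H.pilotErr_sum_moments (projAbs c)), hn.eventually_gt_atTop 0,
    hnb.eventually_gt_atTop 0] with m hg hA hnm hNm
  have hu := sampleScale_pos hnm
  have hun := sampleScale_pow hnm
  obtain ⟨hA2, hA0, hAv⟩ := hA
  obtain ⟨hU2, hU0, hUv, hUA₀⟩ := H.sum_freshNoise (measurableSet_goodSet c (nb m) B s ε)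
    (measurable_hHat (n m) (pilotPert c (nb m)))
    (fun x hx => ⟨(hg x hx).memLp_add, (hg x hx).memLp_sub⟩)
    (C := M / (sampleScale (n m) * ρ₁) ^ 2) (by positivity)
    (fun x hx => ⟨(hg x hx).ne, by
      have h1 := (hρ _ hx).1
      rw [hHat_eq hεs hx]
      have h2 := (hg x hx).second_le
      rw [hHat_eq hεs hx] at h2
      gcongr⟩) (n m - K * nb m) (projAbs c)
  have hUA := hUA₀ hA2
  clear hUA₀
  set U : Ω → ℝ := fun ω => ∑ i ∈ Finset.range (n m - K * nb m), freshNoise P Y θ₀ c ξ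
    (goodSet c (nb m) B s ε) (hHat (n m) (pilotPert c (nb m))) i ω with hU
  set A : Ω → ℝ := fun ω => ∑ k, projAbs c k * pilotErr P Y θ₀ c ξ (nb m) k ω with hAdef
  set x := sampleScale (n m) ^ 4 with hx
  set y := ratioScale (n m) (nb m) * (rho (B, s))⁻¹ with hy
  have e : leadNoise P Y θ₀ c ξ (n m) (nb m) B s ε = fun ω => x * U ω + y * A ω := rfl
  refine ⟨?_, ?_, ?_⟩
  · rw [e]; exact (hU2.const_mul x).add (hA2.const_mul y)
  · rw [e, integral_add ((hU2.integrable one_le_two).const_mul x)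
      ((hA2.integrable one_le_two).const_mul y), integral_const_mul, integral_const_mul, hU0, hA0]
    simp
  · have iUA : Integrable (fun ω => U ω * A ω) μ := hU2.integrable_mul hA2
    have e2 : ∀ ω, leadNoise P Y θ₀ c ξ (n m) (nb m) B s ε ω ^ 2
        = x ^ 2 * U ω ^ 2 + 2 * x * y * (U ω * A ω) + y ^ 2 * A ω ^ 2 := fun ω => by
      rw [e]; ring
    have j1 : Integrable (fun ω => x ^ 2 * U ω ^ 2 + 2 * x * y * (U ω * A ω)) μ :=
      (hU2.integrable_sq.const_mul _).add (iUA.const_mul _)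
    simp only [e2]
    rw [integral_add j1 (hA2.integrable_sq.const_mul _),
      integral_add (hU2.integrable_sq.const_mul _) (iUA.const_mul _), integral_const_mul,
      integral_const_mul, integral_const_mul, hUA, hUv, hAv, freshVar]
    have hcast : ((n m - K * nb m : ℕ) : ℝ) = n m - K * nb m := by
      push_cast [Nat.cast_sub (hnbn m)]; ring
    have hn' : (n m : ℝ) ≠ 0 := by positivity
    rw [hcast, hy, mul_pow, ratioScale_sq hnm hNm, inv_pow, hx]
    generalize (∫ ω, (goodSet c (nb m) B s ε).indicator
      (fun x => noiseVar Y P θ₀ (hHat (n m) (pilotPert c (nb m)) x)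
        / hHat (n m) (pilotPert c (nb m)) x ^ 2)
      (pilotDelta Y θ₀ c (nb m) fun r => ξ r ω) ∂μ) = I
    have e3 : (sampleScale (n m) ^ 4) ^ 2 * (((n m : ℝ) - K * nb m) * I)
        = (1 - K * ((nb m : ℝ) / n m)) * (sampleScale (n m) ^ 2 * I) := by
      have : (sampleScale (n m)) ^ 6 = (n m : ℝ)⁻¹ := by field_simp; linear_combination hun
      calc _ = sampleScale (n m) ^ 6 * ((n m : ℝ) - K * nb m) * (sampleScale (n m) ^ 2 * I) := by
            ring
        _ = _ := by rw [this]; field_simp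
    rw [e3]
    ring

end

section

set_option linter.unusedSectionVars false

variable {S : Type*} [MeasurableSpace S] {P : Measure S} [IsProbabilityMeasure P]
  {Y : ℝ → S → ℝ} {θ₀ : ℝ} {K : ℕ} {c : Fin K → ℝ} {Ω : Type*} [MeasurableSpace Ω]
  {μ : Measure Ω} [IsProbabilityMeasure μ] {ξ : Run K → Ω → S} {B s ε : ℝ} {n nb : ℕ → ℕ}

theorem tendsto_sampleScale_div_pilotScale (hK : 0 < K) (hn : Tendsto n atTop atTop)
    (hnb : Tendsto nb atTop atTop) (hnbn : ∀ m, K * nb m ≤ n m) :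
    Tendsto (fun m => sampleScale (n m) ^ 4 / pilotScale (nb m) ^ 6) atTop (𝓝 0) := by
  have h1 : Tendsto (fun m => (pilotScale (nb m) ^ 2) ^ (1 / 3 : ℝ)) atTop (𝓝 0) := by
    have h2 : Tendsto (fun m => pilotScale (nb m) ^ 2) atTop (𝓝 0) := by
      simpa using (tendsto_pilotScale.comp hnb).pow 2
    have h3 := h2.rpow_const (p := 1 / 3) (Or.inr (by norm_num))
    rwa [Real.zero_rpow (by norm_num)] at h3
  refine squeeze_zero' ?_ ?_ h1
  · filter_upwards [hn.eventually_gt_atTop 0, hnb.eventually_gt_atTop 0] with m hm hN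
    have := sampleScale_pos hm
    have := pilotScale_pos hN
    positivity
  · filter_upwards [hn.eventually_gt_atTop 0, hnb.eventually_gt_atTop 0] with m hm hN
    have hu := sampleScale_pos hm
    have ht := pilotScale_pos hN
    have hq := ratioScale_le_one hm hN hK (hnbn m)
    have hq0 := ratioScale_pos hm hN
    have e : sampleScale (n m) ^ 4 / pilotScale (nb m) ^ 6
        = ((sampleScale (n m) ^ 4 / pilotScale (nb m) ^ 6) ^ 3) ^ (1 / 3 : ℝ) := by
      have h0 : 0 ≤ sampleScale (n m) ^ 4 / pilotScale (nb m) ^ 6 := by positivity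
      generalize sampleScale (n m) ^ 4 / pilotScale (nb m) ^ 6 = y at h0
      rw [← Real.rpow_natCast, ← Real.rpow_mul h0]
      norm_num
    rw [e]
    refine Real.rpow_le_rpow (by positivity) ?_ (by norm_num)
    have e2 : (sampleScale (n m) ^ 4 / pilotScale (nb m) ^ 6) ^ 3
        = ratioScale (n m) (nb m) ^ 4 * pilotScale (nb m) ^ 2 := by
      rw [ratioScale]; field_simp
    rw [e2]
    exact mul_le_of_le_one_left (by positivity) (pow_le_one₀ hq0.le hq)

/-- The leading terms of the normalized error of the estimator. -/
theorem Sim.expansion (H : Sim P Y θ₀ c μ ξ) (hB : B = coefB Y P θ₀)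
    (hs : s = sd Y P θ₀ ^ 2) (hε : 0 < ε) (hεB : ε < |B|) (hεs : ε < s)
    (hn : Tendsto n atTop atTop) (hnb : Tendsto nb atTop atTop) (hnbn : ∀ m, K * nb m ≤ n m)
    (hbad : LpNull μ 2 fun m =>
      {ω | (pilotDelta Y θ₀ c (nb m) fun r => ξ r ω) ∉ goodSet c (nb m) B s ε}.indicator fun ω =>
        (sampleScale (n m) ^ 2)⁻¹ *
          (corCFD Y θ₀ c (n m) (nb m) (fun r => ξ r ω) - deriv (perf Y P) θ₀)) :
    ∃ err : ℕ → Ω → ℝ, LpNull μ 2 err ∧ ∀ᶠ m in atTop, ∀ ω,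
      (sampleScale (n m) ^ 2)⁻¹ *
          (corCFD Y θ₀ c (n m) (nb m) (fun r => ξ r ω) - deriv (perf Y P) θ₀)
        = (B * rho (B, s) ^ 2 + ratioScale (n m) (nb m) * (rho (B, s))⁻¹ *
            (coefD Y P θ₀ * Lam c))
          + leadNoise P Y θ₀ c ξ (n m) (nb m) B s ε ω + err m ω := by
  have hK := H.K_pos
  have hB0 : B ≠ 0 := by rintro rfl; simp at hεB; linarith
  obtain ⟨ρ₁, ρ₂, hρ₁, hρ⟩ := rho_bounds hε hεB hεs
  have hρ0 : 0 < rho (B, s) := rho_pos hB0 (hε.trans hεs)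
  have hρ₂ : 0 ≤ ρ₂ := by
    have := hρ (B, s) (by simp [goodBox, hε])
    linarith
  have hpos : ∀ᶠ m in atTop, 0 < n m ∧ 0 < nb m :=
    (hn.eventually_gt_atTop 0).and (hnb.eventually_gt_atTop 0)
  have hbsq : ∀ z ∈ goodBox B s ε, |rho z ^ 2| ≤ ρ₂ ^ 2 := fun z hz => by
    have := hρ z hz
    rw [abs_of_nonneg (sq_nonneg _)]
    exact pow_le_pow_left₀ (hρ₁.le.trans this.1) this.2 2
  have hbinv : ∀ z ∈ goodBox B s ε, |(rho z)⁻¹| ≤ ρ₁⁻¹ := fun z hz => by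
    have h1 := (hρ z hz).1
    rw [abs_of_pos (inv_pos.2 (hρ₁.trans_le h1))]
    exact inv_anti₀ hρ₁ h1
  let T : (m : ℕ) → Ω → Fin K → Fin (nb m) → ℝ := fun m ω => pilotDelta Y θ₀ c (nb m) fun r => ξ r ω
  let q : ℕ → ℝ := fun m => ratioScale (n m) (nb m)
  let I : (ℝ × ℝ → ℝ) → ℕ → Ω → ℝ := fun F m ω =>
    (goodSet c (nb m) B s ε).indicator (fun x => F (pilotEst c x)) (T m ω)
  have hImeas : ∀ {F : ℝ × ℝ → ℝ}, Measurable F → ∀ m, Measurable (I F m) := fun hF m =>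
    ((hF.comp (measurable_pilotEst c)).indicator (measurableSet_goodSet _ _ _ _ _)).comp
      (H.measurable_sample _)
  have hIbd : ∀ {F : ℝ × ℝ → ℝ} {C : ℝ}, 0 ≤ C → (∀ z ∈ goodBox B s ε, |F z| ≤ C) →
      ∀ m ω, |I F m ω| ≤ C := by
    intro F C hC hF m ω
    simp only [I]
    by_cases hx : T m ω ∈ goodSet c (nb m) B s ε
    · rw [Set.indicator_of_mem hx]; exact hF _ hx
    · rw [Set.indicator_of_notMem hx, abs_zero]; exact hC
  have hq1 : ∀ᶠ m in atTop, |q m| ≤ 1 := by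
    filter_upwards [hpos] with m hm
    rw [abs_of_pos (ratioScale_pos hm.1 hm.2)]
    exact ratioScale_le_one hm.1 hm.2 hK (hnbn m)
  -- convergence of the deterministic and of the random weights
  have hwd : Tendsto (fun m => ∑ k, projAbs c k * pilotBias P Y θ₀ c (nb m) k) atTop
      (𝓝 (coefD Y P θ₀ * Lam c)) := by
    have : coefD Y P θ₀ * Lam c = ∑ k, projAbs c k * (coefD Y P θ₀ * c k ^ 4) := by
      rw [Lam_eq_sum, Finset.mul_sum]
      exact Finset.sum_congr rfl fun k _ => by ring
    rw [this]
    exact tendsto_finsetSum _ fun k _ => ((H.tendsto_pilotBias k).comp hnb).const_mul _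
  have hsq : LpNull μ 2 (fun m ω => I (fun z => rho z ^ 2) m ω - rho (B, s) ^ 2) :=
    (H.good_fun_null hB hs hε (p := 2) one_le_two (by simp) (F := fun z => rho z ^ 2)
      (measurable_rho.pow_const 2) ((continuousAt_rho hB0).pow 2) hbsq).comp_tendsto hnb
  have hinv4 : LpNull μ 4 (fun m ω => I (fun z => (rho z)⁻¹) m ω - (rho (B, s))⁻¹) :=
    (H.good_fun_null hB hs hε (p := 4) (by norm_num) (by simp) (F := fun z => (rho z)⁻¹)
      measurable_rho.inv ((continuousAt_rho hB0).inv₀ hρ0.ne') hbinv).comp_tendsto hnb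
  have hinv2 := hinv4.mono_exponent (p := 2) (by norm_num)
  have hA4 : LpBdd μ 4 (fun m ω => ∑ k, projAbs c k * pilotErr P Y θ₀ c ξ (nb m) k ω) :=
    (LpBdd.sum (by norm_num) Finset.univ (f := fun k N ω => projAbs c k *
      pilotErr P Y θ₀ c ξ N k ω) fun k _ => (H.pilotErr_bdd k).const_mul _).comp_tendsto hnb
  have hmc : ∀ r : ℕ → ℝ, ∀ m, AEStronglyMeasurable (fun _ : Ω => r m) μ := fun _ _ =>
    aestronglyMeasurable_const
  -- the error terms
  have t1 : LpNull μ 2 (fun m ω => B * (I (fun z => rho z ^ 2) m ω - rho (B, s) ^ 2)) :=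
    LpNull.bdd_mul (f := fun _ _ => B) hsq (hmc fun _ => B) (C := |B|) (by simp)
  have t2 : LpNull μ 2 (fun m ω => sampleScale (n m) ^ 6 * ((n m - K * nb m : ℕ) : ℝ) *
      (I (fun z => rho z ^ 2) m ω * (goodSet c (nb m) B s ε).indicator
        (fun x => biasErr P Y θ₀ (hHat (n m) (pilotPert c (nb m)) x)) (T m ω))) := by
    refine LpNull.bdd_mul (f := fun m _ => sampleScale (n m) ^ 6 * ((n m - K * nb m : ℕ) : ℝ))
      (C := 1) (LpNull.bdd_mul (C := ρ₂ ^ 2) ?_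
      (fun m => (hImeas (measurable_rho.pow_const 2) m).aestronglyMeasurable)
      (Eventually.of_forall fun m => hIbd (sq_nonneg _) hbsq m)) (hmc _) ?_
    · refine LpNull.of_uniform (fun m => Measurable.aestronglyMeasurable ?_) fun δ hδ => ?_
      · exact (((measurable_biasErr H.meas).comp (measurable_hHat _ _)).indicator
          (measurableSet_goodSet _ _ _ _ _)).comp (H.measurable_sample _)
      · have hev := (tendsto_zero_iff_abs_tendsto_zero _).1 H.tendsto_biasErr
          |>.eventually_le_const hδ
        filter_upwards [eventually_goodSet hε hεB hεs hn hev (c := c) (nb := nb)] with m hm ω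
        by_cases hx : T m ω ∈ goodSet c (nb m) B s ε
        · rw [Set.indicator_of_mem hx]; exact hm _ hx
        · rw [Set.indicator_of_notMem hx, abs_zero]; exact hδ.le
    · filter_upwards [hpos] with m hm _
      have h1 := sampleScale_pow hm.1
      have h2 : ((n m - K * nb m : ℕ) : ℝ) ≤ n m := by exact_mod_cast Nat.sub_le _ _
      have h3 := sampleScale_pos hm.1
      rw [abs_of_nonneg (by positivity)]
      calc sampleScale (n m) ^ 6 * ((n m - K * nb m : ℕ) : ℝ) ≤ sampleScale (n m) ^ 6 * n m := by
            gcongr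
        _ = 1 := by rw [mul_comm]; exact h1
  have t3 : LpNull μ 2 (fun m ω => (q m * ∑ k, projAbs c k * pilotBias P Y θ₀ c (nb m) k) *
      (I (fun z => (rho z)⁻¹) m ω - (rho (B, s))⁻¹)) := by
    refine LpNull.bdd_mul (f := fun m _ => q m * ∑ k, projAbs c k * pilotBias P Y θ₀ c (nb m) k)
      (C := 1 * (|coefD Y P θ₀ * Lam c| + 1)) hinv2 (hmc _) ?_
    filter_upwards [hq1, hwd.abs.eventually_le_const (lt_add_one _)] with m h1 h2 _
    rw [abs_mul]
    exact mul_le_mul h1 h2 (abs_nonneg _) zero_le_one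
  have t4 : LpNull μ 2 (fun m (_ : Ω) => q m * ((rho (B, s))⁻¹ *
      (∑ k, projAbs c k * pilotBias P Y θ₀ c (nb m) k - coefD Y P θ₀ * Lam c))) := by
    refine LpNull.bdd_mul (f := fun m _ => q m) (C := 1) (LpNull.of_tendsto ?_) (hmc _)
      (hq1.mono fun m h _ => h)
    have := (hwd.sub_const (coefD Y P θ₀ * Lam c)).const_mul (rho (B, s))⁻¹
    rwa [sub_self, mul_zero] at this
  have t5 : LpNull μ 2 (fun m ω => q m * ((I (fun z => (rho z)⁻¹) m ω - (rho (B, s))⁻¹) *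
      ∑ k, projAbs c k * pilotErr P Y θ₀ c ξ (nb m) k ω)) :=
    LpNull.bdd_mul (f := fun m _ => q m) (C := 1) (hinv4.mul_bdd hA4) (hmc _)
      (hq1.mono fun m h _ => h)
  have t6 : LpNull μ 2 (fun m ω => (K * I (fun _ => 1) m ω) *
      (sampleScale (n m) ^ 4 / pilotScale (nb m) ^ 6 * regErr P Y θ₀ c ξ (nb m) 0 ω)) := by
    refine LpNull.bdd_mul (C := K * 1) (LpBdd.null_mul
      (((H.regErr_bdd 0).mono_exponent (p := 2) (by norm_num)).comp_tendsto hnb)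
      (tendsto_sampleScale_div_pilotScale hK hn hnb hnbn))
      (fun m => ((hImeas measurable_const m).const_mul _).aestronglyMeasurable)
      (Eventually.of_forall fun m ω => ?_)
    rw [abs_mul, Nat.abs_cast]
    exact mul_le_mul_of_nonneg_left (hIbd (F := fun _ => 1) zero_le_one
      (fun _ _ => by simp) m ω) (by positivity)
  have t7 : LpNull μ 2 (fun m ω => (K * q m ^ 2 * I (fun z => rho z ^ 2) m ω) *
      (pilotScale (nb m) ^ 2 * regErr P Y θ₀ c ξ (nb m) 1 ω)) := by
    have h0 : Tendsto (fun m => pilotScale (nb m) ^ 2) atTop (𝓝 0) := by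
      simpa using (tendsto_pilotScale.comp hnb).pow 2
    refine LpNull.bdd_mul (C := K * 1 * ρ₂ ^ 2) (LpBdd.null_mul
      (((H.regErr_bdd 1).mono_exponent (p := 2) (by norm_num)).comp_tendsto hnb) h0)
      (fun m => ((hImeas (measurable_rho.pow_const 2) m).const_mul _).aestronglyMeasurable) ?_
    filter_upwards [hq1] with m hm ω
    rw [abs_mul, abs_mul, Nat.abs_cast, abs_pow]
    gcongr
    · exact pow_le_one₀ (abs_nonneg _) hm
    · exact hIbd (sq_nonneg _) hbsq m ω
  refine ⟨_, (((((((t1.add one_le_two t2).add one_le_two t3).add one_le_two t4).add one_le_two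
    t5).add one_le_two t6).add one_le_two t7).add one_le_two hbad), ?_⟩
  filter_upwards [hpos] with m hm ω
  by_cases hx : T m ω ∈ goodSet c (nb m) B s ε
  · have hr : 0 < rho (pilotEst c (T m ω)) := hρ₁.trans_le (hρ _ hx).1
    have hdec := H.corCFD_decomposition hm.1 hm.2 (hnbn m) ω hr (hHat_eq hεs hx)
    have hbadω : ω ∉ {ω | (pilotDelta Y θ₀ c (nb m) fun r => ξ r ω) ∉ goodSet c (nb m) B s ε} :=
      fun h => h hx
    rw [Set.indicator_of_notMem hbadω, hdec]
    simp only [leadNoise, freshNoise, I, q]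
    change T m ω ∈ _ at hx
    have hT : (pilotDelta Y θ₀ c (nb m) fun r => ξ r ω) = T m ω := rfl
    simp only [hT, Set.indicator_of_mem hx, hHat_eq hεs hx, Pi.one_apply, one_mul, mul_add,
      Finset.sum_add_distrib, ← hB]
    ring
  · have hbadω : ω ∈ {ω | (pilotDelta Y θ₀ c (nb m) fun r => ξ r ω) ∉ goodSet c (nb m) B s ε} := hx
    rw [Set.indicator_of_mem hbadω]
    simp only [leadNoise, freshNoise, I, q]
    have hT : (pilotDelta Y θ₀ c (nb m) fun r => ξ r ω) = T m ω := rfl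
    simp only [hT, Set.indicator_of_notMem hx, zero_mul, Finset.sum_const_zero]
    ring

end

/-! ### Asymptotic moments of the estimator -/

theorem rpow_third {x y : ℝ} (hx : 0 ≤ x) (h : x ^ 3 = y) : y ^ (1 / 3 : ℝ) = x := by
  rw [← h, ← Real.rpow_natCast, ← Real.rpow_mul hx]
  norm_num

theorem sampleScale_sq (n : ℕ) : (n : ℝ) ^ (-(1 / 3) : ℝ) = sampleScale n ^ 2 := by
  rw [sampleScale, ← Real.rpow_natCast, ← Real.rpow_mul (by positivity)]
  norm_num

theorem sampleScale_pow_four (n : ℕ) : (n : ℝ) ^ (-(2 / 3) : ℝ) = sampleScale n ^ 4 := by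
  rw [sampleScale, ← Real.rpow_natCast, ← Real.rpow_mul (by positivity)]
  norm_num

theorem inv_sampleScale_sq (n : ℕ) : (n : ℝ) ^ (1 / 3 : ℝ) = (sampleScale n ^ 2)⁻¹ := by
  rw [← sampleScale_sq, Real.rpow_neg (by positivity), inv_inv]

theorem rho_pow_six {B s : ℝ} (hs : 0 ≤ s) : rho (B, s) ^ 6 = s / (4 * B ^ 2) := by
  rw [rho, ← Real.rpow_natCast, ← Real.rpow_mul (by positivity)]
  norm_num

theorem rho_pow_three {B σ : ℝ} (hB : B ≠ 0) (hσ : 0 < σ) :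
    rho (B, σ ^ 2) ^ 3 = σ / (2 * |B|) := by
  have hB' : 0 < |B| := abs_pos.2 hB
  have h1 : (rho (B, σ ^ 2) ^ 3) ^ 2 = (σ / (2 * |B|)) ^ 2 := by
    rw [← pow_mul, rho_pow_six (sq_nonneg σ), div_pow, mul_pow, sq_abs]
    norm_num
  exact (pow_left_inj₀ (pow_nonneg (rho_pos hB (by positivity)).le 3) (by positivity)
    two_ne_zero).1 h1

/-- The absolute bias of the traditional estimator for `n = 1`. -/
noncomputable def optBias (B σ : ℝ) : ℝ := |B| * rho (B, σ ^ 2) ^ 2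

theorem optBias_pos {B σ : ℝ} (hB : B ≠ 0) (hσ : 0 < σ) : 0 < optBias B σ :=
  mul_pos (abs_pos.2 hB) (pow_pos (rho_pos hB (by positivity)) 2)

theorem optBias_cube {B σ : ℝ} (hB : B ≠ 0) : optBias B σ ^ 3 = |B| * σ ^ 2 / 4 := by
  have hB' : 0 < |B| := abs_pos.2 hB
  rw [optBias, mul_pow, ← pow_mul, rho_pow_six (sq_nonneg σ), ← sq_abs B]
  field_simp

theorem inv_rho {B σ : ℝ} (hB : B ≠ 0) (hσ : 0 < σ) :
    (rho (B, σ ^ 2))⁻¹ = 2 / σ * optBias B σ := by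
  have hB' : 0 < |B| := abs_pos.2 hB
  have h0 := rho_pos hB (show 0 < σ ^ 2 by positivity)
  have h1 := rho_pow_three hB hσ
  rw [eq_div_iff (by positivity)] at h1
  refine inv_eq_of_mul_eq_one_right ?_
  rw [optBias]
  field_simp
  linear_combination h1

theorem optVar_eq {B σ : ℝ} (hB : B ≠ 0) (hσ : 0 < σ) :
    (rho (B, σ ^ 2) ^ 2)⁻¹ * (σ ^ 2 / 2) = 2 * optBias B σ ^ 2 := by
  rw [← inv_pow, inv_rho hB hσ]
  field_simp

theorem cube_root_bias {B σ : ℝ} (hB : B ≠ 0) (hσ : 0 < σ) {n : ℕ} (hn : 0 < n) :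
    (|B| * σ ^ 2 / (4 * n)) ^ (1 / 3 : ℝ) = sampleScale n ^ 2 * optBias B σ := by
  have h1 := sampleScale_pow hn
  have hn' : (n : ℝ) ≠ 0 := by positivity
  refine rpow_third (mul_nonneg (sq_nonneg _) (optBias_pos hB hσ).le) ?_
  rw [mul_pow, optBias_cube hB]
  field_simp
  linear_combination h1

theorem cube_root_var {B σ : ℝ} (hB : B ≠ 0) (hσ : 0 < σ) {n : ℕ} (hn : 0 < n) :
    (B ^ 2 * σ ^ 4 / (2 * (n : ℝ) ^ 2)) ^ (1 / 3 : ℝ)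
      = sampleScale n ^ 4 * (2 * optBias B σ ^ 2) := by
  have h1 := sampleScale_pow hn
  have h2 := optBias_cube (σ := σ) hB
  have hn' : (n : ℝ) ≠ 0 := by positivity
  have hb := optBias_pos hB hσ
  refine rpow_third (by positivity) ?_
  have e : (sampleScale n ^ 4 * (2 * optBias B σ ^ 2)) ^ 3
      = 8 * (sampleScale n ^ 6) ^ 2 * (optBias B σ ^ 3) ^ 2 := by ring
  have h3 : sampleScale n ^ 6 = (n : ℝ)⁻¹ := by field_simp; linear_combination h1
  rw [e, h2, h3, div_pow, mul_pow, sq_abs]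
  field_simp
  norm_num

theorem cube_root_mse {B σ : ℝ} (hB : B ≠ 0) (hσ : 0 < σ) {n : ℕ} (hn : 0 < n) :
    (B ^ 2 * σ ^ 4 / (16 * (n : ℝ) ^ 2)) ^ (1 / 3 : ℝ) = sampleScale n ^ 4 * optBias B σ ^ 2 := by
  have h1 := sampleScale_pow hn
  have h2 := optBias_cube (σ := σ) hB
  have hn' : (n : ℝ) ≠ 0 := by positivity
  have hb := optBias_pos hB hσ
  refine rpow_third (by positivity) ?_
  have e : (sampleScale n ^ 4 * optBias B σ ^ 2) ^ 3
      = (sampleScale n ^ 6) ^ 2 * (optBias B σ ^ 3) ^ 2 := by ring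
  have h3 : sampleScale n ^ 6 = (n : ℝ)⁻¹ := by field_simp; linear_combination h1
  rw [e, h2, h3, div_pow, mul_pow, sq_abs]
  field_simp
  norm_num

theorem cbrt_bias {B σ : ℝ} (hB : B ≠ 0) (hσ : 0 < σ) {n : ℕ} (hn : 0 < n) :
    cbrt (B * σ ^ 2 / (4 * n)) = sampleScale n ^ 2 * (Real.sign B * optBias B σ) := by
  have hn' : (0 : ℝ) < n := by positivity
  have e : |B * σ ^ 2 / (4 * n)| = |B| * σ ^ 2 / (4 * n) := by
    rw [abs_div, abs_mul, abs_of_nonneg (sq_nonneg σ), abs_of_pos (by positivity : 0 < 4 * (n : ℝ))]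
  have hsign : Real.sign (B * σ ^ 2 / (4 * n)) = Real.sign B := by
    rcases lt_or_gt_of_ne hB with h | h
    · rw [Real.sign_of_neg h, Real.sign_of_neg]
      exact div_neg_of_neg_of_pos (mul_neg_of_neg_of_pos h (by positivity)) (by positivity)
    · rw [Real.sign_of_pos h, Real.sign_of_pos (by positivity)]
  rw [cbrt, e, cube_root_bias hB hσ hn, hsign]
  ring

theorem mul_rho_sq (B σ : ℝ) : B * rho (B, σ ^ 2) ^ 2 = Real.sign B * optBias B σ := by
  have h : Real.sign B * |B| = B := by
    rcases lt_trichotomy B 0 with h | rfl | h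
    · rw [Real.sign_of_neg h, abs_of_neg h]; ring
    · simp
    · rw [Real.sign_of_pos h, abs_of_pos h, one_mul]
  rw [optBias, ← mul_assoc, h]

theorem isLittleO_of_tendsto_inv_mul {f u : ℕ → ℝ} (hu : ∀ᶠ m in atTop, 0 < u m)
    (h : Tendsto (fun m => (u m)⁻¹ * f m) atTop (𝓝 0)) : f =o[atTop] u := by
  refine (isLittleO_iff_tendsto' (hu.mono fun m hm h0 => absurd h0 hm.ne')).2 (h.congr fun m => ?_)
  rw [div_eq_inv_mul]

/-- An inequality between limits of normalized sequences is an inequality between the sequences,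
up to an error of smaller order. -/
theorem exists_isLittleO_le {f g u : ℕ → ℝ} {x y : ℝ} (hu : ∀ᶠ m in atTop, 0 < u m)
    (hf : Tendsto (fun m => (u m)⁻¹ * f m) atTop (𝓝 x))
    (hg : Tendsto (fun m => (u m)⁻¹ * g m) atTop (𝓝 y)) (hxy : x ≤ y) :
    ∃ e : ℕ → ℝ, (e =o[atTop] u) ∧ ∀ m, f m ≤ g m + e m := by
  refine ⟨fun m => max (f m - g m) 0, isLittleO_of_tendsto_inv_mul hu ?_, fun m => ?_⟩
  · have h := (hf.sub hg).max (tendsto_const_nhds (x := (0 : ℝ)))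
    rw [max_eq_right (by linarith)] at h
    refine h.congr' ?_
    filter_upwards [hu] with m hm
    rw [mul_max_of_nonneg _ _ (inv_pos.2 hm).le, mul_zero, mul_sub]
  · have := le_max_left (f m - g m) 0
    linarith

section

set_option linter.unusedSectionVars false

variable {S : Type*} [MeasurableSpace S] {P : Measure S} [IsProbabilityMeasure P]
  {Y : ℝ → S → ℝ} {θ₀ : ℝ} {K : ℕ} {c : Fin K → ℝ} {Ω : Type*} [MeasurableSpace Ω]
  {μ : Measure Ω} [IsProbabilityMeasure μ] {ξ : Run K → Ω → S} {B σ ε : ℝ} {n nb : ℕ → ℕ}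

/-- Uniform integrability on the event of bad pilot estimates makes this event negligible. -/
theorem Sim.bad_null (H : Sim P Y θ₀ c μ ξ) (hB : B = coefB Y P θ₀) (hσ : σ = sd Y P θ₀)
    (hε : 0 < ε) (hnb : Tendsto nb atTop atTop) {f : ℕ → Ω → ℝ} (hf : ∀ m, Measurable (f m))
    {M : ℕ} (hUI : UnifIntegrable (fun m =>
      {ω | (pilotDelta Y θ₀ c (nb (M + m)) fun r => ξ r ω) ∉
        goodSet c (nb (M + m)) B (σ ^ 2) ε}.indicator (f (M + m))) 2 μ) :
    LpNull μ 2 fun m =>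
      {ω | (pilotDelta Y θ₀ c (nb m) fun r => ξ r ω) ∉ goodSet c (nb m) B (σ ^ 2) ε}.indicator
        (f m) := by
  have hs : ∀ m, MeasurableSet {ω | (pilotDelta Y θ₀ c (nb m) fun r => ξ r ω) ∉
      goodSet c (nb m) B (σ ^ 2) ε} := fun m =>
    H.measurable_sample (nb m) (measurableSet_goodSet c (nb m) B (σ ^ 2) ε).compl
  refine ⟨fun m => ((hf m).indicator (hs m)).aestronglyMeasurable,
    ENNReal.tendsto_nhds_zero.2 fun η hη => ?_⟩
  obtain ⟨κ, hκ, hκη⟩ := ENNReal.lt_iff_exists_nnreal_btwn.1 hη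
  obtain ⟨δ, hδ, h⟩ := hUI (show (0 : ℝ) < κ by simpa using hκ)
  have hb := (H.tendsto_bad (s := σ ^ 2) hB (by rw [hσ]) hε).comp hnb
  filter_upwards [hb.eventually_le_const (show (0 : ℝ≥0∞) < ENNReal.ofReal δ by simpa using hδ),
    eventually_ge_atTop M] with m hm hMm
  obtain ⟨j, rfl⟩ := Nat.exists_eq_add_of_le hMm
  have := h j _ (hs (M + j)) hm
  rw [Set.indicator_indicator, Set.inter_self] at this
  exact this.trans (by simpa using hκη.le)

theorem memLp_of_affine {X Z e : Ω → ℝ} {u a b : ℝ} (hu : u ≠ 0) (hZ : MemLp Z 2 μ)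
    (he : MemLp e 2 μ) (h : ∀ ω, u⁻¹ * (X ω - a) = b + Z ω + e ω) : MemLp X 2 μ := by
  have hX : X = fun ω => u * (b + Z ω + e ω) + a := by
    ext ω
    rw [← h ω]
    field_simp
    ring
  rw [hX]
  exact ((((memLp_const b).add hZ).add he).const_mul u).add (memLp_const a)

/-- The limits of the normalized bias and variance, and the existence of the moments. -/
theorem Sim.limit_moments (H : Sim P Y θ₀ c μ ξ) (hB : B = coefB Y P θ₀) (hσ : σ = sd Y P θ₀)
    (hσ0 : 0 < σ) (hε : 0 < ε) (hεB : ε < |B|) (hεs : ε < σ ^ 2)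
    (hn : Tendsto n atTop atTop) (hnb : Tendsto nb atTop atTop) (hnbn : ∀ m, K * nb m ≤ n m)
    (hbad : LpNull μ 2 fun m =>
      {ω | (pilotDelta Y θ₀ c (nb m) fun r => ξ r ω) ∉ goodSet c (nb m) B (σ ^ 2) ε}.indicator
        fun ω => (sampleScale (n m) ^ 2)⁻¹ *
          (corCFD Y θ₀ c (n m) (nb m) (fun r => ξ r ω) - deriv (perf Y P) θ₀)) :
    (∀ᶠ m in atTop, MemLp (fun ω => corCFD Y θ₀ c (n m) (nb m) fun r => ξ r ω) 2 μ) ∧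
    ∀ r : ℝ, 0 ≤ r → Tendsto (fun m => (K * nb m : ℝ) / n m) atTop (𝓝 r) →
      Tendsto (fun m => (sampleScale (n m) ^ 2)⁻¹ *
        (∫ ω, corCFD Y θ₀ c (n m) (nb m) (fun r => ξ r ω) ∂μ - deriv (perf Y P) θ₀)) atTop
        (𝓝 (optBias B σ * (Real.sign B + Real.sqrt (r / K) * (2 / σ) *
          (coefD Y P θ₀ * Lam c)))) ∧
      Tendsto (fun m => (sampleScale (n m) ^ 4)⁻¹ *
        variance (fun ω => corCFD Y θ₀ c (n m) (nb m) fun r => ξ r ω) μ) atTop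
        (𝓝 (2 * optBias B σ ^ 2 * (1 - r + r / K * ∑ k, projAbs c k ^ 2 / c k ^ 2))) := by
  have hK : (0 : ℝ) < K := by exact_mod_cast H.K_pos
  have hB0 : B ≠ 0 := by rintro rfl; simp at hεB; linarith
  obtain ⟨err, herr, hX⟩ := H.expansion hB (s := σ ^ 2) (by rw [hσ]) hε hεB hεs hn hnb hnbn hbad
  have hlead := H.leadNoise_moments (B := B) hε hεB hεs hn hnb hnbn
  have hu : ∀ᶠ m in atTop, 0 < sampleScale (n m) :=
    (hn.eventually_gt_atTop 0).mono fun m hm => sampleScale_pos hm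
  have hL2 : ∀ᶠ m in atTop, MemLp (fun ω => corCFD Y θ₀ c (n m) (nb m) fun r => ξ r ω) 2 μ := by
    filter_upwards [hlead, hX, herr.memLp, hu] with m hl hX he hu
    exact memLp_of_affine (pow_pos hu 2).ne' hl.1 he hX
  refine ⟨hL2, fun r hr hlim => ?_⟩
  have hratio : Tendsto (fun m => (nb m : ℝ) / n m) atTop (𝓝 (r / K)) := by
    refine (hlim.div_const (K : ℝ)).congr fun m => ?_
    field_simp
  have hq : Tendsto (fun m => ratioScale (n m) (nb m)) atTop (𝓝 (Real.sqrt (r / K))) := by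
    refine (hratio.sqrt).congr' ?_
    filter_upwards [hn.eventually_gt_atTop 0, hnb.eventually_gt_atTop 0] with m hm hN
    rw [← ratioScale_sq hm hN, Real.sqrt_sq (ratioScale_pos hm hN).le]
  have hb : Tendsto (fun m => B * rho (B, σ ^ 2) ^ 2 + ratioScale (n m) (nb m) *
      (rho (B, σ ^ 2))⁻¹ * (coefD Y P θ₀ * Lam c)) atTop
      (𝓝 (optBias B σ * (Real.sign B + Real.sqrt (r / K) * (2 / σ) *
          (coefD Y P θ₀ * Lam c)))) := by
    have h := ((hq.mul_const (rho (B, σ ^ 2))⁻¹).mul_const (coefD Y P θ₀ * Lam c)).const_add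
      (B * rho (B, σ ^ 2) ^ 2)
    convert! h using 2
    rw [mul_rho_sq, inv_rho hB0 hσ0]
    ring
  have hv : Tendsto (fun m => (1 - K * ((nb m : ℝ) / n m)) *
        freshVar P Y θ₀ c ξ μ (n m) (nb m) B (σ ^ 2) ε
      + (nb m : ℝ) / n m * (rho (B, σ ^ 2) ^ 2)⁻¹ *
        ∑ k, projAbs c k ^ 2 / c k ^ 2 * noiseVar Y P θ₀ (pilotPert c (nb m) k)) atTop
      (𝓝 (2 * optBias B σ ^ 2 * (1 - r + r / K * ∑ k, projAbs c k ^ 2 / c k ^ 2))) := by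
    have h1 := H.tendsto_freshVar hB (s := σ ^ 2) (by rw [hσ]) hε hεB hεs hn hnb
    have h2 : Tendsto (fun m => ∑ k, projAbs c k ^ 2 / c k ^ 2 *
        noiseVar Y P θ₀ (pilotPert c (nb m) k)) atTop
        (𝓝 (∑ k, projAbs c k ^ 2 / c k ^ 2 * (σ ^ 2 / 2))) := by
      refine tendsto_finsetSum _ fun k _ => Tendsto.const_mul _ ?_
      rw [hσ]
      exact (H.tendsto_noiseVar_pilot k).comp hnb
    have h3 := ((((hratio.const_mul (K : ℝ)).const_sub 1).mul h1)).add
      ((hratio.mul_const (rho (B, σ ^ 2) ^ 2)⁻¹).mul h2)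
    convert! h3 using 2
    rw [← Finset.sum_mul, ← optVar_eq hB0 hσ0]
    field_simp
  obtain ⟨m1, m2⟩ := tendsto_moments hb (hlead.mono fun m h => h.1) (hlead.mono fun m h => h.2.1)
    (hlead.mono fun m h => h.2.2) hv herr hX
  refine ⟨m1.congr' ?_, m2.congr' ?_⟩
  · filter_upwards [hL2] with m hm
    rw [integral_const_mul, integral_sub (hm.integrable one_le_two) (integrable_const _)]
    simp
  · filter_upwards [hL2] with m hm
    rw [variance_const_mul, variance_sub_const hm.1]
    congr 1
    rw [inv_pow, ← pow_mul]

end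

end CorCFD

theorem proposition1
    -- the simulation model
    {S : Type*} [MeasurableSpace S] (P : Measure S) [IsProbabilityMeasure P]
    (Y : ℝ → S → ℝ) (hY : Measurable (Function.uncurry Y)) (θ₀ : ℝ)
    (hYL2 : ∀ᶠ θ in 𝓝 θ₀, MemLp (Y θ) 2 P)
    -- smoothness of the performance measure
    (hα : ContDiffAt ℝ 5 (CorCFD.perf Y P) θ₀)
    (hα3 : iteratedDeriv 3 (CorCFD.perf Y P) θ₀ ≠ 0)
    (hα5 : iteratedDeriv 5 (CorCFD.perf Y P) θ₀ ≠ 0)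
    -- the noise
    (hσ : ContinuousAt (CorCFD.sd Y P) θ₀) (hσpos : 0 < CorCFD.sd Y P θ₀)
    (hν₄ : limsup (fun h : ℝ =>
      ∫⁻ p, ENNReal.ofReal ((h * CorCFD.cfdNoise Y P θ₀ h p) ^ 4) ∂(P.prod P)) (𝓝[≠] 0) < ⊤)
    -- the coefficients of the pilot perturbations
    {K : ℕ} (hK : 2 ≤ K) (c : Fin K → ℝ) (hc0 : ∀ k, c k ≠ 0) (hc : Function.Injective c)
    (hcsq : ∃ j k, c j ^ 2 ≠ c k ^ 2)
    -- the random inputs of the independent simulation runs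
    {Ω : Type*} [MeasurableSpace Ω] (μ : Measure Ω) [IsProbabilityMeasure μ]
    (ξ : CorCFD.Run K → Ω → S) (hξ : ∀ i, Measurable (ξ i))
    (hξlaw : ∀ i, μ.map (ξ i) = P) (hξindep : iIndepFun ξ μ)
    -- the sample sizes
    (n nb : ℕ → ℕ) (hn : Tendsto n atTop atTop) (hnb : Tendsto nb atTop atTop)
    (hnbn : ∀ m, K * nb m ≤ n m)
    -- the constants
    (a B D σ : ℝ) (ha : a = deriv (CorCFD.perf Y P) θ₀) (hB : B = CorCFD.coefB Y P θ₀)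
    (hD : D = CorCFD.coefD Y P θ₀) (hσ₀ : σ = CorCFD.sd Y P θ₀)
    -- the Cor-CFD estimator and the pilot estimators of `B` and `σ²(θ₀)`
    (est Bhat vhat : ℕ → Ω → ℝ)
    (hest : ∀ m ω, est m ω = CorCFD.corCFD Y θ₀ c (n m) (nb m) (fun i => ξ i ω))
    (hBhat : ∀ m ω, Bhat m ω = CorCFD.betaE (CorCFD.pilotPert c (nb m))
      (CorCFD.pilotDelta Y θ₀ c (nb m) fun i => ξ i ω) 1)
    (hvhat : ∀ m ω, vhat m ω = CorCFD.betaV (CorCFD.pilotPert c (nb m))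
      (CorCFD.pilotDelta Y θ₀ c (nb m) fun i => ξ i ω))
    -- uniform integrability, for large sample sizes, of the squared normalized errors on the
    -- events that one of the two pilot estimators is off by at least some fixed `ε`
    (hUI : ∃ ε : ℝ, 0 < ε ∧ ε < |B| ∧ ε < σ ^ 2 ∧ ∃ M : ℕ, UniformIntegrable
      (fun m => {ω | ε ≤ |Bhat (M + m) ω - B| ∨ ε ≤ |vhat (M + m) ω - σ ^ 2|}.indicator
        fun ω => (n (M + m) : ℝ) ^ (1 / 3 : ℝ) * (est (M + m) ω - a)) 2 μ) :
    -- the moments below exist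
    (∀ᶠ m in atTop, MemLp (est m) 2 μ) ∧
    -- 1. a vanishing fraction of pilot samples
    (((fun m => (nb m : ℝ)) =o[atTop] fun m => (n m : ℝ)) →
      ((fun m => ∫ ω, est m ω ∂μ - (a + CorCFD.cbrt (B * σ ^ 2 / (4 * n m))))
          =o[atTop] fun m => (n m : ℝ) ^ (-(1 / 3) : ℝ)) ∧
      ((fun m => variance (est m) μ - (B ^ 2 * σ ^ 4 / (2 * (n m : ℝ) ^ 2)) ^ (1 / 3 : ℝ))
          =o[atTop] fun m => (n m : ℝ) ^ (-(2 / 3) : ℝ)) ∧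
      ((fun m => ∫ ω, (est m ω - a) ^ 2 ∂μ
            - 3 * (B ^ 2 * σ ^ 4 / (16 * (n m : ℝ) ^ 2)) ^ (1 / 3 : ℝ))
          =o[atTop] fun m => (n m : ℝ) ^ (-(2 / 3) : ℝ))) ∧
    -- 2. and 3. a non-vanishing fraction of pilot samples
    (∀ r : ℝ, 0 < r → r ≤ 1 →
      Tendsto (fun m => (K * nb m : ℝ) / n m) atTop (𝓝 r) →
      ((-1 - Real.sign B ≤ Real.sqrt (r / K) * (2 / σ) * (D * CorCFD.Lam c) ∧
          Real.sqrt (r / K) * (2 / σ) * (D * CorCFD.Lam c) ≤ 1 - Real.sign B) →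
        ∃ e : ℕ → ℝ, (e =o[atTop] fun m => (n m : ℝ) ^ (-(1 / 3) : ℝ)) ∧
          ∀ m, |∫ ω, est m ω ∂μ - a| ≤ (|B| * σ ^ 2 / (4 * n m)) ^ (1 / 3 : ℝ) + e m) ∧
      (¬ (-1 - Real.sign B ≤ Real.sqrt (r / K) * (2 / σ) * (D * CorCFD.Lam c) ∧
          Real.sqrt (r / K) * (2 / σ) * (D * CorCFD.Lam c) ≤ 1 - Real.sign B) →
        ∃ e : ℕ → ℝ, (e =o[atTop] fun m => (n m : ℝ) ^ (-(1 / 3) : ℝ)) ∧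
          ∀ m, |∫ ω, est m ω ∂μ - a| ≤
            (1 + Real.sqrt (r / K) * (2 / σ) * |D * CorCFD.Lam c|) *
              (|B| * σ ^ 2 / (4 * n m)) ^ (1 / 3 : ℝ) + e m) ∧
      ((∀ j k, c j ^ 2 ≤ 2 * c k ^ 2) →
        ∃ e : ℕ → ℝ, (e =o[atTop] fun m => (n m : ℝ) ^ (-(2 / 3) : ℝ)) ∧
          ∀ m, variance (est m) μ ≤
            (B ^ 2 * σ ^ 4 / (2 * (n m : ℝ) ^ 2)) ^ (1 / 3 : ℝ) + e m)) := by
  have H : CorCFD.Sim P Y θ₀ c μ ξ := ⟨hY, hYL2, hα, hσ, hν₄, hc0, hcsq, hξ, hξlaw, hξindep⟩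
  have hσ0 : 0 < σ := hσ₀ ▸ hσpos
  have hB0 : B ≠ 0 := by
    rw [hB]
    exact div_ne_zero hα3 (by norm_num)
  obtain rfl : est = fun m ω => CorCFD.corCFD Y θ₀ c (n m) (nb m) fun i => ξ i ω :=
    funext fun m => funext (hest m)
  obtain rfl : Bhat = fun m ω => CorCFD.betaE (CorCFD.pilotPert c (nb m))
      (CorCFD.pilotDelta Y θ₀ c (nb m) fun i => ξ i ω) 1 :=
    funext fun m => funext (hBhat m)
  obtain rfl : vhat = fun m ω => CorCFD.betaV (CorCFD.pilotPert c (nb m))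
      (CorCFD.pilotDelta Y θ₀ c (nb m) fun i => ξ i ω) :=
    funext fun m => funext (hvhat m)
  subst ha
  subst hD
  obtain ⟨ε, hε, hεB, hεs, M, hU⟩ := hUI
  have hset : ∀ m, {ω | ε ≤ |CorCFD.betaE (CorCFD.pilotPert c (nb m))
        (CorCFD.pilotDelta Y θ₀ c (nb m) fun i => ξ i ω) 1 - B| ∨
      ε ≤ |CorCFD.betaV (CorCFD.pilotPert c (nb m))
        (CorCFD.pilotDelta Y θ₀ c (nb m) fun i => ξ i ω) - σ ^ 2|} =
      {ω | (CorCFD.pilotDelta Y θ₀ c (nb m) fun r => ξ r ω) ∉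
        CorCFD.goodSet c (nb m) B (σ ^ 2) ε} := fun m => by
    ext ω
    simp only [CorCFD.goodSet, CorCFD.goodBox, CorCFD.pilotEst, Set.mem_ofPred_eq, not_and_or,
      not_lt]
  simp only [hset, CorCFD.inv_sampleScale_sq] at hU
  have hbad := H.bad_null hB hσ₀ hε hnb (f := fun m ω => (CorCFD.sampleScale (n m) ^ 2)⁻¹ *
    (CorCFD.corCFD Y θ₀ c (n m) (nb m) (fun r => ξ r ω) - deriv (CorCFD.perf Y P) θ₀))
    (fun m => ((H.measurable_corCFD (n m) (nb m)).sub_const _).const_mul _) hU.2.1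
  obtain ⟨hL2, hlim⟩ := H.limit_moments hB hσ₀ hσ0 hε hεB hεs hn hnb hnbn hbad
  have hpos := hn.eventually_gt_atTop 0
  have hu2 : ∀ᶠ m in atTop, 0 < CorCFD.sampleScale (n m) ^ 2 :=
    hpos.mono fun m hm => pow_pos (CorCFD.sampleScale_pos hm) 2
  have hu4 : ∀ᶠ m in atTop, 0 < CorCFD.sampleScale (n m) ^ 4 :=
    hpos.mono fun m hm => pow_pos (CorCFD.sampleScale_pos hm) 4
  have hb0 := CorCFD.optBias_pos hB0 hσ0
  have hK0 : (0 : ℝ) < K := by exact_mod_cast H.K_pos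
  simp only [CorCFD.sampleScale_sq, CorCFD.sampleScale_pow_four]
  refine ⟨hL2, fun hno => ?_, fun r hr hr1 hrlim => ?_⟩
  · have hr0 : Tendsto (fun m => (K * nb m : ℝ) / n m) atTop (𝓝 0) := by
      have := hno.tendsto_div_nhds_zero.const_mul (K : ℝ)
      simpa only [mul_zero, mul_div_assoc] using this
    obtain ⟨h1, h2⟩ := hlim 0 le_rfl hr0
    simp only [zero_div, Real.sqrt_zero, zero_mul, add_zero, sub_zero, mul_one] at h1 h2
    refine ⟨CorCFD.isLittleO_of_tendsto_inv_mul hu2 ?_,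
      CorCFD.isLittleO_of_tendsto_inv_mul hu4 ?_, CorCFD.isLittleO_of_tendsto_inv_mul hu4 ?_⟩
    · have := h1.sub_const (CorCFD.optBias B σ * Real.sign B)
      rw [sub_self] at this
      refine this.congr' ?_
      filter_upwards [hpos] with m hm
      have hu := CorCFD.sampleScale_pos hm
      rw [CorCFD.cbrt_bias hB0 hσ0 hm]
      field_simp
      ring
    · have := h2.sub_const (2 * CorCFD.optBias B σ ^ 2)
      rw [sub_self] at this
      refine this.congr' ?_
      filter_upwards [hpos] with m hm
      have hu := CorCFD.sampleScale_pos hm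
      rw [CorCFD.cube_root_var hB0 hσ0 hm]
      field_simp
    · have := (h2.add (h1.pow 2)).sub_const (3 * CorCFD.optBias B σ ^ 2)
      have hs : Real.sign B ^ 2 = 1 := by
        rcases Real.sign_apply_eq_of_ne_zero B hB0 with h | h <;> rw [h] <;> norm_num
      rw [mul_pow, hs, show 2 * CorCFD.optBias B σ ^ 2 + CorCFD.optBias B σ ^ 2 * 1
        - 3 * CorCFD.optBias B σ ^ 2 = 0 by ring] at this
      refine this.congr' ?_
      filter_upwards [hpos, hL2] with m hm hL
      have hu := CorCFD.sampleScale_pos hm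
      have hv := variance_eq_sub (hL.sub (memLp_const (deriv (CorCFD.perf Y P) θ₀)))
      have hv' := variance_sub_const hL.1 (deriv (CorCFD.perf Y P) θ₀)
      have hi : ∫ ω, (CorCFD.corCFD Y θ₀ c (n m) (nb m) (fun r => ξ r ω)
          - deriv (CorCFD.perf Y P) θ₀) ∂μ
          = ∫ ω, CorCFD.corCFD Y θ₀ c (n m) (nb m) (fun r => ξ r ω) ∂μ
            - deriv (CorCFD.perf Y P) θ₀ := by
        rw [integral_sub (hL.integrable one_le_two) (integrable_const _)]
        simp
      simp only [Pi.pow_apply, Pi.sub_apply] at hv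
      rw [hi] at hv
      have hmse := hv'.symm.trans hv
      rw [CorCFD.cube_root_mse hB0 hσ0 hm, hmse]
      field_simp
      ring
  · obtain ⟨h1, h2⟩ := hlim r hr.le hrlim
    have hbias : Tendsto (fun m => (CorCFD.sampleScale (n m) ^ 2)⁻¹ *
        (|B| * σ ^ 2 / (4 * n m)) ^ (1 / 3 : ℝ)) atTop (𝓝 (CorCFD.optBias B σ)) := by
      refine tendsto_const_nhds.congr' ?_
      filter_upwards [hpos, hu2] with m hm hu
      rw [CorCFD.cube_root_bias hB0 hσ0 hm, inv_mul_cancel_left₀ hu.ne']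
    have habs := h1.abs
    have habs' : Tendsto (fun m => (CorCFD.sampleScale (n m) ^ 2)⁻¹ *
        |∫ ω, CorCFD.corCFD Y θ₀ c (n m) (nb m) (fun r => ξ r ω) ∂μ
          - deriv (CorCFD.perf Y P) θ₀|) atTop (𝓝 (CorCFD.optBias B σ * |Real.sign B
            + Real.sqrt (r / K) * (2 / σ) * (CorCFD.coefD Y P θ₀ * CorCFD.Lam c)|)) := by
      rw [abs_mul, abs_of_pos hb0] at habs
      refine habs.congr' ?_
      filter_upwards [hu2] with m hu
      rw [abs_mul, abs_of_pos (inv_pos.2 hu)]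
    refine ⟨fun hcond => ?_, fun _ => ?_, fun hratio => ?_⟩
    · refine CorCFD.exists_isLittleO_le hu2 habs' hbias ?_
      refine mul_le_of_le_one_right hb0.le (abs_le.2 ⟨?_, ?_⟩) <;> linarith [hcond.1, hcond.2]
    · have hg := hbias.const_mul (1 + Real.sqrt (r / K) * (2 / σ) *
        |CorCFD.coefD Y P θ₀ * CorCFD.Lam c|)
      refine CorCFD.exists_isLittleO_le hu2 habs' (hg.congr fun m => by ring) ?_
      rw [mul_comm]
      refine mul_le_mul_of_nonneg_right ((abs_add_le _ _).trans (add_le_add ?_ ?_)) hb0.le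
      · rcases Real.sign_apply_eq_of_ne_zero B hB0 with h | h <;> rw [h] <;> norm_num
      · rw [abs_mul, abs_of_nonneg (by positivity : 0 ≤ Real.sqrt (r / K) * (2 / σ))]
    · refine CorCFD.exists_isLittleO_le hu4 h2 (y := 2 * CorCFD.optBias B σ ^ 2) ?_ ?_
      · refine tendsto_const_nhds.congr' ?_
        filter_upwards [hpos, hu4] with m hm hu
        rw [CorCFD.cube_root_var hB0 hσ0 hm, inv_mul_cancel_left₀ hu.ne']
      · refine mul_le_of_le_one_right (by positivity) ?_
        have hQ := mul_le_mul_of_nonneg_left (CorCFD.sum_projAbs_sq_div_le hc0 hcsq hratio)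
          (show 0 ≤ r / K by positivity)
        rw [div_mul_cancel₀ r hK0.ne'] at hQ
        linarith
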